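/- **Model.** There are $K\ge 2$ arms. The mean rewards $\mu_1,\dots,\mu_K\in[0,1]$ are drawn independently, $\mu_i\sim\mathcal P_i$, and given them the successive rewards (samples) of arm $i$ are i.i.d. Bernoulli$(\mu_i)$, independently across the arms. Arms are ordered so that $\mathbb E[\mu_1]\ge\dots\ge\mathbb E[\mu_K]$, and pairwise non-dominance holds: $\Pr[\mu_j<\mathbb E[\mu_i]]>0$ for all $i\neq j$. A random recommendation $A$ is *BIC* if $\mathbb E[\mu_i-\mu_j\mid A=i]\ge 0$ for all arms $i,j$ with $\Pr[A=i]>0$; an algorithm is BIC if its recommendation in each of its rounds is BIC (when earlier recommendations have been followed). **Parameters.** Let $\mathrm{ZEROS}_{j,n}$ be the event that the first $n$ samples of each arm $i<j$ are $0$; let $$G_{pad}=\min_{j\ge 2,\ q\in\Delta_{j-1}}\mathbb E\Big[\big(\mu_j-\textstyle\sum_{i<j}q_i\mu_i\big)_+\Big],\qquad N_{pad}=C_{pad}\,G_{pad}^{-2}\log(G_{pad}^{-1}),$$ $$N_{boot}=\min\{n:\ \mathbb E[\mu_j-\mu_i\mid \mathrm{ZEROS}_{j,n}]>0\ \ \forall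 i<j\},\qquad p_{boot}=\min_j\Pr[\mathrm{ZEROS}_{j,N_{boot}}],$$ where $\Delta_{j-1}$ is the set of distributions over arms $1,\dots,j-1$. **Policies.** A (randomized) policy $\pi$ is *$(j,\lambda,N)$-suitable* if it is BIC, its input is the first $N$ samples of each arm $i\le j$, and $\mathbb E[(\mu_j-\mu_i)\mathbf 1\{\pi=j\}]\ge\lambda$ for each $i<j$. To *exploit* given some data is to choose the arm with the largest posterior mean reward among all $K$ arms (smallest index in case of ties). A *fake-data coupling* for arm $i<j$ maps the first $N$ samples of arm $i$, with extra randomness, to $N$ fake samples, so that conditionally on the first $N_0$ samples of arm $i$ being $0$, the fake samples have the unconditional law of the first $N$ samples of arm $i$, and the posterior mean of $\mu_i$ given the fake samples is a.s. at least the one given the true samples. Given such couplings, $\mathrm{transform}(\pi_j)$ applies $\pi_j$ to fake samples of the arms $i<j$ (drawn independently across arms) and the true samples of arm $j$; it recommends arm $j$ if $\pi_j$ does, and otherwise exploits given the true first $N$ samples of each arm $i\le j$. **Algorithm** (ExponentialExploration with phase length $N$, bootstrapping parameter $N_0\le N$, padding $\lambda>0$, policies $\pi_2,\dots,\pi_K$).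 Each phase consists of $N$ rounds in which one and the same arm is recommended, and uses fresh randomness. First, one phase plays arm $1$. Then, for $j=2,\dots,K$: 1. Exploit, given the first $N_0$ samples of each arm $i<j$ (one phase). Set $p_j=q/(1+q)$, where $q=\lambda\Pr[\mathrm{ZEROS}_{j,N_0}]$. 2. One phase: with probability $p_j$ play arm $j$ (exploration phase); otherwise use $\mathrm{transform}(\pi_j)$ if $\mathrm{ZEROS}_{j,N_0}$ occurs, and exploit with depth $N$ if not. 3. While $p_j<1$, one phase: if an exploration phase for $j$ has already happened, use $\pi_j$; otherwise, with probability $\min(1,\frac{p_j}{1-p_j}\lambda)$ play arm $j$ (exploration phase), and else exploit with depth $N$. Then set $p_j\leftarrow\min(1,p_j(1+\lambda))$. Exploiting with depth $N$ here means exploiting given the first $N$ samples of each arm $i<j$, and also those of arm $j$ if at least $N$ samples of arm $j$ were collected before the phase. **Theorem 4.4.** There are absolute constants $C_0,C>0$ such that the following holds for every $C_{pad}\ge C_0$, every such problem instance, and every integer $N\ge\max(N_{boot},N_{pad})$. Put $N_0=N_{boot}$ and $\lambda=G_{pad}/10$. Then $G_{pad}>0$, $p_{boot}>0$, and $N_{boot}$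 is well-defined; for each $j\ge2$ there is a $(j,\lambda,N)$-suitable policy, and fake-data couplings exist for all arms $i<j$. For any $(j,\lambda,N)$-suitable policies $\pi_j$ ($j\ge 2$) and any fake-data couplings, ExponentialExploration is BIC, and almost surely it collects at least $N$ samples of each arm within its running time, which is a number $T$ of rounds that is fixed in advance and satisfies $$T\le C\,K\,N\,G_{pad}^{-1}\,\log\!\big(G_{pad}^{-1}\,p_{boot}^{-1}\big).$$ -/

import Mathlib

open MeasureTheory

noncomputable section

namespace IncentivizedExploration

/-- The mean rewards `μ₁, …, μ_K` of one realization of the problem. -/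
abbrev Means (K : ℕ) : Type := Fin K → unitInterval

/-- A realization of the environment: the mean rewards, and for every arm `i` and every `n` a
number in `[0,1]` that is used to produce the `n`-th reward of arm `i`. -/
abbrev World (K : ℕ) : Type := Means K × (Fin K × ℕ → unitInterval)

/-- The internal randomness of an algorithm: a table of numbers in `[0,1]`; row `s` is used in
phase `s`. -/
abbrev Seeds : Type := ℕ × ℕ → unitInterval

/-- The samples collected so far, listed for each arm in the order of collection. -/
abbrev Data (K : ℕ) : Type := Fin K → List Bool

/-- A randomized recommendation policy, as a function of the data and of a random seed
(uniform on `[0,1]`, independent of everything else). -/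
abbrev Policy (K : ℕ) : Type := Data K → unitInterval → Fin K

/-- The law of the environment: `μᵢ ∼ prior i` independently, and independently of that i.i.d.
uniform variables that generate the rewards. -/
def worldLaw {K : ℕ} (prior : Fin K → Measure unitInterval) : Measure (World K) :=
  (Measure.pi prior).prod (Measure.infinitePi fun _ : Fin K × ℕ => (volume : Measure unitInterval))

/-- The law of the internal randomness: i.i.d. uniform variables. -/
def seedLaw : Measure Seeds :=
  Measure.infinitePi fun _ : ℕ × ℕ => (volume : Measure unitInterval)

/-- The `n`-th reward (`n = 0, 1, …`) of arm `i`. Given the mean rewards, these are independent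
and `reward i n` is Bernoulli with mean `μᵢ`. -/
def reward {K : ℕ} (i : Fin K) (n : ℕ) (w : World K) : Bool :=
  decide (w.2 (i, n) < w.1 i)

/-- The first `n` samples of arm `i`. -/
def samples {K : ℕ} (i : Fin K) (n : ℕ) (w : World K) : List Bool :=
  (List.range n).map fun m => reward i m w

/-- The prior mean reward of arm `i`. -/
def priorMean {K : ℕ} (prior : Fin K → Measure unitInterval) (i : Fin K) : ℝ :=
  ∫ x, (x : ℝ) ∂(prior i)

/-- Pairwise non-dominance: `Pr[μⱼ < E[μᵢ]] > 0` for all arms `j ≠ i`. -/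
def PairwiseNonDominance {K : ℕ} (prior : Fin K → Measure unitInterval) : Prop :=
  ∀ i j : Fin K, j ≠ i → 0 < prior j {x | (x : ℝ) < priorMean prior i}

/-- Bayesian incentive-compatibility of a random recommendation `A`:
`E[μᵢ - μⱼ | A = i] ≥ 0` for all arms `i, j` with `Pr[A = i] > 0`. -/
def IsBIC {K : ℕ} {Ω : Type*} [MeasurableSpace Ω] (P : Measure Ω) (μ : Ω → Means K)
    (A : Ω → Fin K) : Prop :=
  ∀ i j : Fin K, 0 < P {ω | A ω = i} →
    0 ≤ ∫ ω, ((μ ω i : ℝ) - (μ ω j : ℝ)) ∂(ProbabilityTheory.cond P {ω | A ω = i})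

/-- The recommendation that `π` makes when its input consists of the first `N` samples of each
arm; the second component is the seed of the policy. -/
def policyArm {K : ℕ} (π : Policy K) (N : ℕ) (p : World K × unitInterval) : Fin K :=
  π (fun i => samples i N p.1) p.2

/-- `π` uses only the first `N` samples of each arm `i ≤ j`. -/
def IsInformed {K : ℕ} (j : Fin K) (N : ℕ) (π : Policy K) : Prop :=
  ∀ d d' : Data K, (∀ i ≤ j, (d i).take N = (d' i).take N) → π d = π d'

/-- `E[(μⱼ - μᵢ) 1{π = j}] ≥ lam` for each arm `i < j`. -/
def IsPaddedBIC {K : ℕ} (prior : Fin K → Measure unitInterval) (j : Fin K) (lam : ℝ) (N : ℕ)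
    (π : Policy K) : Prop :=
  ∀ i < j, lam ≤ ∫ p in {p : World K × unitInterval | policyArm π N p = j},
    ((p.1.1 j : ℝ) - (p.1.1 i : ℝ)) ∂((worldLaw prior).prod volume)

/-- `(j, lam, N)`-suitable policies. -/
structure IsSuitable {K : ℕ} (prior : Fin K → Measure unitInterval) (j : Fin K) (lam : ℝ) (N : ℕ)
    (π : Policy K) : Prop where
  measurable : ∀ d : Data K, Measurable (π d)
  informed : IsInformed j N π
  bic : IsBIC ((worldLaw prior).prod volume) (fun p => p.1.1) (policyArm π N)
  padded : IsPaddedBIC prior j lam N π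

/-- `G_pad`, the minimum of `E[(μⱼ - μ_q)₊]` over the arms `j` other than the first one and the
distributions `q` over the arms `i < j`. -/
def Gpad {K : ℕ} (prior : Fin K → Measure unitInterval) : ℝ :=
  sInf {x : ℝ | ∃ j : Fin K, ∃ q ∈ stdSimplex ℝ (Fin K), (∀ i, j ≤ i → q i = 0) ∧
    x = ∫ w : World K, max ((w.1 j : ℝ) - ∑ i, q i * (w.1 i : ℝ)) 0 ∂(worldLaw prior)}

/-- `N_pad = C_pad G_pad⁻² log (G_pad⁻¹)`. -/
def Npad {K : ℕ} (Cpad : ℝ) (prior : Fin K → Measure unitInterval) : ℝ :=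
  Cpad * ((Gpad prior)⁻¹) ^ 2 * Real.log (Gpad prior)⁻¹

/-- The event that the first `N₀` samples of each arm `i < j` are all `0`. -/
def zeros {K : ℕ} (j : Fin K) (N₀ : ℕ) : Set (World K) :=
  {w | ∀ i < j, ∀ n < N₀, reward i n w = false}

/-- The numbers `N₀` such that `E[μⱼ - μᵢ | zeros j N₀] > 0` for all arms `i < j`. -/
def bootSet {K : ℕ} (prior : Fin K → Measure unitInterval) : Set ℕ :=
  {N₀ | ∀ j i : Fin K, i < j →
    0 < ∫ w, ((w.1 j : ℝ) - (w.1 i : ℝ)) ∂(ProbabilityTheory.cond (worldLaw prior) (zeros j N₀))}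

/-- `N_boot`, the smallest element of `bootSet`. -/
def Nboot {K : ℕ} (prior : Fin K → Measure unitInterval) : ℕ := sInf (bootSet prior)

/-- `p_boot = minⱼ Pr[zeros j N_boot]`. -/
def pboot {K : ℕ} (prior : Fin K → Measure unitInterval) : ℝ :=
  ⨅ j : Fin K, (worldLaw prior).real (zeros j (Nboot prior))

/-! ### Exploitation -/

/-- The event that the first `n` samples of each arm in `S` are those recorded in `d`. -/
def agrees {K : ℕ} (S : Set (Fin K)) (n : ℕ) (d : Data K) : Set (World K) :=
  {w | ∀ i ∈ S, samples i n w = (d i).take n}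

/-- The posterior mean reward of arm `k`, given the first `n` samples of each arm in `S`. -/
def posteriorMean {K : ℕ} (prior : Fin K → Measure unitInterval) (S : Set (Fin K)) (n : ℕ)
    (d : Data K) (k : Fin K) : ℝ :=
  ∫ w, (w.1 k : ℝ) ∂(ProbabilityTheory.cond (worldLaw prior) (agrees S n d))

open Classical in
/-- The arm with the largest value of `f`; ties are broken in favour of the smallest index. -/
def argmaxArm {K : ℕ} [NeZero K] (f : Fin K → ℝ) : Fin K :=
  (Finset.univ.filter fun k => ∀ l, f l ≤ f k).min' (by
    obtain ⟨k, hk⟩ := Finite.exists_max f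
    exact ⟨k, by simpa using hk⟩)

/-- An arm with the largest posterior mean reward, given the first `n` samples of each arm
in `S`. -/
def exploit {K : ℕ} [NeZero K] (prior : Fin K → Measure unitInterval) (S : Set (Fin K)) (n : ℕ)
    (d : Data K) : Fin K :=
  argmaxArm (posteriorMean prior S n d)

open Classical in
/-- Exploitation with depth `N` during the exploration of arm `j`: it conditions on the first `N`
samples of each arm `i < j`, and also on those of arm `j` if they have been collected. -/
def exploitAvailable {K : ℕ} [NeZero K] (prior : Fin K → Measure unitInterval) (j : Fin K) (N : ℕ)
    (d : Data K) : Fin K :=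
  if N ≤ (d j).length then exploit prior (Set.Iic j) N d else exploit prior (Set.Iio j) N d

/-! ### The transformed policy -/

/-- `κ` turns `N` samples of arm `i`, whose first `N₀` are `0`, into `N` "fake" samples of that
arm, with the help of a uniform seed. It is a coupling: conditionally on the first `N₀` samples of
arm `i` being `0`, the fake samples have the unconditional law of the first `N` samples, and their
posterior mean is almost surely at least the one of the true samples. -/
structure IsFakeData {K : ℕ} (prior : Fin K → Measure unitInterval) (N₀ N : ℕ) (i : Fin K)
    (κ : List Bool → unitInterval → List Bool) : Prop where
  measurable : ∀ l l' : List Bool, MeasurableSet {u | κ l u = l'}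
  law : ∀ l : List Bool,
    ((ProbabilityTheory.cond (worldLaw prior) {w | ∀ n < N₀, reward i n w = false}).prod volume)
        {p | κ (samples i N p.1) p.2 = l} =
      worldLaw prior {w | samples i N w = l}
  dominates : ∀ᵐ p ∂((ProbabilityTheory.cond (worldLaw prior)
        {w | ∀ n < N₀, reward i n w = false}).prod (volume : Measure unitInterval)),
    posteriorMean prior {i} N (fun _ => samples i N p.1) i ≤
      posteriorMean prior {i} N (fun _ => κ (samples i N p.1) p.2) i

open Classical in
/-- The policy `transform(πⱼ)`: replace the first `N` samples of each arm `i < j` by fake ones,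
independently across the arms, and apply `πⱼ`. If it recommends arm `j`, then so does
`transform(πⱼ)`; otherwise exploit, given the (true) first `N` samples of each arm `i ≤ j`.
Seed `1` is used by `πⱼ` and seed `2 + i` for the fake samples of arm `i`. -/
def transform {K : ℕ} [NeZero K] (prior : Fin K → Measure unitInterval) (N : ℕ) (j : Fin K)
    (π : Policy K) (κ : Fin K → List Bool → unitInterval → List Bool)
    (d : Data K) (r : ℕ → unitInterval) : Fin K :=
  if π (fun i => if i < j then κ i ((d i).take N) (r (2 + i)) else d i) (r 1) = j then j
  else exploit prior (Set.Iic j) N d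

/-! ### The algorithm -/

/-- The inputs of the algorithm: phase length `N`, bootstrapping parameter `N₀`, padding `lam`,
the policies for the padded phases, and the couplings used by `transform`. -/
structure Params (K : ℕ) where
  N : ℕ
  N₀ : ℕ
  lam : ℝ
  π : Fin K → Policy K
  κ : Fin K → Fin K → List Bool → unitInterval → List Bool

/-- The value of the variable `pⱼ` after `n` iterations of the main loop for arm `j`. -/
def exploreProb {K : ℕ} (prior : Fin K → Measure unitInterval) (N₀ : ℕ) (lam : ℝ) (j : Fin K) :
    ℕ → ℝ
  | 0 => lam * (worldLaw prior).real (zeros j N₀) / (1 + lam * (worldLaw prior).real (zeros j N₀))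
  | n + 1 => min 1 (exploreProb prior N₀ lam j n * (1 + lam))

/-- The number of iterations of the loop `while pⱼ < 1`. -/
def loopLength {K : ℕ} (prior : Fin K → Measure unitInterval) (N₀ : ℕ) (lam : ℝ) (j : Fin K) : ℕ :=
  sInf {n | 1 ≤ exploreProb prior N₀ lam j n}

/-- The positions in the pseudocode at which a phase of `N` rounds is played. -/
inductive Phase (K : ℕ) : Type
  /-- the initial exploration of the first arm -/
  | init : Phase K
  /-- first bootstrapping phase for arm `j` -/
  | boot₁ (j : Fin K) : Phase K
  /-- second bootstrapping phase for arm `j` -/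
  | boot₂ (j : Fin K) : Phase K
  /-- iteration `n` of the main loop for arm `j` -/
  | main (j : Fin K) (n : ℕ) : Phase K

open Classical in
/-- The sequence of the phases in a run of the algorithm. -/
def schedule {K : ℕ} [NeZero K] (prior : Fin K → Measure unitInterval) (N₀ : ℕ) (lam : ℝ) :
    List (Phase K) :=
  Phase.init :: (List.finRange K).flatMap fun j =>
    if j = 0 then [] else
      Phase.boot₁ j :: Phase.boot₂ j ::
        (List.range (loopLength prior N₀ lam j)).map fun n => Phase.main j n

/-- The memory of the algorithm: the samples collected so far, and whether the exploration phase
for the current arm `j` has happened. -/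
structure State (K : ℕ) where
  data : Data K
  explored : Bool

open Classical in
/-- The arm played in a phase, and the new value of the flag "exploration phase has happened".
Seed `0` of the phase is used to flip the coin of the pseudocode. -/
def choose {K : ℕ} [NeZero K] (prior : Fin K → Measure unitInterval) (a : Params K)
    (ph : Phase K) (st : State K) (r : ℕ → unitInterval) : Fin K × Bool :=
  match ph with
  | Phase.init => (0, false)
  | Phase.boot₁ j => (exploit prior (Set.Iio j) a.N₀ st.data, false)
  | Phase.boot₂ j =>
      if (r 0 : ℝ) ≤ exploreProb prior a.N₀ a.lam j 0 then (j, true)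
      else if ∀ i < j, ∀ x ∈ (st.data i).take a.N₀, x = false then
        (transform prior a.N j (a.π j) (a.κ j) st.data r, false)
      else (exploitAvailable prior j a.N st.data, false)
  | Phase.main j n =>
      if st.explored = true then (a.π j st.data (r 1), true)
      else if (r 0 : ℝ) ≤ min 1 (exploreProb prior a.N₀ a.lam j n /
          (1 - exploreProb prior a.N₀ a.lam j n) * a.lam) then (j, true)
      else (exploitAvailable prior j a.N st.data, false)

open Classical in
/-- Play an arm for `N` rounds and record the rewards. -/
def play {K : ℕ} (N : ℕ) (w : World K) (d : Data K) (k : Fin K) : Data K :=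
  fun i => if i = k then d i ++ (List.range N).map (fun m => reward i ((d i).length + m) w) else d i

/-- The decision in phase `s`, given the state at its start. -/
def decision {K : ℕ} [NeZero K] (prior : Fin K → Measure unitInterval) (a : Params K) (s : ℕ)
    (st : State K) (σ : Seeds) : Fin K × Bool :=
  choose prior a ((schedule prior a.N₀ a.lam).getD s Phase.init) st fun m => σ (s, m)

/-- The state at the start of phase `s` (where all recommendations are followed). -/
def stateAt {K : ℕ} [NeZero K] (prior : Fin K → Measure unitInterval) (a : Params K)
    (ω : World K × Seeds) : ℕ → State K
  | 0 => ⟨fun _ => [], false⟩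
  | s + 1 =>
      let st := stateAt prior a ω s
      let c := decision prior a s st ω.2
      ⟨play a.N ω.1 st.data c.1, c.2⟩

/-- The recommendation in round `t = 0, 1, …` of the algorithm ExponentialExploration. -/
def recommendation {K : ℕ} [NeZero K] (prior : Fin K → Measure unitInterval) (a : Params K)
    (t : ℕ) (ω : World K × Seeds) : Fin K :=
  (decision prior a (t / a.N) (stateAt prior a ω (t / a.N)) ω.2).1

/-- The number of rounds of the algorithm: `N` rounds for each phase. -/
def horizon {K : ℕ} [NeZero K] (prior : Fin K → Measure unitInterval) (N N₀ : ℕ) (lam : ℝ) : ℕ :=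
  (schedule prior N₀ lam).length * N

end IncentivizedExploration

end

namespace IncentivizedExploration

section

/-! ### Independence of the arms -/

/-! Multiplying by the probability of the recommendation turns incentive compatibility into the
inequalities E[(μ_i - μ_l) 1{A = i}] ≥ 0 (`isBIC_iff`). These are additive over a partition of the
event {A = i}, so a phase may be split according to the reason for which arm i is played, with the
pieces weighed against each other. All N rounds of a phase share one recommendation, so it suffices
to treat phases.

Three kinds of pieces occur. Exploitation contributes nonnegatively on every event that is
determined by the exploited samples and by independent seeds (`exploit_gap_nonneg`). Here it matters
that the availability of arm j's samples is itself determined by the arms before j and the seeds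
(`Params.Admissible.avail_congr`), so that observing it leaks nothing about arm j. Exploration by a
coin depends on the seeds alone: it costs at most its probability when compared with an earlier arm,
and costs nothing when compared with a later one, since prior means decrease. A suitable policy
earns at least λ against each earlier arm.

The probabilities balance these pieces. At iteration n of the main loop for arm j, exploration has
already happened with probability p_n, independently of the environment. The policy then earns at
least p_n λ, while the coin costs at most (1 - p_n) times its success probability, which was chosen
to be at most p_n λ (`explore_le`, `Params.Admissible.isBIC_main`). At the start nothing has been
explored, but on the event ZEROS the first bootstrapping phase plays arm j
(`Params.Admissible.exploit_zeros`). In the second one, the policy applied to fake data earns at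
least Pr[ZEROS] λ: the arms are independent, the fake samples have the right law, and replacing true
samples by fake ones can only overstate the posterior means of the earlier arms
(`sum_fakeWeight_ge`). The value of p_0 makes this gain equal to the bound on the exploration cost.

Suitable policies come from a minimax argument (`exists_forall_le_sum`). Against a fixed mixture of
the earlier arms, recommend j when its empirical mean beats that of the mixture; this loses at most
1/√N compared with G_pad (`padGap_sub_le`). The fake data come from a quantile coupling along the
number of successes: conditioning on initial zeros makes that number stochastically smaller
(`mul_measureReal_le`), and the posterior mean increases with it (`posteriorMean_single_mono`).

Finally, p_n grows by the factor 1 + λ until it reaches 1, so each arm needs O(λ⁻¹ log(1/p_0))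
phases, and the coin of the last iteration succeeds with certainty. -/

/-- The part of the environment that concerns arm `i`. -/
def arm {K : ℕ} (i : Fin K) (w : World K) : unitInterval × (ℕ → unitInterval) :=
  (w.1 i, fun n => w.2 (i, n))

/-- The list of the first `n` rewards of an arm. -/
noncomputable def armSamples (n : ℕ) (x : unitInterval × (ℕ → unitInterval)) : List Bool :=
  (List.range n).map fun m => decide (x.2 m < x.1)

instance : MeasurableSpace (List Bool) := ⊤

instance : DiscreteMeasurableSpace (List Bool) := ⟨fun _ => trivial⟩

variable {K : ℕ}

@[fun_prop]
lemma measurable_arm (i : Fin K) : Measurable (arm i) := by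
  unfold arm; fun_prop

lemma samples_eq_armSamples (i : Fin K) (n : ℕ) (w : World K) :
    samples i n w = armSamples n (arm i w) := rfl

@[fun_prop]
lemma measurable_armSamples (n : ℕ) : Measurable (armSamples n) := by
  unfold armSamples
  induction n with
  | zero => simp
  | succ n ih =>
    simp only [List.range_succ, List.map_append, List.map_cons, List.map_nil]
    have h : Measurable fun x : unitInterval × (ℕ → unitInterval) => decide (x.2 n < x.1) :=
      measurable_to_bool (by
        have : (fun x : unitInterval × (ℕ → unitInterval) => decide (x.2 n < x.1)) ⁻¹' {true}
            = {x | x.2 n < x.1} := by ext; simp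
        rw [this]
        exact measurableSet_lt (by fun_prop) (by fun_prop))
    have h2 : Measurable fun p : List Bool × Bool => p.1 ++ [p.2] := Measurable.of_discrete
    exact h2.comp (ih.prodMk h)

@[fun_prop]
lemma measurable_samples (i : Fin K) (n : ℕ) : Measurable (samples i n) :=
  (measurable_armSamples n).comp (measurable_arm i)

@[simp]
lemma length_samples (i : Fin K) (n : ℕ) (w : World K) : (samples i n w).length = n := by
  simp [samples]

lemma take_samples (i : Fin K) {m n : ℕ} (h : m ≤ n) (w : World K) :
    (samples i n w).take m = samples i m w := by
  simp [samples, ← List.map_take, List.take_range, h]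

lemma samples_congr {i : Fin K} {m n : ℕ} (h : m ≤ n) {w w' : World K}
    (hw : samples i n w = samples i n w') : samples i m w = samples i m w' := by
  rw [← take_samples i h, ← take_samples i h, hw]

variable (prior : Fin K → Measure unitInterval) [∀ i, IsProbabilityMeasure (prior i)]

instance : IsProbabilityMeasure (worldLaw prior) := by
  unfold worldLaw; infer_instance

instance : IsProbabilityMeasure seedLaw := by
  unfold seedLaw; infer_instance

/-- The joint law of the arms is a product. -/
lemma map_arm_worldLaw : (worldLaw prior).map (fun w i => arm i w) =
    Measure.pi fun i => (prior i).prod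
      (Measure.infinitePi fun _ : ℕ => (volume : Measure unitInterval)) := by
  -- Two rearrangements are composed: currying splits the table of uniforms into independent rows,
  -- and a pair of families over the arms becomes a family of pairs.
  have h := (measurePreserving_arrowProdEquivProdArrow unitInterval (ℕ → unitInterval) (Fin K)
    prior (fun _ => Measure.infinitePi fun _ : ℕ => (volume : Measure unitInterval))).symm
  rw [← h.map_eq]
  have h2 : (Measure.infinitePi fun _ : Fin K × ℕ => (volume : Measure unitInterval)).map
      (MeasurableEquiv.curry (Fin K) ℕ unitInterval) =
      Measure.pi fun _ => Measure.infinitePi fun _ : ℕ => (volume : Measure unitInterval) := by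
    rw [← Measure.infinitePi_eq_pi]
    exact Measure.infinitePi_map_curry fun _ _ => volume
  rw [← h2]
  have h3 : (Measure.pi prior).prod ((Measure.infinitePi fun _ : Fin K × ℕ =>
      (volume : Measure unitInterval)).map (MeasurableEquiv.curry (Fin K) ℕ unitInterval)) =
      (worldLaw prior).map (Prod.map id (MeasurableEquiv.curry (Fin K) ℕ unitInterval)) := by
    unfold worldLaw
    rw [← Measure.map_prod_map _ _ measurable_id (MeasurableEquiv.measurable _), Measure.map_id]
  rw [h3, Measure.map_map (MeasurableEquiv.measurable _)
    (measurable_id.prodMap (MeasurableEquiv.measurable _))]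
  rfl

lemma map_arm_eq (i : Fin K) : (worldLaw prior).map (arm i) = (prior i).prod
      (Measure.infinitePi fun _ : ℕ => (volume : Measure unitInterval)) := by
  have h := measurePreserving_eval (fun i => (prior i).prod
      (Measure.infinitePi fun _ : ℕ => (volume : Measure unitInterval))) i
  rw [← map_arm_worldLaw] at h
  rw [← h.map_eq, Measure.map_map (by fun_prop) (by fun_prop)]
  rfl

lemma integral_prod_arm {h : Fin K → unitInterval × (ℕ → unitInterval) → ℝ}
    (hm : ∀ i, Measurable (h i)) :
    ∫ w, ∏ i, h i (arm i w) ∂(worldLaw prior) = ∏ i, ∫ w, h i (arm i w) ∂(worldLaw prior) := by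
  have h1 : ∀ i, ∫ w, h i (arm i w) ∂(worldLaw prior) = ∫ x, h i x ∂((prior i).prod
      (Measure.infinitePi fun _ : ℕ => (volume : Measure unitInterval))) := fun i => by
    rw [← map_arm_eq, integral_map (by fun_prop) (hm i).aestronglyMeasurable]
  simp_rw [h1]
  rw [← integral_fintype_prod_eq_prod, ← map_arm_worldLaw, integral_map]
  · exact Measurable.aemeasurable (by fun_prop)
  · exact Measurable.aestronglyMeasurable (by fun_prop)

lemma integral_prod_arm_finset (S : Finset (Fin K))
    {h : Fin K → unitInterval × (ℕ → unitInterval) → ℝ} (hm : ∀ i, Measurable (h i)) :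
    ∫ w, ∏ i ∈ S, h i (arm i w) ∂(worldLaw prior) =
      ∏ i ∈ S, ∫ w, h i (arm i w) ∂(worldLaw prior) := by
  -- Arms outside `S` receive the constant factor 1.
  have := integral_prod_arm prior (h := fun i x => if i ∈ S then h i x else 1)
    (fun i => by split_ifs <;> fun_prop)
  simp only [Finset.prod_ite_mem, Finset.univ_inter] at this
  rw [this, ← Finset.prod_subset (Finset.subset_univ S)]
  · exact Finset.prod_congr rfl fun i hi => by simp [hi]
  · intro i _ hi
    simp [hi]

/-- Functions of one arm and of finitely many other arms are uncorrelated. -/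
lemma integral_mul_prod_arm {k : Fin K} {S : Finset (Fin K)} (hk : k ∉ S)
    {g : unitInterval × (ℕ → unitInterval) → ℝ} (hg : Measurable g)
    {h : Fin K → unitInterval × (ℕ → unitInterval) → ℝ} (hm : ∀ i, Measurable (h i)) :
    ∫ w, g (arm k w) * ∏ i ∈ S, h i (arm i w) ∂(worldLaw prior) =
      (∫ w, g (arm k w) ∂(worldLaw prior)) * ∫ w, ∏ i ∈ S, h i (arm i w) ∂(worldLaw prior) := by
  have := integral_prod_arm_finset prior (insert k S) (h := fun i => if i = k then g else h i)
    (fun i => by split_ifs <;> fun_prop)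
  rw [integral_prod_arm_finset prior S hm]
  simp only [Finset.prod_insert hk, ↓reduceIte] at this
  have e : ∀ i ∈ S, i ≠ k := fun i hi e => hk (e ▸ hi)
  rw [Finset.prod_congr rfl (fun i hi => by rw [if_neg (e i hi)])] at this
  rw [← this]
  congr 1
  ext w
  congr 1
  exact Finset.prod_congr rfl fun i hi => by rw [if_neg (e i hi)]

/-- The integral of a function of the mean reward and the first `n` samples of one arm. -/
lemma integral_arm (i : Fin K) {g : unitInterval × (ℕ → unitInterval) → ℝ} (hg : Measurable g)
    {c : ℝ} (hb : ∀ x, |g x| ≤ c) :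
    ∫ w, g (arm i w) ∂(worldLaw prior) = ∫ x, ∫ v, g (x, v)
      ∂(Measure.infinitePi fun _ : ℕ => (volume : Measure unitInterval)) ∂(prior i) := by
  rw [← integral_prod, ← map_arm_eq, integral_map (by fun_prop) hg.aestronglyMeasurable]
  exact Integrable.of_bound hg.aestronglyMeasurable c (.of_forall hb)

lemma integral_mean (i : Fin K) : ∫ w, (w.1 i : ℝ) ∂(worldLaw prior) = priorMean prior i := by
  have := integral_arm prior i (g := fun x => (x.1 : ℝ)) (by fun_prop) (c := 1) (fun x => by
    simp [abs_of_nonneg x.1.2.1, x.1.2.2])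
  simpa [arm, priorMean] using this

end

section

variable {K : ℕ}

/-! ### Incentive compatibility through unnormalized integrals -/

lemma integral_cond_eq {Ω : Type*} [MeasurableSpace Ω] (P : Measure Ω) (s : Set Ω) (f : Ω → ℝ) :
    ∫ ω, f ω ∂(ProbabilityTheory.cond P s) = (P.real s)⁻¹ * ∫ ω in s, f ω ∂P := by
  rw [ProbabilityTheory.cond, integral_smul_measure, ENNReal.toReal_inv, smul_eq_mul]
  rfl

/-- The conditional expectation is the integral over the event divided by its probability, and over
a null event the integral vanishes. The side condition of positive probability thus disappears, and
the condition becomes additive over partitions of the event. -/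
lemma isBIC_iff {Ω : Type*} [MeasurableSpace Ω] {P : Measure Ω} [IsFiniteMeasure P]
    {μ : Ω → Means K} {A : Ω → Fin K} :
    IsBIC P μ A ↔ ∀ i j, 0 ≤ ∫ ω in {ω | A ω = i}, ((μ ω i : ℝ) - (μ ω j : ℝ)) ∂P := by
  refine forall₂_congr fun i j => ?_
  rw [integral_cond_eq]
  constructor
  · intro h
    rcases eq_or_ne (P {ω | A ω = i}) 0 with h0 | h0
    · rw [Measure.restrict_eq_zero.2 h0, integral_zero_measure]
    · have hp : 0 < (P.real {ω | A ω = i})⁻¹ :=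
        inv_pos.2 (ENNReal.toReal_pos h0 (measure_ne_top _ _))
      exact (mul_nonneg_iff_of_pos_left hp).1 (h (pos_iff_ne_zero.2 h0))
  · intro h _
    exact mul_nonneg (inv_nonneg.2 measureReal_nonneg) h

lemma abs_gap_le (x : Means K) (i l : Fin K) : |(x i : ℝ) - (x l : ℝ)| ≤ 1 := by
  rw [abs_le]
  constructor <;> linarith [(x i).2.1, (x i).2.2, (x l).2.1, (x l).2.2]

lemma integrable_gap {Ω : Type*} [MeasurableSpace Ω] {P : Measure Ω} [IsFiniteMeasure P]
    {μ : Ω → Means K} (hμ : Measurable μ) (i l : Fin K) :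
    Integrable (fun ω => (μ ω i : ℝ) - (μ ω l : ℝ)) P :=
  Integrable.of_bound (Measurable.aestronglyMeasurable (by fun_prop)) 1
    (.of_forall fun ω => abs_gap_le (μ ω) i l)

lemma integrable_mean {Ω : Type*} [MeasurableSpace Ω] {P : Measure Ω} [IsFiniteMeasure P]
    {μ : Ω → Means K} (hμ : Measurable μ) (i : Fin K) :
    Integrable (fun ω => (μ ω i : ℝ)) P :=
  Integrable.of_bound (Measurable.aestronglyMeasurable (by fun_prop)) 1
    (.of_forall fun ω => by
      rw [Real.norm_eq_abs, abs_of_nonneg (μ ω i).2.1]; exact (μ ω i).2.2)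

/-! ### Exploitation -/

lemma le_argmaxArm [NeZero K] (f : Fin K → ℝ) (l : Fin K) : f l ≤ f (argmaxArm f) := by
  classical
  have := Finset.min'_mem (Finset.univ.filter fun k => ∀ l, f l ≤ f k) (by
    obtain ⟨k, hk⟩ := Finite.exists_max f
    exact ⟨k, by simpa using hk⟩)
  simp only [Finset.mem_filter, Finset.mem_univ, true_and] at this
  unfold argmaxArm
  convert this l

lemma argmaxArm_eq [NeZero K] {f : Fin K → ℝ} {k : Fin K} (h1 : ∀ l < k, f l < f k)
    (h2 : ∀ l, f l ≤ f k) : argmaxArm f = k := by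
  refine le_antisymm ?_ ?_
  · unfold argmaxArm
    exact Finset.min'_le _ _ (by simpa using h2)
  · by_contra h
    exact absurd (le_argmaxArm f k) (not_le.2 (h1 _ (not_le.1 h)))

lemma agrees_congr {S : Set (Fin K)} {n : ℕ} {d d' : Data K}
    (h : ∀ i ∈ S, (d i).take n = (d' i).take n) : agrees S n d = agrees S n d' := by
  ext w
  exact forall₂_congr fun i hi => by rw [h i hi]

variable (prior : Fin K → Measure unitInterval)

lemma posteriorMean_congr {S : Set (Fin K)} {n : ℕ} {d d' : Data K}
    (h : ∀ i ∈ S, (d i).take n = (d' i).take n) :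
    posteriorMean prior S n d = posteriorMean prior S n d' := by
  ext k
  rw [posteriorMean, posteriorMean, agrees_congr h]

lemma exploit_congr [NeZero K] {S : Set (Fin K)} {n : ℕ} {d d' : Data K}
    (h : ∀ i ∈ S, (d i).take n = (d' i).take n) :
    exploit prior S n d = exploit prior S n d' := by
  rw [exploit, exploit, posteriorMean_congr prior h]

variable [∀ i, IsProbabilityMeasure (prior i)]

lemma measurableSet_agrees (S : Set (Fin K)) (n : ℕ) (d : Data K) :
    MeasurableSet (agrees S n d) := by
  have : agrees S n d = ⋂ i, ⋂ (_ : i ∈ S), samples i n ⁻¹' {(d i).take n} := by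
    ext w; simp [agrees]
  rw [this]
  exact .iInter fun i => .iInter fun _ => measurable_samples i n trivial

lemma setIntegral_agrees (S : Set (Fin K)) (n : ℕ) (d : Data K) (k : Fin K) :
    ∫ w in agrees S n d, (w.1 k : ℝ) ∂(worldLaw prior) =
      (worldLaw prior).real (agrees S n d) * posteriorMean prior S n d k := by
  rw [posteriorMean, integral_cond_eq, ← mul_assoc]
  by_cases h : (worldLaw prior).real (agrees S n d) = 0
  · rw [h]
    have : (worldLaw prior) (agrees S n d) = 0 := by
      rwa [measureReal_eq_zero_iff] at h
    simp [Measure.restrict_eq_zero.2 this]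
  · rw [mul_inv_cancel₀ h, one_mul]

/-! ### Atoms of the observed samples -/

/-- The part of the first `n` samples of the arms in `S`, as an element of a finite type. -/
noncomputable def profile (S : Set (Fin K)) (n : ℕ) (w : World K) : Fin K → Fin n → Bool :=
  open Classical in fun i m => if i ∈ S then reward i m w else false

lemma profile_eq_iff {S : Set (Fin K)} {n : ℕ} {w w' : World K} :
    profile S n w = profile S n w' ↔ ∀ i ∈ S, samples i n w = samples i n w' := by
  simp only [profile, funext_iff, samples, List.map_inj_left, List.mem_range]
  constructor
  · intro h i hi m hm
    simpa [hi] using h i ⟨m, hm⟩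
  · intro h i m
    by_cases hi : i ∈ S <;> simp [hi]
    exact h i hi m m.2

/-- An event that depends only on the observed samples contains an atom entirely or misses it. As
there are finitely many atoms, measurability of such an event need not be assumed. -/
lemma measurableSet_saturated {S : Set (Fin K)} {n : ℕ} {B : Set (World K)}
    (hinv : ∀ w w', (∀ i ∈ S, samples i n w = samples i n w') → w ∈ B → w' ∈ B)
    (t : Fin K → Fin n → Bool) : B ∩ {w | profile S n w = t} = ∅ ∨
      ∃ w ∈ B, B ∩ {w | profile S n w = t} = agrees S n fun i => samples i n w := by
  rcases Set.eq_empty_or_nonempty (B ∩ {w | profile S n w = t}) with h | ⟨w, hw, ht⟩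
  · exact .inl h
  refine .inr ⟨w, hw, Set.Subset.antisymm ?_ ?_⟩
  · rintro w' ⟨_, h'⟩
    have : profile S n w' = profile S n w := h'.trans ht.symm
    rw [profile_eq_iff] at this
    intro i hi
    simp [take_samples, this i hi]
  · intro w' hw'
    have h : ∀ i ∈ S, samples i n w = samples i n w' := fun i hi => by
      simpa [take_samples] using (hw' i hi).symm
    exact ⟨hinv w w' h hw, (profile_eq_iff.2 h).symm.trans ht⟩

/-- On each atom the gap equals the probability of the atom times a difference of posterior means,
and the exploited arm maximizes the posterior mean. -/
lemma exploit_gap_nonneg_world [NeZero K] {S : Set (Fin K)} {n : ℕ} {B : Set (World K)}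
    (hinv : ∀ w w', (∀ i ∈ S, samples i n w = samples i n w') → w ∈ B → w' ∈ B)
    {i : Fin K} (hi : ∀ w ∈ B, exploit prior S n (fun k => samples k n w) = i) (l : Fin K) :
    0 ≤ ∫ w in B, ((w.1 i : ℝ) - (w.1 l : ℝ)) ∂(worldLaw prior) := by
  have hU : B = ⋃ t, B ∩ {w | profile S n w = t} := by
    ext w; simp
  have hmeas : ∀ t, MeasurableSet (B ∩ {w | profile S n w = t}) := fun t => by
    rcases measurableSet_saturated hinv t with h | ⟨w, _, h⟩ <;> rw [h]
    · exact .empty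
    · exact measurableSet_agrees S n _
  rw [hU, integral_iUnion_fintype hmeas]
  · refine Finset.sum_nonneg fun t _ => ?_
    rcases measurableSet_saturated hinv t with h | ⟨w, hw, h⟩ <;> rw [h]
    · simp
    · rw [integral_sub, setIntegral_agrees, setIntegral_agrees, ← mul_sub]
      · refine mul_nonneg measureReal_nonneg (sub_nonneg.2 ?_)
        conv_rhs => rw [← hi w hw]
        exact le_argmaxArm _ l
      · exact integrable_mean (by fun_prop) i
      · exact integrable_mean (by fun_prop) l
  · intro a b hab
    rw [Function.onFun, Set.disjoint_left]
    rintro w ⟨_, h⟩ ⟨_, h'⟩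
    exact hab (h.symm.trans h')
  · exact fun t => (integrable_gap (by fun_prop) i l).integrableOn

/-- Exploitation is incentive-compatible on every event that is determined by the data that are
exploited and by independent randomness. -/
lemma exploit_gap_nonneg [NeZero K] {Ω : Type*} [MeasurableSpace Ω] {Q : Measure Ω}
    [IsProbabilityMeasure Q] (S : Set (Fin K)) (n : ℕ) {B : Set (World K × Ω)}
    (hB : MeasurableSet B)
    (hinv : ∀ w w' o, (∀ i ∈ S, samples i n w = samples i n w') → (w, o) ∈ B → (w', o) ∈ B)
    {i : Fin K} (hi : ∀ w o, (w, o) ∈ B → exploit prior S n (fun k => samples k n w) = i)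
    (l : Fin K) :
    0 ≤ ∫ p in B, ((p.1.1 i : ℝ) - (p.1.1 l : ℝ)) ∂((worldLaw prior).prod Q) := by
  -- The independent randomness is integrated last: for each of its values the slice of `B` is an
  -- event determined by the samples.
  rw [← integral_indicator hB, integral_prod_symm _
    ((integrable_gap (by fun_prop) i l).indicator hB)]
  refine integral_nonneg fun o => ?_
  have := exploit_gap_nonneg_world prior (B := {w | (w, o) ∈ B})
    (fun w w' h => hinv w w' o h) (fun w h => hi w o h) l
  have hB' : MeasurableSet {w | (w, o) ∈ B} := measurable_prodMk_right hB
  rw [← integral_indicator hB'] at this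
  exact this

end

section

variable {K : ℕ}

/-! ### Events that are intersections of events about single arms -/

section Arms

variable (prior : Fin K → Measure unitInterval) [∀ i, IsProbabilityMeasure (prior i)]
  {B : Fin K → Set (unitInterval × (ℕ → unitInterval))}

lemma measurableSet_arms (S : Finset (Fin K)) (hB : ∀ i, MeasurableSet (B i)) :
    MeasurableSet {w : World K | ∀ i ∈ S, arm i w ∈ B i} := by
  have : {w : World K | ∀ i ∈ S, arm i w ∈ B i} = ⋂ i ∈ S, arm i ⁻¹' B i := by
    ext; simp
  rw [this]
  exact Finset.measurableSet_biInter _ fun i _ => measurable_arm i (hB i)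

lemma indicator_arms (S : Finset (Fin K)) (w : World K) :
    {w : World K | ∀ i ∈ S, arm i w ∈ B i}.indicator (fun _ => (1 : ℝ)) w =
      ∏ i ∈ S, (B i).indicator (fun _ => (1 : ℝ)) (arm i w) := by
  classical
  simp only [Set.indicator_apply, Finset.prod_boole, Set.mem_ofPred_eq]
  congr

lemma measureReal_arms (S : Finset (Fin K)) (hB : ∀ i, MeasurableSet (B i)) :
    (worldLaw prior).real {w | ∀ i ∈ S, arm i w ∈ B i} =
      ∏ i ∈ S, (worldLaw prior).real {w | arm i w ∈ B i} := by
  rw [← integral_indicator_one (measurableSet_arms S hB)]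
  simp_rw [Pi.one_def, indicator_arms]
  rw [integral_prod_arm_finset _ _ fun i => by fun_prop (disch := exact hB i)]
  refine Finset.prod_congr rfl fun i _ => ?_
  have := measurable_arm i (hB i)
  exact (integral_indicator_one this)

lemma setIntegral_arms {k : Fin K} {S : Finset (Fin K)} (hk : k ∉ S)
    (hB : ∀ i, MeasurableSet (B i))
    {g : unitInterval × (ℕ → unitInterval) → ℝ} (hg : Measurable g) :
    ∫ w in {w | ∀ i ∈ S, arm i w ∈ B i}, g (arm k w) ∂(worldLaw prior) =
      (∫ w, g (arm k w) ∂(worldLaw prior)) *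
        (worldLaw prior).real {w | ∀ i ∈ S, arm i w ∈ B i} := by
  rw [← integral_indicator_one (measurableSet_arms S hB),
    ← integral_indicator (measurableSet_arms S hB)]
  have : ∀ w, {w : World K | ∀ i ∈ S, arm i w ∈ B i}.indicator (fun w => g (arm k w)) w =
      g (arm k w) * ∏ i ∈ S, (B i).indicator (fun _ => (1 : ℝ)) (arm i w) := fun w => by
    classical
    rw [← indicator_arms, Set.indicator_apply, Set.indicator_apply]
    split_ifs <;> simp
  simp_rw [this, Pi.one_def, indicator_arms]
  exact integral_mul_prod_arm prior hk hg fun i => by fun_prop (disch := exact hB i)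

lemma setIntegral_arms_mem {k : Fin K} {S : Finset (Fin K)} (hk : k ∈ S)
    (hB : ∀ i, MeasurableSet (B i))
    {g : unitInterval × (ℕ → unitInterval) → ℝ} (hg : Measurable g) :
    ∫ w in {w | ∀ i ∈ S, arm i w ∈ B i}, g (arm k w) ∂(worldLaw prior) =
      (∫ w in {w | arm k w ∈ B k}, g (arm k w) ∂(worldLaw prior)) *
        ∏ i ∈ S.erase k, (worldLaw prior).real {w | arm i w ∈ B i} := by
  -- The condition on arm `k` is absorbed into the function of arm `k`, which is independent of the
  -- remaining conditions.
  have h := setIntegral_arms prior (S.notMem_erase k) hB (hg.indicator (hB k))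
  rw [← measureReal_arms prior _ hB]
  have h1 : MeasurableSet {w : World K | arm k w ∈ B k} := measurable_arm k (hB k)
  have h2 : ∀ w, (B k).indicator g (arm k w) =
    {w : World K | arm k w ∈ B k}.indicator (fun w => g (arm k w)) w := fun w => rfl
  simp_rw [h2] at h
  rw [setIntegral_indicator h1, integral_indicator h1] at h
  rw [← h]
  congr 2
  ext w
  simp only [Set.mem_ofPred_eq, Set.mem_inter_iff, Finset.mem_erase]
  grind

end Arms

/-! ### The likelihood of a list of samples -/

/-- The law of a sequence of independent uniform variables. -/
noncomputable abbrev uniformSeq : Measure (ℕ → unitInterval) :=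
  Measure.infinitePi fun _ : ℕ => (volume : Measure unitInterval)

/-- The probability of a list of independent Bernoulli variables with mean `x`. -/
noncomputable def likelihood (l : List Bool) (x : unitInterval) : ℝ :=
  (l.map fun b => if b then (x : ℝ) else 1 - x).prod

lemma likelihood_eq (l : List Bool) (x : unitInterval) :
    likelihood l x = (x : ℝ) ^ l.count true * (1 - x) ^ l.count false := by
  unfold likelihood
  induction l with
  | nil => simp
  | cons b l ih => cases b <;> simp [ih, pow_succ] <;> ring

lemma likelihood_nonneg (l : List Bool) (x : unitInterval) : 0 ≤ likelihood l x := by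
  rw [likelihood_eq]
  exact mul_nonneg (pow_nonneg x.2.1 _) (pow_nonneg (by linarith [x.2.2]) _)

@[fun_prop]
lemma continuous_likelihood (l : List Bool) : Continuous (likelihood l) := by
  have : likelihood l = fun x : unitInterval => (x : ℝ) ^ l.count true * (1 - x) ^ l.count false :=
    funext (likelihood_eq l)
  rw [this]; fun_prop

/-- For a fixed mean the event is a box: coordinate m must lie in [0, x) or in [x, 1], according to
the m-th entry of the list. -/
lemma measure_armSamples {n : ℕ} {l : List Bool} (hl : l.length = n) (x : unitInterval) :
    uniformSeq.real {v | armSamples n (x, v) = l} = likelihood l x := by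
  have h1 : {v : ℕ → unitInterval | armSamples n (x, v) = l} =
      Set.pi (Finset.range n : Set ℕ)
        fun m => {u : unitInterval | decide (u < x) = l.getD m false} := by
    ext v
    simp only [armSamples, Set.mem_ofPred_eq, Set.mem_pi, Finset.coe_range, Set.mem_Iio]
    constructor
    · rintro rfl m hm
      simp [hm]
    · intro h
      refine List.ext_getElem (by simp [hl]) fun m h1 h2 => ?_
      simp only [List.getElem_map, List.getElem_range]
      rw [h m (by omega)]
      simp [h2]
  have hm : ∀ b : Bool, MeasurableSet {u : unitInterval | decide (u < x) = b} := by
    intro b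
    cases b
    · have : {u : unitInterval | decide (u < x) = false} = Set.Ici x := by ext; simp
      exact this ▸ measurableSet_Ici
    · have : {u : unitInterval | decide (u < x) = true} = Set.Iio x := by ext; simp
      exact this ▸ measurableSet_Iio
  rw [h1, measureReal_def, Measure.infinitePi_pi _ (fun m _ => hm _), ENNReal.toReal_prod,
    Finset.prod_range, likelihood, ← Fin.prod_univ_fun_getElem]
  subst hl
  refine Finset.prod_congr rfl fun m _ => ?_
  have hx : 0 ≤ 1 - (x : ℝ) := by linarith [x.2.2]
  simp only [Fin.is_lt, List.getD_eq_getElem]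
  cases l[(m : ℕ)]
  · have : {u : unitInterval | decide (u < x) = false} = Set.Ici x := by ext; simp
    rw [this, unitInterval.volume_Ici]
    simp [hx]
  · have : {u : unitInterval | decide (u < x) = true} = Set.Iio x := by ext; simp
    rw [this, unitInterval.volume_Iio]
    simp [x.2.1]

variable (prior : Fin K → Measure unitInterval) [∀ i, IsProbabilityMeasure (prior i)]

/-- Expectations on the event that the first `n` samples of an arm are given. -/
lemma setIntegral_samples_eq (i : Fin K) {n : ℕ} {l : List Bool} (hl : l.length = n)
    {f : unitInterval → ℝ} (hf : Measurable f) {c : ℝ} (hc : ∀ x, |f x| ≤ c) :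
    ∫ w in {w | samples i n w = l}, f (w.1 i) ∂(worldLaw prior) =
      ∫ x, f x * likelihood l x ∂(prior i) := by
  have hB : MeasurableSet {x | armSamples n x = l} := measurable_armSamples n (.of_discrete (s := {l}))
  have h := integral_arm prior i (g := {x | armSamples n x = l}.indicator fun x => f x.1)
    (Measurable.indicator (by fun_prop) hB) (c := c) (fun x => by
      by_cases hx : x ∈ {x | armSamples n x = l}
      · rw [Set.indicator_of_mem hx]; exact hc _
      · rw [Set.indicator_of_notMem hx, abs_zero]; exact (abs_nonneg _).trans (hc x.1))
  have hB' : MeasurableSet {w | samples i n w = l} := measurable_samples i n (.of_discrete (s := {l}))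
  rw [← integral_indicator hB']
  refine h.trans (integral_congr_ae (.of_forall fun x => ?_))
  have hB2 : MeasurableSet {v : ℕ → unitInterval | armSamples n (x, v) = l} :=
    measurable_prodMk_left hB
  have h2 : ∀ v, {x | armSamples n x = l}.indicator (fun x => f x.1) (x, v) =
    f x * {v : ℕ → unitInterval | armSamples n (x, v) = l}.indicator 1 v := fun v => by
      simp [Set.indicator_apply]
  simp_rw [h2]
  rw [integral_const_mul, integral_indicator_one hB2, measure_armSamples hl]

lemma measureReal_samples_eq (i : Fin K) {n : ℕ} {l : List Bool} (hl : l.length = n) :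
    (worldLaw prior).real {w | samples i n w = l} = ∫ x, likelihood l x ∂(prior i) := by
  have := setIntegral_samples_eq prior i hl (f := fun _ => 1) measurable_const (c := 1) (by simp)
  simpa using this

/-! ### The bootstrapping event -/

lemma reward_zero_iff (i : Fin K) (n : ℕ) (w : World K) :
    (∀ m < n, reward i m w = false) ↔ samples i n w = List.replicate n false := by
  rw [List.eq_replicate_iff]
  simp [samples]

lemma zeros_eq_arms (j : Fin K) (n : ℕ) : zeros j n =
    {w : World K | ∀ i ∈ Finset.Iio j,
      arm i w ∈ {x | armSamples n x = List.replicate n false}} := by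
  ext w
  simp only [zeros, reward_zero_iff, Set.mem_ofPred_eq, Finset.mem_Iio, samples_eq_armSamples]

lemma measurableSet_armSamples_eq (n : ℕ) (l : List Bool) :
    MeasurableSet {x | armSamples n x = l} := measurable_armSamples n (.of_discrete (s := {l}))

lemma measurableSet_zeros (j : Fin K) (n : ℕ) : MeasurableSet (zeros j n) := by
  rw [zeros_eq_arms]
  exact measurableSet_arms _ fun i => measurableSet_armSamples_eq n _

/-- The event concerns only arms before `j`, so it is independent of arm `k`. -/
lemma setIntegral_zeros_of_le {j k : Fin K} (hk : j ≤ k) (n : ℕ) :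
    ∫ w in zeros j n, (w.1 k : ℝ) ∂(worldLaw prior) =
      priorMean prior k * (worldLaw prior).real (zeros j n) := by
  rw [zeros_eq_arms, ← integral_mean]
  exact setIntegral_arms prior (by simpa using hk) (fun i => measurableSet_armSamples_eq n _)
    (g := fun x => (x.1 : ℝ)) (by fun_prop)

lemma measureReal_zeros (j : Fin K) (n : ℕ) : (worldLaw prior).real (zeros j n) =
    ∏ i ∈ Finset.Iio j, ∫ x, (1 - (x : ℝ)) ^ n ∂(prior i) := by
  rw [zeros_eq_arms, measureReal_arms _ _ fun i => measurableSet_armSamples_eq n _]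
  refine Finset.prod_congr rfl fun i _ => ?_
  refine (measureReal_samples_eq prior i (by simp)).trans ?_
  simp [likelihood_eq, List.count_replicate]

lemma setIntegral_zeros_of_lt {i j : Fin K} (hi : i < j) (n : ℕ) :
    ∫ w in zeros j n, (w.1 i : ℝ) ∂(worldLaw prior) =
      (∫ x, (x : ℝ) * (1 - x) ^ n ∂(prior i)) *
        ∏ k ∈ (Finset.Iio j).erase i, ∫ x, (1 - (x : ℝ)) ^ n ∂(prior k) := by
  rw [zeros_eq_arms]
  refine (setIntegral_arms_mem prior (by simpa using hi)
    (fun i => measurableSet_armSamples_eq n _) (g := fun x => (x.1 : ℝ)) (by fun_prop)).trans ?_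
  congr 1
  · refine (setIntegral_samples_eq prior i (l := List.replicate n false) (by simp)
      (f := fun x => (x : ℝ)) (by fun_prop) (c := 1)
      (fun x => by rw [abs_of_nonneg x.2.1]; exact x.2.2)).trans ?_
    simp [likelihood_eq, List.count_replicate]
  · refine Finset.prod_congr rfl fun i _ => ?_
    refine (measureReal_samples_eq prior i (by simp)).trans ?_
    simp [likelihood_eq, List.count_replicate]

end

section

variable {K : ℕ}

/-! ### The parameters are well-defined -/

lemma exists_measure_le_pos {ν : Measure unitInterval} {c : ℝ} (h : 0 < ν {x | (x : ℝ) < c}) :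
    ∃ c' < c, 0 < ν {x | (x : ℝ) ≤ c'} := by
  by_contra! hc
  have hU : {x : unitInterval | (x : ℝ) < c} =
      ⋃ k : ℕ, {x : unitInterval | (x : ℝ) ≤ c - 1 / ((k : ℝ) + 1)} := by
    ext x
    simp only [Set.mem_ofPred_eq, Set.mem_iUnion]
    constructor
    · intro hx
      obtain ⟨k, hk⟩ := exists_nat_one_div_lt (sub_pos.2 hx)
      exact ⟨k, by linarith⟩
    · rintro ⟨k, hk⟩
      have : (0 : ℝ) < 1 / ((k : ℝ) + 1) := by positivity
      linarith
  rw [hU] at h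
  refine h.ne' (measure_iUnion_null fun k => ?_)
  refine le_antisymm (hc _ ?_) zero_le
  have : (0 : ℝ) < 1 / ((k : ℝ) + 1) := by positivity
  linarith

lemma integrable_unitInterval {ν : Measure unitInterval} [IsFiniteMeasure ν]
    {f : unitInterval → ℝ} (hf : Continuous f) : Integrable f ν := by
  obtain ⟨c, hc⟩ := (isCompact_univ.image hf).isBounded.exists_norm_le
  exact Integrable.of_bound hf.aestronglyMeasurable c
    (.of_forall fun x => hc _ ⟨x, trivial, rfl⟩)

/-- This is why bootstrapping works. Some mass lies below a level c' < c and contributes at least a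
multiple of (1 - c')^n, whereas the mass above c subtracts at most (1 - c)^n, which is exponentially
smaller. -/
lemma eventually_integral_pos {ν : Measure unitInterval} [IsProbabilityMeasure ν] {c : ℝ}
    (hc : c ≤ 1) (h : 0 < ν {x | (x : ℝ) < c}) :
    ∀ᶠ n : ℕ in Filter.atTop, 0 < ∫ x, (c - (x : ℝ)) * (1 - x) ^ n ∂ν := by
  obtain ⟨c', hc', hpos⟩ := exists_measure_le_pos h
  set A : Set unitInterval := {x | (x : ℝ) ≤ c'} with hA
  have hAm : MeasurableSet A := measurableSet_le (by fun_prop) (by fun_prop)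
  have ha : 0 < ν.real A := ENNReal.toReal_pos hpos.ne' (measure_ne_top _ _)
  have h1 : 0 < 1 - c' := by linarith
  have hlim := tendsto_pow_atTop_nhds_zero_of_lt_one (r := (1 - c) / (1 - c'))
    (div_nonneg (by linarith) h1.le) ((div_lt_one h1).2 (by linarith))
  have hcc : 0 < (c - c') * ν.real A := mul_pos (by linarith) ha
  filter_upwards [hlim.eventually_lt_const hcc] with n hn
  rw [div_pow, div_lt_iff₀ (by positivity)] at hn
  have hle : ∀ x : unitInterval,
      A.indicator (fun _ => (c - c') * (1 - c') ^ n) x - (1 - c) ^ n ≤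
        (c - (x : ℝ)) * (1 - x) ^ n := by
    intro x
    have hx0 : 0 ≤ 1 - (x : ℝ) := by linarith [x.2.2]
    have hcn : 0 ≤ (1 - c) ^ n := pow_nonneg (by linarith) n
    by_cases hx : x ∈ A
    · rw [Set.indicator_of_mem hx]
      have hx' : (x : ℝ) ≤ c' := hx
      have : (c - c') * (1 - c') ^ n ≤ (c - x) * (1 - x) ^ n := by
        gcongr
        linarith
      linarith
    · rw [Set.indicator_of_notMem hx]
      rcases le_or_gt (x : ℝ) c with hxc | hxc
      · have : 0 ≤ (c - x) * (1 - (x : ℝ)) ^ n := mul_nonneg (by linarith) (by positivity)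
        linarith
      · have h3 : (1 - (x : ℝ)) ^ n ≤ (1 - c) ^ n := by gcongr
        -- A negative c would make A empty. Since c ≥ 0, the factor c - x is at least -1.
        have hA' : 0 ≤ (x : ℝ) ∧ 0 ≤ c := by
          refine ⟨x.2.1, ?_⟩
          by_contra hneg
          have : A = ∅ := by
            ext y
            simp only [hA, Set.mem_ofPred_eq, Set.mem_empty_iff_false, iff_false]
            linarith [y.2.1]
          simp [this] at ha
        nlinarith [pow_nonneg hx0 n, x.2.2]
  have hint : Integrable (fun x : unitInterval => (c - (x : ℝ)) * (1 - x) ^ n) ν :=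
    integrable_unitInterval (by fun_prop)
  have hint2 : Integrable (A.indicator (fun _ => (c - c') * (1 - c') ^ n)) ν :=
    (integrable_const _).indicator hAm
  have := integral_mono (hint2.sub (integrable_const ((1 - c) ^ n))) hint hle
  refine lt_of_lt_of_le ?_ this
  simp only [Pi.sub_apply]
  rw [integral_sub hint2 (integrable_const _), integral_indicator_const _ hAm]
  simp only [integral_const, smul_eq_mul, probReal_univ, one_mul]
  linarith

lemma integral_one_sub_pow_pos {ν : Measure unitInterval} [IsProbabilityMeasure ν]
    (h : 0 < ν {x | (x : ℝ) < 1}) (n : ℕ) : 0 < ∫ x, (1 - (x : ℝ)) ^ n ∂ν := by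
  have h0 : ∀ x : unitInterval, 0 ≤ 1 - (x : ℝ) := fun x => by linarith [x.2.2]
  rw [integral_pos_iff_support_of_nonneg (fun x => pow_nonneg (h0 x) n)
    (integrable_unitInterval (by fun_prop))]
  refine h.trans_le (measure_mono fun x hx => ?_)
  have : 0 < 1 - (x : ℝ) := sub_pos.2 hx
  exact (pow_pos this n).ne'

lemma priorMean_mem (prior : Fin K → Measure unitInterval) [∀ i, IsProbabilityMeasure (prior i)]
    (i : Fin K) : 0 ≤ priorMean prior i ∧ priorMean prior i ≤ 1 := by
  refine ⟨integral_nonneg fun x => x.2.1, ?_⟩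
  have := integral_mono (μ := prior i) (integrable_unitInterval (by fun_prop))
    (integrable_const (1 : ℝ)) (fun x : unitInterval => x.2.2)
  simpa [priorMean] using this

section

variable {prior : Fin K → Measure unitInterval} [∀ i, IsProbabilityMeasure (prior i)]

lemma PairwiseNonDominance.measure_lt_one_pos (h : PairwiseNonDominance prior) (hK : 2 ≤ K)
    (i : Fin K) : 0 < prior i {x | (x : ℝ) < 1} := by
  have : Nontrivial (Fin K) := Fin.nontrivial_iff_two_le.2 hK
  obtain ⟨j, hj⟩ := exists_ne i
  exact (h j i hj.symm).trans_le
    (measure_mono fun x hx => lt_of_lt_of_le hx (priorMean_mem prior j).2)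

lemma PairwiseNonDominance.zeros_pos (h : PairwiseNonDominance prior) (hK : 2 ≤ K)
    (j : Fin K) (n : ℕ) : 0 < (worldLaw prior).real (zeros j n) := by
  rw [measureReal_zeros]
  exact Finset.prod_pos fun i _ => integral_one_sub_pow_pos (h.measure_lt_one_pos hK i) n

/-- By independence the unnormalized gap is E[(E μ_j - μ_i)(1 - μ_i)^n] times the zero probabilities
of the other arms before j. The first factor is positive for large n by `eventually_integral_pos`,
and there are finitely many pairs. -/
lemma PairwiseNonDominance.bootSet_nonempty (h : PairwiseNonDominance prior) (hK : 2 ≤ K) :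
    (bootSet prior).Nonempty := by
  have hev : ∀ᶠ n : ℕ in Filter.atTop, ∀ j i : Fin K, i ≠ j →
      0 < ∫ x, (priorMean prior j - (x : ℝ)) * (1 - x) ^ n ∂(prior i) := by
    rw [Filter.eventually_all]; intro j
    rw [Filter.eventually_all]; intro i
    by_cases hij : i = j
    · exact .of_forall fun n hn => absurd hij hn
    · filter_upwards [eventually_integral_pos (priorMean_mem prior j).2 (h j i hij)] with n hn _
      exact hn
  obtain ⟨n, hn⟩ := hev.exists
  refine ⟨n, fun j i hij => ?_⟩
  rw [integral_cond_eq]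
  refine mul_pos (inv_pos.2 (h.zeros_pos hK j n)) ?_
  rw [integral_sub (integrable_mean (by fun_prop) j) (integrable_mean (by fun_prop) i),
    setIntegral_zeros_of_le prior le_rfl, setIntegral_zeros_of_lt prior hij, measureReal_zeros,
    ← Finset.mul_prod_erase (Finset.Iio j) _ (Finset.mem_Iio.2 hij), ← mul_assoc, ← sub_mul]
  refine mul_pos ?_ (Finset.prod_pos fun k _ =>
    integral_one_sub_pow_pos (h.measure_lt_one_pos hK k) n)
  have := hn j i hij.ne
  rw [← integral_const_mul, ← integral_sub]
  · simpa only [sub_mul] using this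
  · exact integrable_unitInterval (by fun_prop)
  · exact integrable_unitInterval (by fun_prop)

lemma PairwiseNonDominance.pboot_pos (h : PairwiseNonDominance prior) (hK : 2 ≤ K) :
    0 < pboot prior := by
  have : Nonempty (Fin K) := ⟨⟨0, by omega⟩⟩
  obtain ⟨j, hj⟩ := exists_eq_ciInf_of_finite
    (f := fun j : Fin K => (worldLaw prior).real (zeros j (Nboot prior)))
  rw [pboot, ← hj]
  exact h.zeros_pos hK j _

omit [∀ i, IsProbabilityMeasure (prior i)] in
lemma pboot_le (j : Fin K) : pboot prior ≤ (worldLaw prior).real (zeros j (Nboot prior)) :=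
  ciInf_le (Set.finite_range _).bddBelow j

/-! ### Positivity and size of the padding gap -/

/-- `E[(μⱼ - μ_q)₊]`. -/
noncomputable def padGap (prior : Fin K → Measure unitInterval) (j : Fin K) (q : Fin K → ℝ) : ℝ :=
  ∫ w : World K, max ((w.1 j : ℝ) - ∑ i, q i * (w.1 i : ℝ)) 0 ∂(worldLaw prior)

omit [∀ i, IsProbabilityMeasure (prior i)] in
lemma Gpad_le {j : Fin K} {q : Fin K → ℝ} (hq : q ∈ stdSimplex ℝ (Fin K))
    (hj : ∀ i, j ≤ i → q i = 0) : Gpad prior ≤ padGap prior j q := by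
  refine csInf_le ⟨0, ?_⟩ ⟨j, q, hq, hj, rfl⟩
  rintro x ⟨j, q, -, -, rfl⟩
  exact integral_nonneg fun w => le_max_right _ _

lemma mix_mem {q : Fin K → ℝ} (hq : q ∈ stdSimplex ℝ (Fin K)) (x : Means K) :
    0 ≤ ∑ i, q i * (x i : ℝ) ∧ ∑ i, q i * (x i : ℝ) ≤ 1 := by
  refine ⟨Finset.sum_nonneg fun i _ => mul_nonneg (hq.1 i) (x i).2.1, ?_⟩
  rw [← hq.2]
  exact Finset.sum_le_sum fun i _ => mul_le_of_le_one_right (hq.1 i) (x i).2.2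

lemma integrable_posPart_gap {q : Fin K → ℝ} (hq : q ∈ stdSimplex ℝ (Fin K)) (j : Fin K) :
    Integrable (fun w : World K => max ((w.1 j : ℝ) - ∑ i, q i * (w.1 i : ℝ)) 0)
      (worldLaw prior) := by
  refine Integrable.of_bound (Measurable.aestronglyMeasurable (by fun_prop)) 1
    (.of_forall fun w => ?_)
  rw [Real.norm_eq_abs, abs_of_nonneg (le_max_right _ _)]
  exact max_le (by linarith [mix_mem hq w.1, (w.1 j).2.2]) zero_le_one

/-- A lower bound for `E[(μⱼ - μ_q)₊]` that does not depend on `q`. -/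
lemma le_padGap {j : Fin K} {q : Fin K → ℝ} (hq : q ∈ stdSimplex ℝ (Fin K))
    (hj : ∀ i, j ≤ i → q i = 0) (ε : ℝ) :
    ε * ∏ i ∈ Finset.Iio j, (worldLaw prior).real
      {w | (w.1 i : ℝ) ≤ priorMean prior j - ε} ≤ padGap prior j q := by
  set m := priorMean prior j
  let B : Fin K → Set (unitInterval × (ℕ → unitInterval)) := fun _ => {x | (x.1 : ℝ) ≤ m - ε}
  have hB : ∀ i, MeasurableSet (B i) := fun i => measurableSet_le (by fun_prop) (by fun_prop)
  -- On the event that every earlier mean is at most m - ε, so is every mixture of them. Arm `j` is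
  -- independent of this event and exceeds m - ε by ε on average.
  have h1 := setIntegral_arms prior (k := j) (S := Finset.Iio j) (by simp) hB
    (g := fun x => (x.1 : ℝ) - (m - ε)) (by fun_prop)
  rw [measureReal_arms prior _ hB] at h1
  have h2 : ∫ w, ((arm j w).1 : ℝ) - (m - ε) ∂(worldLaw prior) = ε := by
    have := integral_mean prior j
    simp only [arm]
    rw [integral_sub (integrable_mean (by fun_prop) j) (integrable_const _), integral_const, this]
    simp only [probReal_univ, one_smul]
    ring
  rw [h2] at h1
  refine h1.ge.trans ?_
  have hm := measurableSet_arms (Finset.Iio j) hB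
  rw [← integral_indicator hm]
  refine integral_mono (Integrable.indicator ?_ hm) (integrable_posPart_gap hq j) fun w => ?_
  · exact (integrable_mean (μ := fun w : World K => w.1) (by fun_prop) j).sub
      (integrable_const _)
  · by_cases hw : w ∈ {w : World K | ∀ i ∈ Finset.Iio j, arm i w ∈ B i}
    · rw [Set.indicator_of_mem hw]
      refine le_max_of_le_left (sub_le_sub_left ?_ _)
      calc ∑ i, q i * (w.1 i : ℝ) ≤ ∑ i, q i * (m - ε) := by
            refine Finset.sum_le_sum fun i _ => ?_
            by_cases hi : i < j
            · exact mul_le_mul_of_nonneg_left (hw i (Finset.mem_Iio.2 hi)) (hq.1 i)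
            · rw [hj i (not_lt.1 hi), zero_mul, zero_mul]
        _ = m - ε := by rw [← Finset.sum_mul, hq.2, one_mul]
    · rw [Set.indicator_of_notMem hw]
      exact le_max_right _ _

lemma map_mean_eq (i : Fin K) : (worldLaw prior).map (fun w => w.1 i) = prior i := by
  have := congrArg (Measure.map Prod.fst) (map_arm_eq prior i)
  rw [Measure.map_map (by fun_prop) (by fun_prop), Measure.map_fst_prod] at this
  simpa using! this

/-- The lower bound of `le_padGap` does not involve `q`, so only a minimum over finitely many arms
remains and no compactness of the simplex is needed. -/
lemma PairwiseNonDominance.Gpad_pos (h : PairwiseNonDominance prior) (hK : 2 ≤ K) :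
    0 < Gpad prior := by
  have hpos : ∀ j : Fin K, ∃ ε > 0, ∀ i, i ≠ j →
      0 < prior i {x | (x : ℝ) ≤ priorMean prior j - ε} := by
    intro j
    have h1 : ∀ i, ∃ ε > 0, i ≠ j → 0 < prior i {x | (x : ℝ) ≤ priorMean prior j - ε} := by
      intro i
      by_cases hij : i = j
      · exact ⟨1, one_pos, fun hn => absurd hij hn⟩
      · obtain ⟨c, hc, hp⟩ := exists_measure_le_pos (h j i hij)
        exact ⟨priorMean prior j - c, sub_pos.2 hc, fun _ => by simpa using hp⟩
    choose ε hε hp using h1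
    obtain ⟨k, hk⟩ := @Finite.exists_min _ _ _ ⟨j⟩ _ ε
    exact ⟨ε k, hε k, fun i hi => (hp i hi).trans_le
      (measure_mono fun x hx => le_trans (Set.mem_ofPred_eq ▸ hx) (by linarith [hk i]))⟩
  choose ε hε hp using hpos
  let b : Fin K → ℝ := fun j => ε j * ∏ i ∈ Finset.Iio j, (worldLaw prior).real
      {w | (w.1 i : ℝ) ≤ priorMean prior j - ε j}
  have hb : ∀ j, 0 < b j := fun j => mul_pos (hε j) (Finset.prod_pos fun i hi => by
    refine ENNReal.toReal_pos ?_ (measure_ne_top _ _)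
    have := hp j i (Finset.mem_Iio.1 hi).ne
    rw [← map_mean_eq (prior := prior) i, Measure.map_apply (by fun_prop)
      (measurableSet_le (by fun_prop) (by fun_prop))] at this
    exact this.ne')
  obtain ⟨k, hk⟩ := @Finite.exists_min _ _ _ ⟨⟨0, by omega⟩⟩ _ b
  refine (hb k).trans_le (le_csInf ?_ ?_)
  -- The set must be shown nonempty, since the infimum of the empty set of reals is 0.
  · refine ⟨_, ⟨1, by omega⟩, Pi.single ⟨0, by omega⟩ 1, single_mem_stdSimplex _ _, ?_, rfl⟩
    intro i hi
    rw [Pi.single_eq_of_ne]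
    rintro rfl
    exact absurd hi (by simp)
  · rintro x ⟨j, q, hq, hj, rfl⟩
    exact (hk j).trans (le_padGap hq hj (ε j))

/-- For the first two arms (μ_b - μ_a)₊ ≤ μ_b (1 - μ_a), whose mean factorizes and is at most m_a (1
- m_a) ≤ 1/4. The bound keeps log G_pad⁻¹ above 1, so that additive constants can be absorbed. -/
lemma Gpad_le_quarter (hK : 2 ≤ K) (hanti : Antitone (priorMean prior)) :
    Gpad prior ≤ 1 / 4 := by
  have h01 : (⟨0, by omega⟩ : Fin K) < ⟨1, by omega⟩ := by simp
  set a : Fin K := ⟨0, by omega⟩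
  set b : Fin K := ⟨1, by omega⟩
  have hq := single_mem_stdSimplex ℝ a
  refine (Gpad_le (j := b) hq ?_).trans ?_
  · intro i hi
    rw [Pi.single_eq_of_ne]
    rintro rfl
    exact absurd hi (not_le.2 h01)
  have h1 : padGap prior b (Pi.single a 1) ≤
      ∫ w, ((arm b w).1 : ℝ) * ∏ i ∈ {a}, (1 - ((arm i w).1 : ℝ)) ∂(worldLaw prior) := by
    refine integral_mono (integrable_posPart_gap hq b) ?_ fun w => ?_
    · refine Integrable.of_bound (Measurable.aestronglyMeasurable (by fun_prop)) 1
        (.of_forall fun w => ?_)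
      have h1 := (w.1 a).2
      have h2 := (w.1 b).2
      simp only [arm, Finset.prod_singleton, Real.norm_eq_abs]
      rw [abs_of_nonneg (mul_nonneg h2.1 (by linarith [h1.2]))]
      nlinarith [h1.1, h1.2, h2.1, h2.2]
    · have h1 := (w.1 a).2
      have h2 := (w.1 b).2
      simp only [arm, Finset.prod_singleton, Pi.single_apply, ite_mul, one_mul, zero_mul,
        Finset.sum_ite_eq', Finset.mem_univ, if_true]
      refine max_le ?_ (mul_nonneg h2.1 (by linarith [h1.2]))
      nlinarith [h1.1, h1.2, h2.1, h2.2]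
  have h2 := integral_mul_prod_arm prior (k := b) (S := {a}) (by simp [h01.ne'])
    (g := fun x => (x.1 : ℝ)) (by fun_prop) (h := fun _ x => 1 - (x.1 : ℝ)) (fun _ => by fun_prop)
  rw [h2] at h1
  refine h1.trans ?_
  have h3 := integral_mean prior b
  have h4 : ∫ w : World K, ∏ i ∈ {a}, (1 - ((arm i w).1 : ℝ)) ∂(worldLaw prior) =
      1 - priorMean prior a := by
    simp only [Finset.prod_singleton, arm]
    rw [integral_sub (integrable_const _) (integrable_mean (by fun_prop) a), integral_mean]
    simp
  rw [h4]
  simp only [arm]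
  rw [h3]
  have h5 := hanti h01.le
  have h6 := (priorMean_mem prior a).2
  nlinarith [mul_le_mul_of_nonneg_right h5 (sub_nonneg.2 h6),
    sq_nonneg (priorMean prior a - 1 / 2)]

/-! ### The number of rounds -/

omit [∀ i, IsProbabilityMeasure (prior i)] in
lemma exploreProb_zero_mem {lam : ℝ} {j : Fin K} {N₀ : ℕ}
    (hq : 0 < lam * (worldLaw prior).real (zeros j N₀)) :
    0 < exploreProb prior N₀ lam j 0 ∧ exploreProb prior N₀ lam j 0 < 1 := by
  rw [exploreProb]
  exact ⟨by positivity, (div_lt_one (by linarith)).2 (by linarith)⟩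

omit [∀ i, IsProbabilityMeasure (prior i)] in
lemma le_exploreProb {lam : ℝ} (hlam : 0 ≤ lam) (j : Fin K) {N₀ : ℕ} (n : ℕ) :
    min 1 (exploreProb prior N₀ lam j 0 * (1 + lam) ^ n) ≤ exploreProb prior N₀ lam j n := by
  induction n with
  | zero => simp
  | succ n ih =>
    rw [exploreProb]
    refine le_min (min_le_left _ _) ?_
    rw [pow_succ, ← mul_assoc]
    refine le_trans ?_ (mul_le_mul_of_nonneg_right ih (by linarith))
    rcases le_total 1 (exploreProb prior N₀ lam j 0 * (1 + lam) ^ n) with h | h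
    · rw [min_eq_left h]
      exact (min_le_left _ _).trans (by linarith)
    · rw [min_eq_right h]
      exact min_le_right _ _

-- Up to the cap at 1 the probability grows geometrically, and log(1 + λ) ≥ λ/2 for λ ≤ 1.
omit [∀ i, IsProbabilityMeasure (prior i)] in
lemma exists_exploreProb_ge {lam : ℝ} (hlam : 0 < lam) (hlam1 : lam ≤ 1) {j : Fin K} {N₀ : ℕ}
    (hq : 0 < lam * (worldLaw prior).real (zeros j N₀)) {n : ℕ}
    (hn : 2 / lam * Real.log (exploreProb prior N₀ lam j 0)⁻¹ ≤ n) :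
    1 ≤ exploreProb prior N₀ lam j n := by
  refine le_trans (le_min le_rfl ?_) (le_exploreProb hlam.le j n)
  have hp := (exploreProb_zero_mem hq).1
  set p := exploreProb prior N₀ lam j 0
  -- Indeed log(1 + λ) ≥ 1 - 1/(1 + λ) = λ/(1 + λ) ≥ λ/2.
  have h1 : lam / 2 ≤ Real.log (1 + lam) := by
    refine le_trans ?_ (Real.one_sub_inv_le_log_of_pos (by linarith))
    rw [le_sub_iff_add_le, ← le_sub_iff_add_le', inv_le_iff_one_le_mul₀ (by linarith)]
    nlinarith
  rw [← div_le_iff₀' hp, one_div]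
  have h2 : Real.log p⁻¹ ≤ Real.log ((1 + lam) ^ n) := by
    rw [Real.log_pow]
    calc Real.log p⁻¹ = (2 / lam * Real.log p⁻¹) * (lam / 2) := by field_simp
      _ ≤ n * (lam / 2) := by gcongr
      _ ≤ n * Real.log (1 + lam) := by gcongr
  exact (Real.log_le_log_iff (by positivity) (by positivity)).1 h2

/-- With λ = G/10, the count (2/λ) log(1/p_0) is at most (20/G) · 4 log X, where X = (G p_boot)⁻¹.
Rounding up adds at most 1, which the second conclusion absorbs: 80 + 1 = 81. -/
lemma loopLength_le (h : PairwiseNonDominance prior) (hK : 2 ≤ K)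
    (hanti : Antitone (priorMean prior)) (j : Fin K) :
    (loopLength prior (Nboot prior) (Gpad prior / 10) j : ℝ) ≤
      81 * ((Gpad prior)⁻¹ * Real.log ((Gpad prior)⁻¹ * (pboot prior)⁻¹)) ∧
    1 ≤ (Gpad prior)⁻¹ * Real.log ((Gpad prior)⁻¹ * (pboot prior)⁻¹) := by
  have hG := h.Gpad_pos hK
  have hG4 := Gpad_le_quarter hK hanti
  have hp := h.pboot_pos hK
  have hpz := pboot_le (prior := prior) j
  have hz1 : (worldLaw prior).real (zeros j (Nboot prior)) ≤ 1 := measureReal_le_one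
  set G := Gpad prior
  set pb := pboot prior
  set X := G⁻¹ * pb⁻¹ with hX
  have hGi : 4 ≤ G⁻¹ := by
    rw [le_inv_comm₀ (by norm_num) hG]; linarith
  have hpi : 1 ≤ pb⁻¹ := (one_le_inv₀ hp).2 (hpz.trans hz1)
  have hX4 : 4 ≤ X := by nlinarith
  have hlog : 1 ≤ Real.log X := by
    rw [Real.le_log_iff_exp_le (by linarith)]
    linarith [Real.exp_one_lt_d9]
  have hone : 1 ≤ G⁻¹ * Real.log X := by nlinarith
  refine ⟨?_, hone⟩
  have hlam : 0 < G / 10 := by positivity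
  have hz := h.zeros_pos hK j (Nboot prior)
  have hq := mul_pos hlam hz
  set q := G / 10 * (worldLaw prior).real (zeros j (Nboot prior)) with hqdef
  have hp0 : exploreProb prior (Nboot prior) (G / 10) j 0 = q / (1 + q) := rfl
  have hq1 : q ≤ 1 := by nlinarith
  have hlogp : Real.log (exploreProb prior (Nboot prior) (G / 10) j 0)⁻¹ ≤ 4 * Real.log X := by
    rw [hp0, inv_div]
    -- The constant 20 is swallowed by 4³ ≤ X³.
    have : (1 + q) / q ≤ X ^ 4 := by
      calc (1 + q) / q ≤ 2 / q := by gcongr; linarith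
        _ ≤ 2 / (G / 10 * pb) := by
          rw [hqdef]; gcongr
        _ = 20 * X := by rw [hX]; field_simp; norm_num
        _ ≤ 4 ^ 3 * X := by gcongr; norm_num
        _ ≤ X ^ 3 * X := by gcongr
        _ = X ^ 4 := by ring
    refine (Real.log_le_log (by positivity) this).trans ?_
    rw [Real.log_pow]; norm_num
  have hle : loopLength prior (Nboot prior) (G / 10) j ≤
      ⌈2 / (G / 10) * Real.log (exploreProb prior (Nboot prior) (G / 10) j 0)⁻¹⌉₊ :=
    Nat.sInf_le (exists_exploreProb_ge hlam (by linarith) hq (Nat.le_ceil _))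
  have hpos : 0 ≤ 2 / (G / 10) * Real.log (exploreProb prior (Nboot prior) (G / 10) j 0)⁻¹ := by
    refine mul_nonneg (by positivity) (Real.log_nonneg ?_)
    have := exploreProb_zero_mem hq
    exact (one_le_inv₀ this.1).2 this.2.le
  have h3 := (Nat.cast_le (α := ℝ).2 hle).trans (Nat.ceil_lt_add_one hpos).le
  have h4 : 2 / (G / 10) * Real.log (exploreProb prior (Nboot prior) (G / 10) j 0)⁻¹ ≤
      2 / (G / 10) * (4 * Real.log X) := by gcongr
  have h5 : 2 / (G / 10) * (4 * Real.log X) = 80 * (G⁻¹ * Real.log X) := by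
    field_simp; norm_num
  linarith

/-- A block has two bootstrapping phases and at most 81 Y iterations, hence at most 83 Y phases
because Y ≥ 1. The initial phase raises the constant to 84. -/
lemma horizon_le [NeZero K] (h : PairwiseNonDominance prior) (hK : 2 ≤ K)
    (hanti : Antitone (priorMean prior)) (N : ℕ) :
    (horizon prior N (Nboot prior) (Gpad prior / 10) : ℝ) ≤
      84 * K * N * (Gpad prior)⁻¹ * Real.log ((Gpad prior)⁻¹ * (pboot prior)⁻¹) := by
  classical
  have hone := (loopLength_le h hK hanti ⟨0, by omega⟩).2
  set Y := (Gpad prior)⁻¹ * Real.log ((Gpad prior)⁻¹ * (pboot prior)⁻¹) with hY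
  have hlen : ((schedule prior (Nboot prior) (Gpad prior / 10)).length : ℝ) ≤ 84 * K * Y := by
    unfold schedule
    rw [List.length_cons, List.length_flatMap]
    have hb : ∀ x ∈ (List.map (fun j : Fin K => (if j = 0 then [] else
        Phase.boot₁ j :: Phase.boot₂ j ::
        (List.range (loopLength prior (Nboot prior) (Gpad prior / 10) j)).map
          -- The floor is taken because the summands are natural numbers.
          fun n => Phase.main j n).length) (List.finRange K)), x ≤ ⌊83 * Y⌋₊ := by
      intro x hx
      obtain ⟨j, -, rfl⟩ := List.mem_map.1 hx
      refine Nat.le_floor ?_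
      split_ifs
      · simp only [List.length_nil, Nat.cast_zero]; linarith
      · simp only [List.length_cons, List.length_map, List.length_range]
        push_cast
        linarith [(loopLength_le h hK hanti j).1]
    have hs := List.sum_le_card_nsmul _ _ hb
    rw [List.length_map, List.length_finRange, smul_eq_mul] at hs
    have hs' := Nat.cast_le (α := ℝ).2 hs
    have hf := Nat.floor_le (show 0 ≤ 83 * Y by linarith)
    have hK1 : (1 : ℝ) ≤ K := by exact_mod_cast (by omega : 1 ≤ K)
    push_cast at hs' ⊢
    have := mul_le_mul_of_nonneg_left hf (by linarith : (0 : ℝ) ≤ K)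
    nlinarith
  unfold horizon
  push_cast
  calc _ ≤ 84 * K * Y * N := by gcongr
    _ = _ := by rw [hY]; ring

end

end

section

/-! ### Quantile couplings -/

/-- The sum telescopes along the cumulative sums of `p`; the induction removes the largest element.
-/
lemma sum_sub_eq_of_linearOrder {α : Type*} [LinearOrder α] (s : Finset α) (p : α → ℝ)
    (g : ℝ → ℝ) :
    ∑ a ∈ s, (g (∑ b ∈ s with b < a, p b + p a) - g (∑ b ∈ s with b < a, p b)) =
      g (∑ a ∈ s, p a) - g 0 := by
  induction s using Finset.induction_on_max with
  | empty => simp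
  | insert m s hm ih =>
    have hms : m ∉ s := fun h => lt_irrefl _ (hm m h)
    have h1 : ∀ a ∈ s, ({b ∈ insert m s | b < a} : Finset α) = {b ∈ s | b < a} := by
      intro a ha
      rw [Finset.filter_insert, if_neg (not_lt.2 (hm a ha).le)]
    have h2 : ({b ∈ insert m s | b < m} : Finset α) = s := by
      rw [Finset.filter_insert, if_neg (lt_irrefl _), Finset.filter_true_of_mem hm]
    have h3 : ∑ a ∈ s, (g (∑ b ∈ insert m s with b < a, p b + p a) -
        g (∑ b ∈ insert m s with b < a, p b)) = g (∑ a ∈ s, p a) - g 0 := by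
      rw [← ih]
      exact Finset.sum_congr rfl fun a ha => by rw [h1 a ha]
    rw [Finset.sum_insert hms, h3, h2, Finset.sum_insert hms, add_comm (p m)]
    ring

/-- Both sides are the length of the part of the interval [a, a + p] that lies below t. -/
lemma mul_volume_lt {a p : ℝ} (hp : 0 ≤ p) (t : ℝ) :
    p * (volume : Measure unitInterval).real {u | a + u * p < t} =
      min t (a + p) - min t a := by
  rcases hp.eq_or_lt with rfl | hp
  · simp
  rcases le_total t a with h | h
  · have : {u : unitInterval | a + u * p < t} = ∅ := by
      ext u
      simp only [Set.mem_ofPred_eq, Set.mem_empty_iff_false, iff_false, not_lt]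
      have := mul_nonneg u.2.1 hp.le
      linarith
    rw [this, min_eq_left h, min_eq_left (by linarith)]
    simp
  rcases lt_or_ge (a + p) t with h' | h'
  · have : {u : unitInterval | a + u * p < t} = Set.univ := by
      ext u
      simp only [Set.mem_ofPred_eq, Set.mem_univ, iff_true]
      have := mul_le_mul_of_nonneg_right u.2.2 hp.le
      linarith
    rw [this, min_eq_right h'.le, min_eq_right h]
    simp
  · have hx : (t - a) / p ∈ unitInterval :=
      ⟨div_nonneg (by linarith) hp.le, (div_le_one hp).2 (by linarith)⟩
    have : {u : unitInterval | a + u * p < t} = Set.Iio ⟨(t - a) / p, hx⟩ := by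
      ext u
      rw [Set.mem_Iio, ← Subtype.coe_lt_coe, lt_div_iff₀ hp, Set.mem_ofPred_eq, lt_sub_iff_add_lt']
    rw [this, measureReal_def, unitInterval.volume_Iio, min_eq_left h', min_eq_right h,
      ENNReal.toReal_ofReal hx.1]
    field_simp

/-- A coupling of two distributions on a finite linear order that respects a weaker order in
which one of them dominates the other stochastically. -/
lemma exists_quantile_coupling {α : Type*} [LinearOrder α] (s : Finset α) {p₀ p₁ : α → ℝ}
    (h₀ : ∀ a, 0 ≤ p₀ a) (h₁ : ∀ a, 0 ≤ p₁ a) (hs₀ : ∑ a ∈ s, p₀ a = 1) (hs₁ : ∑ a ∈ s, p₁ a = 1)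
    (r : α → ℕ) (hr : Monotone r)
    (hdom : ∀ c, ∑ a ∈ s with r a ≤ c, p₁ a ≤ ∑ a ∈ s with r a ≤ c, p₀ a) :
    ∃ κ : α → unitInterval → Option α,
      (∀ a b, MeasurableSet {u | κ a u = b}) ∧
      (∀ b ∈ s, ∑ a ∈ s, p₀ a * (volume : Measure unitInterval).real {u | κ a u = some b} = p₁ b) ∧
      ∀ a ∈ s, ∀ u b, κ a u = some b → r a ≤ r b := by
  classical
  -- Cumulative distribution functions without the current atom. When a has law p₀ and u is uniform,
  -- F₀ a + u p₀ a is uniform on the unit interval; b is the element whose p₁-interval contains this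
  -- point.
  let F₀ : α → ℝ := fun a => ∑ b ∈ s with b < a, p₀ b
  let F₁ : α → ℝ := fun a => ∑ b ∈ s with b < a, p₁ b
  let R : α → unitInterval → α → Prop := fun a u b =>
    b ∈ s ∧ F₁ b ≤ F₀ a + u * p₀ a ∧ F₀ a + u * p₀ a < F₁ b + p₁ b
  have hF : ∀ b ∈ s, ∀ b', b < b' → F₁ b + p₁ b ≤ F₁ b' := by
    intro b hb b' hbb'
    have : F₁ b + p₁ b = ∑ a ∈ insert b {a ∈ s | a < b}, p₁ a := by
      rw [Finset.sum_insert (by simp), add_comm]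
    rw [this]
    refine Finset.sum_le_sum_of_subset_of_nonneg ?_ fun a _ _ => h₁ a
    intro a ha
    simp only [Finset.mem_insert, Finset.mem_filter] at ha ⊢
    rcases ha with rfl | ⟨ha, hab⟩
    · exact ⟨hb, hbb'⟩
    · exact ⟨ha, hab.trans hbb'⟩
  have huniq : ∀ a u b b', R a u b → R a u b' → b = b' := by
    rintro a u b b' ⟨hb, h1, h2⟩ ⟨hb', h3, h4⟩
    rcases lt_trichotomy b b' with h | h | h
    · linarith [hF b hb b' h]
    · exact h
    · linarith [hF b' hb' b h]
  -- The value `none` is for points in no interval, such as the right endpoint 1.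
  let κ : α → unitInterval → Option α := fun a u =>
    if h : ∃ b, R a u b then some h.choose else none
  have hκ : ∀ a u b, κ a u = some b ↔ R a u b := by
    intro a u b
    by_cases h : ∃ b, R a u b
    · simp only [κ, dif_pos h, Option.some.injEq]
      exact ⟨fun e => e ▸ h.choose_spec, fun hb => huniq a u _ _ h.choose_spec hb⟩
    · simp only [κ, dif_neg h, reduceCtorEq, false_iff]
      exact fun hb => h ⟨b, hb⟩
  have hmeas : ∀ a b, MeasurableSet {u | κ a u = some b} := by
    intro a b
    simp only [hκ, R]
    by_cases hb : b ∈ s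
    · simp only [hb, true_and]
      have hm : Measurable fun u : unitInterval => F₀ a + u * p₀ a := by fun_prop
      exact (measurableSet_le measurable_const hm).inter (measurableSet_lt hm measurable_const)
    · simp [hb]
  refine ⟨κ, ?_, ?_, ?_⟩
  · intro a b
    cases b with
    | some b => exact hmeas a b
    | none =>
      have : {u | κ a u = none} = (⋃ b ∈ s, {u | κ a u = some b})ᶜ := by
        ext u
        simp only [Set.mem_ofPred_eq, Set.mem_compl_iff, Set.mem_iUnion, not_exists]
        constructor
        · intro h b _ hb
          rw [h] at hb
          exact absurd hb (by simp)
        · intro h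
          rw [Option.eq_none_iff_forall_ne_some]
          exact fun b hb => h b ((hκ a u b).1 hb).1 hb
      rw [this]
      exact (Finset.measurableSet_biUnion s fun b _ => hmeas a b).compl
  · intro b hb
    have h1 : ∀ a, p₀ a * (volume : Measure unitInterval).real {u | κ a u = some b} =
        (min (F₁ b + p₁ b) (F₀ a + p₀ a) - min (F₁ b + p₁ b) (F₀ a)) -
          (min (F₁ b) (F₀ a + p₀ a) - min (F₁ b) (F₀ a)) := by
      intro a
      have hset : {u | κ a u = some b} = {u : unitInterval | F₀ a + u * p₀ a < F₁ b + p₁ b} \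
          {u : unitInterval | F₀ a + u * p₀ a < F₁ b} := by
        ext u
        simp only [hκ, R, Set.mem_ofPred_eq, Set.mem_sdiff, hb, true_and, not_lt]
        exact and_comm
      rw [hset, measureReal_sdiff, mul_sub, mul_volume_lt (h₀ a), mul_volume_lt (h₀ a)]
      · intro u hu
        rw [Set.mem_ofPred_eq] at hu ⊢
        linarith [h₁ b]
      · exact measurableSet_lt (by fun_prop) (by fun_prop)
    -- Each p₀-interval meets the p₁-interval of `b` in a difference of two half-line lengths.
    -- Summed over a these telescope to the length p₁ b.
    rw [Finset.sum_congr rfl fun a _ => h1 a, Finset.sum_sub_distrib,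
      sum_sub_eq_of_linearOrder s p₀ (fun x => min (F₁ b + p₁ b) x),
      sum_sub_eq_of_linearOrder s p₀ (fun x => min (F₁ b) x), hs₀]
    have hb0 : 0 ≤ F₁ b := Finset.sum_nonneg fun a _ => h₁ a
    have hb1 : F₁ b + p₁ b ≤ 1 := by
      have : F₁ b + p₁ b = ∑ a ∈ insert b {a ∈ s | a < b}, p₁ a := by
        rw [Finset.sum_insert (by simp), add_comm]
      rw [this, ← hs₁]
      refine Finset.sum_le_sum_of_subset_of_nonneg ?_ fun a _ _ => h₁ a
      intro a ha
      simp only [Finset.mem_insert, Finset.mem_filter] at ha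
      rcases ha with rfl | ⟨ha, -⟩ <;> assumption
    have := h₁ b
    rw [min_eq_left hb1, min_eq_left (by linarith : F₁ b ≤ 1), min_eq_right hb0,
      min_eq_right (by linarith)]
    ring
  · intro a ha u b hab
    obtain ⟨hb, -, h2⟩ := (hκ a u b).1 hab
    -- If r b < r a, then F₁ b + p₁ b ≤ P₁(r ≤ r b) ≤ P₀(r ≤ r b) ≤ F₀ a, so the point for `a` would
    -- lie beyond the interval of `b`.
    by_contra! hlt
    have e1 : F₁ b + p₁ b ≤ ∑ c ∈ s with r c ≤ r b, p₁ c := by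
      have : F₁ b + p₁ b = ∑ a ∈ insert b {a ∈ s | a < b}, p₁ a := by
        rw [Finset.sum_insert (by simp), add_comm]
      rw [this]
      refine Finset.sum_le_sum_of_subset_of_nonneg ?_ fun a _ _ => h₁ a
      intro a ha
      simp only [Finset.mem_insert, Finset.mem_filter] at ha ⊢
      rcases ha with rfl | ⟨ha, hab⟩
      · exact ⟨hb, le_rfl⟩
      · exact ⟨ha, hr hab.le⟩
    have e2 : ∑ c ∈ s with r c ≤ r b, p₀ c ≤ F₀ a := by
      refine Finset.sum_le_sum_of_subset_of_nonneg ?_ fun a _ _ => h₀ a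
      intro c hc
      simp only [Finset.mem_filter] at hc ⊢
      exact ⟨hc.1, not_le.1 fun h => absurd (hr h) (by omega)⟩
    have e3 := hdom (r b)
    have e4 := mul_nonneg u.2.1 (h₀ a)
    linarith

/-! ### Association -/

/-- Chebyshev's association inequality. -/
lemma integral_mul_integral_le_of_monovary {α : Type*} [MeasurableSpace α] {ν : Measure α}
    [IsProbabilityMeasure ν] {f g : α → ℝ} (hf : Integrable f ν) (hg : Integrable g ν)
    (hfg : Integrable (fun x => f x * g x) ν)
    (h : ∀ x y, 0 ≤ (f x - f y) * (g x - g y)) :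
    (∫ x, f x ∂ν) * ∫ x, g x ∂ν ≤ ∫ x, f x * g x ∂ν := by
  -- Comparison with an independent copy: expanding the product gives twice the covariance.
  have h0 : 0 ≤ ∫ x, ∫ y, (f x - f y) * (g x - g y) ∂ν ∂ν :=
    integral_nonneg fun x => integral_nonneg fun y => h x y
  have h1 : ∀ x, ∫ y, (f x - f y) * (g x - g y) ∂ν =
      f x * g x - f x * (∫ y, g y ∂ν) - (∫ y, f y ∂ν) * g x + ∫ y, f y * g y ∂ν := by
    intro x
    have : ∀ y, (f x - f y) * (g x - g y) = (f x * g x - f x * g y) - (f y * g x - f y * g y) :=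
      fun y => by ring
    simp_rw [this]
    rw [integral_sub, integral_sub, integral_sub, integral_const, integral_const_mul,
      integral_mul_const]
    · simp only [probReal_univ, smul_eq_mul]; ring
    all_goals fun_prop
  simp_rw [h1] at h0
  rw [integral_add, integral_sub, integral_sub, integral_mul_const, integral_const_mul,
    integral_const] at h0
  · simp only [probReal_univ, smul_eq_mul] at h0
    linarith
  all_goals fun_prop

end

section

/-! ### Lists of samples -/

/-- The lists of length `n`. -/
def lists : ℕ → Finset (List Bool)
  | 0 => {[]}
  | n + 1 => (lists n).image (List.cons true) ∪ (lists n).image (List.cons false)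

lemma mem_lists {n : ℕ} {l : List Bool} : l ∈ lists n ↔ l.length = n := by
  induction n generalizing l with
  | zero => simp [lists]
  | succ n ih =>
    cases l with
    | nil => simp [lists]
    | cons b l => cases b <;> simp [lists, ih]

lemma sum_lists_succ (n : ℕ) (f : List Bool → ℝ) : ∑ l ∈ lists (n + 1), f l =
    ∑ l ∈ lists n, f (true :: l) + ∑ l ∈ lists n, f (false :: l) := by
  rw [lists, Finset.sum_union, Finset.sum_image (by simp), Finset.sum_image (by simp)]
  rw [Finset.disjoint_left]
  intro l h1 h2
  obtain ⟨a, -, rfl⟩ := Finset.mem_image.1 h1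
  simp at h2

lemma measureReal_eq_sum_lists {Ω : Type*} [MeasurableSpace Ω] {P : Measure Ω} [IsFiniteMeasure P]
    {X : Ω → List Bool} (hX : Measurable X) {n : ℕ} (hn : ∀ ω, (X ω).length = n)
    (p : List Bool → Prop) [DecidablePred p] :
    P.real {ω | p (X ω)} = ∑ l ∈ lists n with p l, P.real {ω | X ω = l} := by
  have h := sum_measureReal_preimage_singleton (μ := P) {l ∈ lists n | p l} (f := X)
    (fun l _ => hX (.of_discrete))
  refine Eq.trans ?_ h.symm
  congr 1
  ext ω
  simp [mem_lists, hn]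

/-- The probability that at most `c` of `n` Bernoulli variables with mean `x` are `1`. -/
noncomputable def lowerTail (n c : ℕ) (x : unitInterval) : ℝ :=
  ∑ l ∈ lists n with l.count true ≤ c, likelihood l x

lemma length_armSamples (n : ℕ) (x : unitInterval × (ℕ → unitInterval)) :
    (armSamples n x).length = n := by simp [armSamples]

lemma measureReal_armSamples (n : ℕ) (x : unitInterval) (p : List Bool → Prop) [DecidablePred p] :
    uniformSeq.real {v | p (armSamples n (x, v))} =
      ∑ l ∈ lists n with p l, likelihood l x := by
  have hm : Measurable fun v => armSamples n (x, v) :=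
    (measurable_armSamples n).comp measurable_prodMk_left
  rw [measureReal_eq_sum_lists hm (fun v => length_armSamples n (x, v)) p]
  refine Finset.sum_congr rfl fun l hl => ?_
  exact measure_armSamples (mem_lists.1 (Finset.mem_filter.1 hl).1) x

lemma count_armSamples_mono (n : ℕ) (v : ℕ → unitInterval) {x y : unitInterval} (h : x ≤ y) :
    (armSamples n (x, v)).count true ≤ (armSamples n (y, v)).count true := by
  simp only [armSamples, List.count_eq_countP, List.countP_map]
  refine List.countP_mono_left fun m _ hm => ?_
  simp only [Function.comp_apply, beq_true, decide_eq_true_eq] at hm ⊢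
  exact lt_of_lt_of_le hm h

/-- The same uniform variables generate the samples for both means, and a larger mean turns more of
them into successes. -/
lemma antitone_lowerTail (n c : ℕ) : Antitone (lowerTail n c) := by
  intro x y h
  rw [lowerTail, lowerTail, ← measureReal_armSamples, ← measureReal_armSamples]
  exact measureReal_mono fun v hv => (count_armSamples_mono n v h).trans hv

lemma likelihood_cons (b : Bool) (l : List Bool) (x : unitInterval) :
    likelihood (b :: l) x = (if b then (x : ℝ) else 1 - x) * likelihood l x := by
  simp [likelihood]

/-- One more trial can only add successes. -/
lemma lowerTail_succ_le (n c : ℕ) (x : unitInterval) : lowerTail (n + 1) c x ≤ lowerTail n c x := by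
  simp only [lowerTail, Finset.sum_filter]
  rw [sum_lists_succ, ← Finset.sum_add_distrib]
  refine Finset.sum_le_sum fun l _ => ?_
  have h0 := likelihood_nonneg l x
  have h1 := x.2
  simp only [likelihood_cons, List.count_cons_self, ne_eq, not_false_eq_true,
    List.count_cons_of_ne, reduceIte, Bool.false_eq_true]
  split_ifs <;> first | omega | nlinarith [h1.1, h1.2]

/-- Given m initial zeros, only n - m trials can succeed, which makes few successes at least as
likely as in n trials. The induction peels off one zero at a time. -/
lemma mul_lowerTail_le (n c : ℕ) (x : unitInterval) {m : ℕ} (hm : m ≤ n) :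
    (1 - (x : ℝ)) ^ m * lowerTail n c x ≤
      ∑ l ∈ lists n with (l.take m = List.replicate m false ∧ l.count true ≤ c),
        likelihood l x := by
  induction m generalizing n with
  | zero => simp [lowerTail]
  | succ m ih =>
    obtain ⟨n, rfl⟩ : ∃ k, n = k + 1 := ⟨n - 1, by omega⟩
    have h1 : 0 ≤ 1 - (x : ℝ) := by linarith [x.2.2]
    calc (1 - (x : ℝ)) ^ (m + 1) * lowerTail (n + 1) c x
        ≤ (1 - (x : ℝ)) ^ (m + 1) * lowerTail n c x := by
          gcongr; exact lowerTail_succ_le n c x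
      _ = (1 - x) * ((1 - (x : ℝ)) ^ m * lowerTail n c x) := by ring
      _ ≤ (1 - x) * ∑ l ∈ lists n with (l.take m = List.replicate m false ∧ l.count true ≤ c),
            likelihood l x := by
          gcongr; exact ih n (by omega)
      _ = _ := by
          rw [Finset.sum_filter, Finset.sum_filter, sum_lists_succ, Finset.mul_sum]
          simp only [List.take_succ_cons, List.replicate_succ, List.cons.injEq, Bool.true_eq_false,
            false_and, if_false, Finset.sum_const_zero, zero_add, true_and, likelihood_cons]
          refine Finset.sum_congr rfl fun l _ => ?_
          simp

variable {K : ℕ} (prior : Fin K → Measure unitInterval) [∀ i, IsProbabilityMeasure (prior i)]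

lemma measureReal_samples (i : Fin K) (n : ℕ) (p : List Bool → Prop) [DecidablePred p] :
    (worldLaw prior).real {w | p (samples i n w)} =
      ∫ x, ∑ l ∈ lists n with p l, likelihood l x ∂(prior i) := by
  rw [measureReal_eq_sum_lists (measurable_samples i n) (fun w => length_samples i n w) p,
    integral_finsetSum _ fun l _ => integrable_unitInterval (by fun_prop)]
  refine Finset.sum_congr rfl fun l hl => ?_
  exact measureReal_samples_eq prior i (mem_lists.1 (Finset.mem_filter.1 hl).1)

/-- Conditioning on initial zeros makes the number of successes stochastically smaller. -/
lemma mul_measureReal_le (i : Fin K) {m n : ℕ} (hm : m ≤ n) (c : ℕ) :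
    (worldLaw prior).real {w | ∀ k < m, reward i k w = false} *
      (worldLaw prior).real {w | (samples i n w).count true ≤ c} ≤
      (worldLaw prior).real ({w | ∀ k < m, reward i k w = false} ∩
        {w | (samples i n w).count true ≤ c}) := by
  have h1 : {w : World K | ∀ k < m, reward i k w = false} =
      {w | samples i m w = List.replicate m false} := by
    ext w; exact reward_zero_iff i m w
  have h2 : {w : World K | ∀ k < m, reward i k w = false} ∩
        {w | (samples i n w).count true ≤ c} = {w | (samples i n w).take m =
          List.replicate m false ∧ (samples i n w).count true ≤ c} := by
    rw [h1]
    ext w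
    simp [take_samples i hm]
  have hint : Integrable (fun x => lowerTail n c x) (prior i) :=
    integrable_finsetSum _ fun l _ => integrable_unitInterval (by fun_prop)
  have hcont : ∀ s : Finset (List Bool), Continuous fun x => ∑ l ∈ s, likelihood l x :=
    fun s => by fun_prop
  rw [h2, measureReal_samples prior i n fun l => l.take m = List.replicate m false ∧
    l.count true ≤ c, measureReal_samples prior i n fun l => l.count true ≤ c, h1,
    measureReal_samples_eq prior i (by simp)]
  have h3 : ∀ x, likelihood (List.replicate m false) x = (1 - (x : ℝ)) ^ m := fun x => by
    simp [likelihood_eq, List.count_replicate]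
  simp_rw [h3]
  -- Given the mean x, the probability (1 - x)^m of initial zeros and the lower tail both decrease
  -- in x, so they are positively correlated under the prior.
  refine (integral_mul_integral_le_of_monovary (f := fun x : unitInterval => (1 - (x : ℝ)) ^ m)
    (g := lowerTail n c) (integrable_unitInterval (by fun_prop)) hint
    (integrable_unitInterval (Continuous.mul (by fun_prop) (hcont _))) fun x y => ?_).trans ?_
  · rcases le_total x y with h | h
    · refine mul_nonneg (sub_nonneg.2 ?_) (sub_nonneg.2 (antitone_lowerTail n c h))
      have : (x : ℝ) ≤ y := h
      exact pow_le_pow_left₀ (by linarith [y.2.2]) (by linarith) m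
    · refine mul_nonneg_of_nonpos_of_nonpos (sub_nonpos.2 ?_)
        (sub_nonpos.2 (antitone_lowerTail n c h))
      have : (y : ℝ) ≤ x := h
      exact pow_le_pow_left₀ (by linarith [x.2.2]) (by linarith) m
  · exact integral_mono (integrable_unitInterval (Continuous.mul (by fun_prop) (hcont _)))
      (integrable_unitInterval (hcont _)) fun x => mul_lowerTail_le n c x hm

/-! ### The posterior mean given the samples of one arm -/

lemma posteriorMean_single (i : Fin K) {n : ℕ} {l : List Bool} (hl : l.length = n) :
    posteriorMean prior {i} n (fun _ => l) i =
      (∫ x, likelihood l x ∂(prior i))⁻¹ * ∫ x, (x : ℝ) * likelihood l x ∂(prior i) := by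
  have h : agrees {i} n (fun _ => l) = {w : World K | samples i n w = l} := by
    ext w
    simp [agrees, List.take_of_length_le hl.le]
  rw [posteriorMean, integral_cond_eq, h, measureReal_samples_eq prior i hl,
    setIntegral_samples_eq prior i hl (f := fun x => (x : ℝ)) (by fun_prop) (c := 1)
      fun x => by rw [abs_of_nonneg x.2.1]; exact x.2.2]

/-- Monotone likelihood ratio: for lists of equal length, d additional successes multiply the ratio
by (x / (1 - x))^d, which increases in x. The cross-multiplied form avoids division by zero. -/
lemma likelihood_mul_le {l l' : List Bool} (hl : l.length = l'.length)
    (h : l.count true ≤ l'.count true) {x y : unitInterval} (hxy : x ≤ y) :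
    likelihood l' x * likelihood l y ≤ likelihood l' y * likelihood l x := by
  have hc : ∀ l : List Bool, l.count true + l.count false = l.length := fun l => by
    induction l with
    | nil => rfl
    | cons b l ih => cases b <;> simp <;> omega
  obtain ⟨d, hd⟩ := Nat.exists_eq_add_of_le h
  have h1 := hc l
  have h2 := hc l'
  have hd' : l.count false = l'.count false + d := by omega
  simp only [likelihood_eq, hd, hd', pow_add]
  have hx := x.2
  have hy := y.2
  have hx1 : 0 ≤ 1 - (x : ℝ) := by linarith [hx.2]
  have hy1 : 0 ≤ 1 - (y : ℝ) := by linarith [hy.2]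
  have hxy' : (x : ℝ) ≤ y := hxy
  have key : ((x : ℝ) * (1 - y)) ^ d ≤ ((y : ℝ) * (1 - x)) ^ d :=
    pow_le_pow_left₀ (mul_nonneg hx.1 hy1) (by nlinarith) d
  rw [mul_pow, mul_pow] at key
  have hA : 0 ≤ (x : ℝ) ^ l.count true * (y : ℝ) ^ l.count true * (1 - (x : ℝ)) ^ l'.count false *
      (1 - (y : ℝ)) ^ l'.count false :=
    mul_nonneg (mul_nonneg (mul_nonneg (pow_nonneg hx.1 _) (pow_nonneg hy.1 _))
      (pow_nonneg hx1 _)) (pow_nonneg hy1 _)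
  nlinarith [mul_le_mul_of_nonneg_left key hA]

/-- The posterior mean increases with the number of successes. -/
lemma posteriorMean_single_mono (i : Fin K) {n : ℕ} {l l' : List Bool} (hl : l.length = n)
    (hl' : l'.length = n) (h : l.count true ≤ l'.count true)
    (hp : 0 < ∫ x, likelihood l x ∂(prior i)) (hp' : 0 < ∫ x, likelihood l' x ∂(prior i)) :
    posteriorMean prior {i} n (fun _ => l) i ≤ posteriorMean prior {i} n (fun _ => l') i := by
  rw [posteriorMean_single prior i hl, posteriorMean_single prior i hl', inv_mul_le_iff₀ hp,
    mul_left_comm, ← div_eq_inv_mul, le_div_iff₀ hp']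
  -- By the monotone likelihood ratio the two factors have the same sign. Expanding the double
  -- integral gives twice the cross-multiplied inequality between posterior means.
  have h0 : 0 ≤ ∫ x, ∫ y, ((x : ℝ) - y) * (likelihood l' x * likelihood l y -
      likelihood l' y * likelihood l x) ∂(prior i) ∂(prior i) := by
    refine integral_nonneg fun x => integral_nonneg fun y => ?_
    rcases le_total x y with hxy | hxy
    · have : (x : ℝ) ≤ y := hxy
      exact mul_nonneg_of_nonpos_of_nonpos (by linarith)
        (sub_nonpos.2 (likelihood_mul_le (hl.trans hl'.symm) h hxy))
    · have : (y : ℝ) ≤ x := hxy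
      exact mul_nonneg (by linarith)
        (sub_nonneg.2 (likelihood_mul_le (hl.trans hl'.symm) h hxy))
  have hI : ∀ f : unitInterval → ℝ, Continuous f → Integrable f (prior i) := fun f hf =>
    integrable_unitInterval hf
  have h1 : ∀ x : unitInterval, ∫ y, ((x : ℝ) - y) * (likelihood l' x * likelihood l y -
      likelihood l' y * likelihood l x) ∂(prior i) =
      (x * likelihood l' x) * (∫ y, likelihood l y ∂(prior i))
      - (x * likelihood l x) * (∫ y, likelihood l' y ∂(prior i))
      - (likelihood l' x * (∫ y, y * likelihood l y ∂(prior i))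
      - likelihood l x * (∫ y, y * likelihood l' y ∂(prior i))) := by
    intro x
    simp only [← integral_const_mul]
    rw [← integral_sub (hI _ (by fun_prop)) (hI _ (by fun_prop)),
      ← integral_sub (hI _ (by fun_prop)) (hI _ (by fun_prop)),
      ← integral_sub (hI _ (by fun_prop)) (hI _ (by fun_prop))]
    congr 1
    ext y
    ring
  simp_rw [h1] at h0
  rw [integral_sub (hI _ (by fun_prop)) (hI _ (by fun_prop)),
    integral_sub (hI _ (by fun_prop)) (hI _ (by fun_prop)),
    integral_sub (hI _ (by fun_prop)) (hI _ (by fun_prop))] at h0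
  simp only [integral_mul_const] at h0
  linarith

/-! ### Fake data -/

lemma measureReal_cond {Ω : Type*} [MeasurableSpace Ω] {P : Measure Ω} {s : Set Ω}
    (hs : MeasurableSet s) (t : Set Ω) :
    (ProbabilityTheory.cond P s).real t = (P.real s)⁻¹ * P.real (s ∩ t) := by
  rw [measureReal_def, ProbabilityTheory.cond_apply hs, ENNReal.toReal_mul, ENNReal.toReal_inv]
  rfl

/-- The quantile coupling is applied to the conditional and the unconditional law of the samples,
ranked by the number of successes. `mul_measureReal_le` gives the stochastic domination, and more
successes mean a larger posterior mean. -/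
lemma exists_isFakeData {i : Fin K} {N₀ N : ℕ} (hN : N₀ ≤ N)
    (hZ : worldLaw prior {w | ∀ n < N₀, reward i n w = false} ≠ 0) :
    ∃ κ, IsFakeData prior N₀ N i κ := by
  set Z : Set (World K) := {w | ∀ n < N₀, reward i n w = false} with hZdef
  have hZm : MeasurableSet Z := by
    have : Z = {w | samples i N₀ w = List.replicate N₀ false} := by
      ext w; exact reward_zero_iff i N₀ w
    rw [this]
    exact measurable_samples i N₀ (.of_discrete (s := {List.replicate N₀ false}))
  have hcond : IsProbabilityMeasure (ProbabilityTheory.cond (worldLaw prior) Z) :=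
    ProbabilityTheory.cond_isProbabilityMeasure hZ
  set Q := ProbabilityTheory.cond (worldLaw prior) Z with hQ
  let p₀ : List Bool → ℝ := fun l => Q.real {w | samples i N w = l}
  let p₁ : List Bool → ℝ := fun l => (worldLaw prior).real {w | samples i N w = l}
  have hsum : ∀ (P : Measure (World K)) [IsProbabilityMeasure P],
      ∑ l ∈ lists N, P.real {w | samples i N w = l} = 1 := by
    intro P _
    have := measureReal_eq_sum_lists (P := P) (measurable_samples i N)
      (fun w => length_samples i N w) (fun _ => True)
    simpa using this.symm
  -- Ties in the number of successes are broken by the list itself, so that the ranking becomes a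
  -- linear order.
  have hinj : Function.Injective fun l : List Bool => toLex (l.count true, l) := by
    intro a b h
    have h' := congrArg (fun x => (ofLex x).2) h
    exact h'
  obtain ⟨κ, hκm, hκl, hκd⟩ := @exists_quantile_coupling (List Bool)
    (LinearOrder.lift' (fun l : List Bool => toLex (l.count true, l)) hinj) (lists N) p₀ p₁
    (fun _ => measureReal_nonneg) (fun _ => measureReal_nonneg) (hsum Q) (hsum _)
    (fun l => l.count true)
    (fun a b (h : toLex (a.count true, a) ≤ toLex (b.count true, b)) =>
      Prod.Lex.monotone_fst _ _ h) (by
    intro c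
    have hz : 0 < (worldLaw prior).real Z := ENNReal.toReal_pos hZ (measure_ne_top _ _)
    rw [← measureReal_eq_sum_lists (measurable_samples i N) (fun w => length_samples i N w)
      fun l => l.count true ≤ c, ← measureReal_eq_sum_lists (measurable_samples i N)
      (fun w => length_samples i N w) fun l => l.count true ≤ c, hQ,
      measureReal_cond hZm, le_inv_mul_iff₀ hz]
    exact mul_measureReal_le prior i hN c)
  -- The default value `[]` is used only on the null event where the coupling returns no list.
  have hmeas : ∀ l l' : List Bool, MeasurableSet {u | (κ l u).getD [] = l'} := by
    intro l l'
    have : {u | (κ l u).getD [] = l'} = ⋃ o ∈ {o : Option (List Bool) | o.getD [] = l'},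
        {u | κ l u = o} := by
      ext u; simp
    rw [this]
    exact .biUnion (Set.to_countable _) fun o _ => hκm l o
  have hprod : ∀ s : List Bool → Set unitInterval, (∀ l, MeasurableSet (s l)) →
      (Q.prod volume).real {p : World K × unitInterval | p.2 ∈ s (samples i N p.1)} =
        ∑ l ∈ lists N, p₀ l * (volume : Measure unitInterval).real (s l) := by
    intro s hs
    have h1 : {p : World K × unitInterval | p.2 ∈ s (samples i N p.1)} =
        ⋃ l ∈ lists N, {w | samples i N w = l} ×ˢ s l := by
      ext p
      simp [mem_lists]
    rw [h1, measureReal_biUnion_finset]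
    · refine Finset.sum_congr rfl fun l _ => ?_
      rw [measureReal_prod_prod]
    · intro a _ b _ hab
      rw [Function.onFun, Set.disjoint_left]
      rintro p ⟨h1, -⟩ ⟨h2, -⟩
      exact hab (h1.symm.trans h2)
    · intro l _
      exact MeasurableSet.prod (measurable_samples i N (.of_discrete (s := {l}))) (hs l)
  have hlaw : ∀ l' ∈ lists N, (Q.prod volume).real
      {p : World K × unitInterval | κ (samples i N p.1) p.2 = some l'} = p₁ l' := by
    intro l' hl'
    rw [← hκl l' hl']
    exact hprod (fun l => {u | κ l u = some l'}) fun l => hκm l _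
  -- The probabilities with which the coupling returns the various lists of length `N` already add
  -- up to 1.
  have hae : ∀ᵐ p ∂(Q.prod (volume : Measure unitInterval)),
      ∃ l' ∈ lists N, κ (samples i N p.1) p.2 = some l' := by
    have hm : ∀ l', MeasurableSet
        {p : World K × unitInterval | κ (samples i N p.1) p.2 = some l'} := by
      intro l'
      have h1 : {p : World K × unitInterval | κ (samples i N p.1) p.2 = some l'} =
          ⋃ l ∈ lists N, {w | samples i N w = l} ×ˢ {u | κ l u = some l'} := by
        ext p
        simp [mem_lists]
      rw [h1]
      exact Finset.measurableSet_biUnion _ fun l _ =>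
        MeasurableSet.prod (measurable_samples i N (.of_discrete (s := {l}))) (hκm l _)
    have hU : (Q.prod volume).real (⋃ l' ∈ lists N,
        {p : World K × unitInterval | κ (samples i N p.1) p.2 = some l'}) = 1 := by
      rw [measureReal_biUnion_finset _ fun l' _ => hm l']
      · rw [Finset.sum_congr rfl hlaw]
        exact hsum _
      · intro a _ b _ hab
        rw [Function.onFun, Set.disjoint_left]
        intro p h1 h2
        exact hab (Option.some.inj (h1.symm.trans h2))
    have hU' : (Q.prod volume) (⋃ l' ∈ lists N,
        {p : World K × unitInterval | κ (samples i N p.1) p.2 = some l'}) = 1 := by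
      rw [measureReal_def] at hU
      exact (ENNReal.toReal_eq_one_iff _).1 hU
    have := (mem_ae_iff_prob_eq_one (Finset.measurableSet_biUnion _ fun l' _ => hm l')).2 hU'
    filter_upwards [this] with p hp
    simpa using hp
  refine ⟨fun l u => (κ l u).getD [], hmeas, fun l' => ?_, ?_⟩
  · by_cases hl' : l' ∈ lists N
    · have h1 : (Q.prod volume) {p : World K × unitInterval | (κ (samples i N p.1) p.2).getD [] = l'}
          = (Q.prod volume) {p : World K × unitInterval | κ (samples i N p.1) p.2 = some l'} := by
        refine measure_congr ?_
        filter_upwards [hae] with p ⟨l, hl, hp⟩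
        refine propext ?_
        change (κ _ _).getD [] = l' ↔ κ _ _ = some l'
        simp [hp]
      refine h1.trans ?_
      exact (ENNReal.toReal_eq_toReal_iff' (measure_ne_top _ _) (measure_ne_top _ _)).1
        (hlaw l' hl')
    · have h1 : {w : World K | samples i N w = l'} = ∅ := by
        ext w
        simp only [Set.mem_ofPred_eq, Set.mem_empty_iff_false, iff_false]
        rintro rfl
        exact hl' (mem_lists.2 (length_samples i N w))
      rw [h1, measure_empty]
      rw [measure_eq_zero_iff_ae_notMem]
      filter_upwards [hae] with p ⟨l, hl, hp⟩ hpl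
      refine hl' ?_
      have : (κ (samples i N p.1) p.2).getD [] = l' := hpl
      rw [hp, Option.getD_some] at this
      exact this ▸ hl
  -- Posterior means are comparable only at lists of positive prior probability. The true and the
  -- fake list both have this property almost surely.
  · have hpos₁ : ∀ᵐ p ∂(Q.prod (volume : Measure unitInterval)),
        0 < p₁ (samples i N p.1) := by
      have h1 : ∀ᵐ w ∂(worldLaw prior), 0 < p₁ (samples i N w) := by
        have : ∀ᵐ w ∂(worldLaw prior), ∀ l ∈ lists N, p₁ l = 0 → samples i N w ≠ l := by
          rw [Filter.eventually_all_finset]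
          intro l _
          by_cases h0 : p₁ l = 0
          · have := (measureReal_eq_zero_iff (measure_ne_top _ _)).1 h0
            filter_upwards [measure_eq_zero_iff_ae_notMem.1 this] with w hw _
            exact hw
          · exact .of_forall fun w h => absurd h h0
        filter_upwards [this] with w hw
        refine lt_of_le_of_ne measureReal_nonneg fun h0 => ?_
        exact hw _ (mem_lists.2 (length_samples i N w)) h0.symm rfl
      have h2 : ∀ᵐ w ∂Q, 0 < p₁ (samples i N w) :=
        ProbabilityTheory.cond_absolutelyContinuous.ae_le h1
      exact Measure.quasiMeasurePreserving_fst.ae h2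
    have hpos₂ : ∀ᵐ p ∂(Q.prod (volume : Measure unitInterval)),
        ∀ l' ∈ lists N, p₁ l' = 0 → κ (samples i N p.1) p.2 ≠ some l' := by
      rw [Filter.eventually_all_finset]
      intro l' hl'
      by_cases h0 : p₁ l' = 0
      · have := (measureReal_eq_zero_iff (measure_ne_top _ _)).1 ((hlaw l' hl').trans h0)
        filter_upwards [measure_eq_zero_iff_ae_notMem.1 this] with p hp _
        exact hp
      · exact .of_forall fun p h => absurd h h0
    filter_upwards [hae, hpos₁, hpos₂] with p ⟨l', hl', hp⟩ h1 h2
    have h3 : 0 < p₁ l' := lt_of_le_of_ne measureReal_nonneg fun h0 => h2 l' hl' h0.symm hp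
    have hlen := length_samples i N p.1
    rw [hp, Option.getD_some]
    refine posteriorMean_single_mono prior i hlen (mem_lists.1 hl')
      (hκd _ (mem_lists.2 hlen) p.2 l' hp) ?_ ?_
    · rw [← measureReal_samples_eq prior i hlen]; exact h1
    · rw [← measureReal_samples_eq prior i (mem_lists.1 hl')]; exact h3

end

section

/-! ### A theorem of the alternative -/

/-- The minimax theorem for a player who chooses a vector in a cube. -/
lemma exists_forall_le_sum {T ι : Type*} [Fintype T] [Fintype ι] (c : T → ι → ℝ) (b : ι → ℝ)
    (h : ∀ q : ι → ℝ, (∀ i, 0 ≤ q i) → ∃ φ : T → ℝ, (∀ t, φ t ∈ Set.Icc (0 : ℝ) 1) ∧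
      ∑ i, q i * b i ≤ ∑ i, q i * ∑ t, φ t * c t i) :
    ∃ φ : T → ℝ, (∀ t, φ t ∈ Set.Icc (0 : ℝ) 1) ∧ ∀ i, b i ≤ ∑ t, φ t * c t i := by
  classical
  let L : (T → ℝ) →ₗ[ℝ] (ι → ℝ) :=
    { toFun := fun φ i => ∑ t, φ t * c t i
      map_add' := fun φ ψ => by
        ext i; simp [add_mul, Finset.sum_add_distrib]
      map_smul' := fun r φ => by
        ext i; simp [Finset.mul_sum, mul_assoc] }
  set Q : Set (T → ℝ) := Set.univ.pi fun _ => Set.Icc (0 : ℝ) 1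
  have hQ : IsCompact Q := isCompact_univ_pi fun _ => isCompact_Icc
  have hQc : Convex ℝ Q := convex_pi fun _ _ => convex_Icc 0 1
  by_contra! hne
  -- The image of the cube is compact and convex. If no choice met all the bounds, a hyperplane
  -- would separate it from the orthant above `b`, and the normal vector would contradict the
  -- hypothesis.
  have hdisj : Disjoint (L '' Q) (Set.Ici b) := by
    rw [Set.disjoint_left]
    rintro _ ⟨φ, hφ, rfl⟩ hb
    obtain ⟨i, hi⟩ := hne φ fun t => hφ t trivial
    exact absurd (hb i) (not_le.2 hi)
  obtain ⟨f, u, v, hA, huv, hB⟩ := geometric_hahn_banach_compact_closed (hQc.linear_image L)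
    (hQ.image L.continuous_of_finiteDimensional) (convex_Ici b) isClosed_Ici hdisj
  let q : ι → ℝ := fun i => f (Pi.single i 1)
  have hf : ∀ y : ι → ℝ, f y = ∑ i, q i * y i := by
    intro y
    conv_lhs => rw [pi_eq_sum_univ' y]
    rw [map_sum]
    refine Finset.sum_congr rfl fun i _ => ?_
    rw [map_smul, smul_eq_mul, mul_comm]
  have hq : ∀ i, 0 ≤ q i := by
    intro i
    by_contra! hi
    have hv := hB b (Set.mem_Ici.2 le_rfl)
    -- A negative coefficient would make the functional unbounded below on the orthant; the step
    -- length is chosen so that it takes exactly the forbidden value `v`.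
    have h1 := hB (b + ((f b - v) / (-q i)) • Pi.single i 1) (by
      rw [Set.mem_Ici, le_add_iff_nonneg_right]
      refine smul_nonneg (div_nonneg (by linarith) (by linarith)) ?_
      exact Pi.single_nonneg.2 zero_le_one)
    rw [map_add, map_smul, smul_eq_mul] at h1
    change v < f b + (f b - v) / (-q i) * q i at h1
    have : (f b - v) / (-q i) * q i = -(f b - v) := by
      rw [div_neg, neg_mul, div_mul_cancel₀ _ hi.ne]
    linarith
  obtain ⟨φ, hφ, hle⟩ := h q hq
  have h1 := hA (L φ) ⟨φ, fun t _ => hφ t, rfl⟩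
  have h2 := hB b (Set.mem_Ici.2 le_rfl)
  rw [hf] at h1 h2
  have h3 : ∑ i, q i * L φ i = ∑ i, q i * ∑ t, φ t * c t i := rfl
  linarith

/-! ### Empirical means -/

lemma sum_lists_likelihood (n : ℕ) (x : unitInterval) : ∑ l ∈ lists n, likelihood l x = 1 := by
  induction n with
  | zero => simp [lists, likelihood]
  | succ n ih =>
    rw [sum_lists_succ]
    simp only [likelihood_cons, ← Finset.mul_sum, ih]
    simp

lemma sum_lists_second_moment (n : ℕ) (x : unitInterval) :
    ∑ l ∈ lists n, ((l.count true : ℝ) - n * x) ^ 2 * likelihood l x = n * (x * (1 - x)) := by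
  induction n with
  | zero => simp [lists]
  | succ n ih =>
    have h0 := sum_lists_likelihood n x
    rw [sum_lists_succ, ← Finset.sum_add_distrib]
    -- Averaging over the new trial removes the cross term, since its centred value has mean zero,
    -- and adds its variance x(1 - x).
    calc _ = ∑ l ∈ lists n, (((l.count true : ℝ) - n * x) ^ 2 * likelihood l x +
          x * (1 - x) * likelihood l x) := by
          refine Finset.sum_congr rfl fun l _ => ?_
          simp only [likelihood_cons, List.count_cons_self, ne_eq, not_false_eq_true,
            List.count_cons_of_ne, reduceIte, Bool.false_eq_true]
          push_cast
          ring
      _ = _ := by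
          rw [Finset.sum_add_distrib, ih, ← Finset.mul_sum, h0]
          push_cast
          ring

variable {K : ℕ}

lemma integral_eq_sum_lists {Ω : Type*} [MeasurableSpace Ω] {P : Measure Ω}
    {X : Ω → List Bool} (hX : Measurable X) {n : ℕ} (hn : ∀ ω, (X ω).length = n)
    {f : Ω → ℝ} (hf : Integrable f P) :
    ∫ ω, f ω ∂P = ∑ l ∈ lists n, ∫ ω in {ω | X ω = l}, f ω ∂P := by
  rw [← integral_biUnion_finset]
  · have : (⋃ l ∈ lists n, {ω | X ω = l}) = Set.univ := by
      ext ω; simp [mem_lists, hn]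
    rw [this, Measure.restrict_univ]
  · exact fun l _ => hX (.of_discrete (s := {l}))
  · intro a _ b _ hab
    rw [Function.onFun, Set.disjoint_left]
    exact fun ω h1 h2 => hab (h1.symm.trans h2)
  · exact fun l _ => hf.integrableOn

/-- The empirical mean of a list of samples. -/
noncomputable def empMean (n : ℕ) (l : List Bool) : ℝ := l.count true / n

lemma empMean_mem {n : ℕ} {l : List Bool} (hl : l.length = n) :
    0 ≤ empMean n l ∧ empMean n l ≤ 1 := by
  refine ⟨by unfold empMean; positivity, ?_⟩
  refine div_le_one_of_le₀ ?_ (by positivity)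
  exact_mod_cast List.count_le_length.trans hl.le

@[fun_prop]
lemma measurable_empMean (n : ℕ) : Measurable (empMean n) := .of_discrete

section

variable (prior : Fin K → Measure unitInterval) [∀ i, IsProbabilityMeasure (prior i)]

lemma abs_empMean_sub_le (i : Fin K) (n : ℕ) (w : World K) :
    |empMean n (samples i n w) - w.1 i| ≤ 1 := by
  have h1 := empMean_mem (length_samples i n w)
  have h2 := (w.1 i).2
  rw [abs_le]
  constructor <;> linarith [h1.1, h1.2, h2.1, h2.2]

lemma integral_sq_empMean_sub_le (i : Fin K) {n : ℕ} (hn : 0 < n) :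
    ∫ w, (empMean n (samples i n w) - w.1 i) ^ 2 ∂(worldLaw prior) ≤ 1 / (4 * n) := by
  have hint : Integrable (fun w : World K => (empMean n (samples i n w) - w.1 i) ^ 2)
      (worldLaw prior) := by
    refine Integrable.of_bound (Measurable.aestronglyMeasurable (by fun_prop)) 1
      (.of_forall fun w => ?_)
    rw [Real.norm_eq_abs, abs_pow]
    exact pow_le_one₀ (abs_nonneg _) (abs_empMean_sub_le i n w)
  rw [integral_eq_sum_lists (measurable_samples i n) (length_samples i n) hint]
  have h1 : ∀ l ∈ lists n, ∫ w in {w | samples i n w = l},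
      (empMean n (samples i n w) - w.1 i) ^ 2 ∂(worldLaw prior) =
      ∫ x, (empMean n l - (x : ℝ)) ^ 2 * likelihood l x ∂(prior i) := by
    intro l hl
    rw [← setIntegral_samples_eq prior i (mem_lists.1 hl) (f := fun x => (empMean n l - x) ^ 2)
      (by fun_prop) (c := 1)]
    · exact setIntegral_congr_fun (measurable_samples i n (.of_discrete (s := {l})))
        fun w hw => by
          have : samples i n w = l := hw
          simp only [this]
    · intro x
      have h1 := empMean_mem (mem_lists.1 hl)
      have h2 := x.2
      rw [abs_pow]
      refine pow_le_one₀ (abs_nonneg _) ?_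
      rw [abs_le]
      constructor <;> linarith [h1.1, h1.2, h2.1, h2.2]
  rw [Finset.sum_congr rfl h1, ← integral_finsetSum _ fun l _ =>
    integrable_unitInterval (by fun_prop)]
  have h2 : ∀ x : unitInterval, ∑ l ∈ lists n, (empMean n l - (x : ℝ)) ^ 2 * likelihood l x ≤
      1 / (4 * n) := by
    intro x
    have hn' : (0 : ℝ) < n := by exact_mod_cast hn
    have e : ∀ l ∈ lists n, (empMean n l - (x : ℝ)) ^ 2 * likelihood l x =
        (1 / (n : ℝ) ^ 2) * (((l.count true : ℝ) - n * x) ^ 2 * likelihood l x) := by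
      intro l _
      unfold empMean
      field_simp
    rw [Finset.sum_congr rfl e, ← Finset.mul_sum, sum_lists_second_moment]
    have : (x : ℝ) * (1 - x) ≤ 1 / 4 := by nlinarith [sq_nonneg ((x : ℝ) - 1 / 2)]
    calc 1 / (n : ℝ) ^ 2 * (n * ((x : ℝ) * (1 - x)))
        ≤ 1 / (n : ℝ) ^ 2 * ((n : ℝ) * (1 / 4)) := by gcongr
      _ = 1 / (4 * (n : ℝ)) := by field_simp
  refine (integral_mono (integrable_unitInterval (by fun_prop)) (integrable_const _) h2).trans ?_
  simp

lemma integrable_abs_empMean_sub (i : Fin K) (n : ℕ) :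
    Integrable (fun w : World K => |empMean n (samples i n w) - w.1 i|) (worldLaw prior) :=
  Integrable.of_bound (Measurable.aestronglyMeasurable (by fun_prop)) 1
    (.of_forall fun w => by
      rw [Real.norm_eq_abs, abs_abs]; exact abs_empMean_sub_le i n w)

/-- The pointwise bound |d| ≤ √n d² + 1/(4√n), a completed square, replaces the Cauchy–Schwarz
inequality; the variance bound makes both terms 1/(4√n). -/
lemma integral_abs_empMean_sub_le (i : Fin K) {n : ℕ} (hn : 0 < n) :
    ∫ w, |empMean n (samples i n w) - w.1 i| ∂(worldLaw prior) ≤ 1 / (2 * √n) := by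
  have hn' : (0 : ℝ) < n := by exact_mod_cast hn
  have hs : 0 < √(n : ℝ) := Real.sqrt_pos.2 hn'
  have hsq : √(n : ℝ) ^ 2 = n := Real.sq_sqrt hn'.le
  have h1 : ∀ w : World K, |empMean n (samples i n w) - w.1 i| ≤
      √n * (empMean n (samples i n w) - w.1 i) ^ 2 + 1 / (4 * √n) := by
    intro w
    set a := |empMean n (samples i n w) - w.1 i|
    rw [← sq_abs]
    have : 0 ≤ √(n : ℝ) * (a - 1 / (2 * √n)) ^ 2 := by positivity
    have e : √(n : ℝ) * (a - 1 / (2 * √n)) ^ 2 = √n * a ^ 2 + 1 / (4 * √n) - a := by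
      field_simp
      ring
    linarith
  have hint : Integrable (fun w : World K => (empMean n (samples i n w) - w.1 i) ^ 2)
      (worldLaw prior) := by
    refine Integrable.of_bound (Measurable.aestronglyMeasurable (by fun_prop)) 1
      (.of_forall fun w => ?_)
    rw [Real.norm_eq_abs, abs_pow]
    exact pow_le_one₀ (abs_nonneg _) (abs_empMean_sub_le i n w)
  refine (integral_mono (integrable_abs_empMean_sub prior i n)
    ((hint.const_mul _).add (integrable_const _)) h1).trans ?_
  rw [integral_add' (hint.const_mul _) (integrable_const _), integral_const_mul, integral_const]
  have h2 := integral_sq_empMean_sub_le prior i hn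
  simp only [probReal_univ, one_smul]
  calc _ ≤ √(n : ℝ) * (1 / (4 * n)) + 1 / (4 * √n) := by gcongr
    _ = √(n : ℝ) * (1 / (4 * √n ^ 2)) + 1 / (4 * √n) := by rw [hsq]
    _ = 1 / (2 * √n) := by
      generalize √(n : ℝ) = r at hs
      field_simp
      norm_num

end

end

section

/-! ### Suitable policies -/

variable {K : ℕ} (prior : Fin K → Measure unitInterval) [∀ i, IsProbabilityMeasure (prior i)]

lemma iIndepFun_arm : ProbabilityTheory.iIndepFun (fun (i : Fin K) w => arm i w)
    (worldLaw prior) := by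
  rw [ProbabilityTheory.iIndepFun_iff_map_fun_eq_pi_map fun i => by fun_prop, map_arm_worldLaw]
  simp_rw [map_arm_eq]

/-- Decoupling one arm from finitely many others. -/
lemma integral_decouple {k : Fin K} {S : Finset (Fin K)} (hk : k ∉ S)
    {F : (unitInterval × (ℕ → unitInterval)) × (S → unitInterval × (ℕ → unitInterval)) → ℝ}
    (hF : Measurable F) {c : ℝ} (hc : ∀ x, |F x| ≤ c) :
    ∫ w, F (arm k w, fun i : S => arm i w) ∂(worldLaw prior) =
      ∫ w', ∫ w, F (arm k w, fun i : S => arm i w') ∂(worldLaw prior) ∂(worldLaw prior) := by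
  have h1 := (iIndepFun_arm prior).indepFun_finset {k} S (by simpa using hk)
    fun i => measurable_arm i
  have h2 : ProbabilityTheory.IndepFun (arm k) (fun w (i : S) => arm i w) (worldLaw prior) :=
    h1.comp (φ := fun a : (({k} : Finset (Fin K)) → unitInterval × (ℕ → unitInterval)) =>
      a ⟨k, by simp⟩) (ψ := id) (by fun_prop) measurable_id
  have h3 := h2.map_prod_eq_prod_map_map (by fun_prop)
    (Measurable.aemeasurable (by fun_prop))
  have hP : Measurable fun w : World K => (fun i : S => arm (i : Fin K) w) := by fun_prop
  have e1 : ∫ w, F (arm k w, fun i : S => arm i w) ∂(worldLaw prior) =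
      ∫ p, F p ∂((worldLaw prior).map fun w => (arm k w, fun i : S => arm (i : Fin K) w)) := by
    rw [integral_map (Measurable.aemeasurable (by fun_prop)) hF.aestronglyMeasurable]
  have i1 : IsProbabilityMeasure ((worldLaw prior).map (arm k)) :=
    Measure.isProbabilityMeasure_map (by fun_prop)
  have i2 : IsProbabilityMeasure ((worldLaw prior).map fun w (i : S) => arm (i : Fin K) w) :=
    Measure.isProbabilityMeasure_map hP.aemeasurable
  rw [e1, h3, integral_prod_symm _ (Integrable.of_bound hF.aestronglyMeasurable c
    (.of_forall hc)), integral_map hP.aemeasurable]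
  · congr 1
    ext w'
    rw [integral_map (by fun_prop) (Measurable.aestronglyMeasurable (by fun_prop))]
  · exact hF.stronglyMeasurable.integral_prod_left'.aestronglyMeasurable

/-- Observing that the empirical mean of an arm is large makes its mean reward larger. -/
lemma mul_integral_le_of_empMean (j : Fin K) (n : ℕ) (c : ℝ) :
    priorMean prior j *
        ∫ w, (if c < empMean n (samples j n w) then (1 : ℝ) else 0) ∂(worldLaw prior) ≤
      ∫ w, (w.1 j : ℝ) * (if c < empMean n (samples j n w) then (1 : ℝ) else 0)
        ∂(worldLaw prior) := by
  have hm : MeasurableSet {x | c < empMean n (armSamples n x)} :=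
    measurableSet_lt (by fun_prop) (by fun_prop)
  have hmi : Measurable fun x => if c < empMean n (armSamples n x) then (1 : ℝ) else 0 :=
    Measurable.ite hm (by fun_prop) (by fun_prop)
  have h1 := integral_arm prior j
    (g := fun x => if c < empMean n (armSamples n x) then (1 : ℝ) else 0) hmi (c := 1)
    (fun x => by split_ifs <;> simp)
  have h2 := integral_arm prior j
    (g := fun x => (x.1 : ℝ) * if c < empMean n (armSamples n x) then (1 : ℝ) else 0)
    (by fun_prop) (c := 1)
    (fun x => by
      have := x.1.2
      split_ifs <;> simp [abs_of_nonneg this.1, this.2])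
  -- The probability of passing the threshold, given the mean. It increases with the mean because
  -- the same uniforms generate all samples, so the association inequality applies.
  let g : unitInterval → ℝ := fun x => uniformSeq.real {v | c < empMean n (armSamples n (x, v))}
  have hg : ∀ x, ∫ v, (if c < empMean n (armSamples n (x, v)) then (1 : ℝ) else 0) ∂uniformSeq =
      g x := by
    intro x
    have hm' : MeasurableSet {v | c < empMean n (armSamples n (x, v))} :=
      measurable_prodMk_left hm
    change _ = uniformSeq.real {v | c < empMean n (armSamples n (x, v))}
    rw [← integral_indicator_one hm']
    congr 1
  have hmono : Monotone g := fun x y h => measureReal_mono fun v hv => by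
    rw [Set.mem_ofPred_eq] at hv ⊢
    refine hv.trans_le ?_
    unfold empMean
    gcongr
    exact count_armSamples_mono n v h
  simp only [integral_const_mul, hg] at h1 h2
  change ∫ w, (if c < empMean n (samples j n w) then (1 : ℝ) else 0) ∂(worldLaw prior) = _ at h1
  change ∫ w, (w.1 j : ℝ) * (if c < empMean n (samples j n w) then (1 : ℝ) else 0)
        ∂(worldLaw prior) = _ at h2
  rw [h1, h2, priorMean]
  have hgi : Integrable g (prior j) := Integrable.of_bound hmono.measurable.aestronglyMeasurable 1
    (.of_forall fun x => by
      rw [Real.norm_eq_abs, abs_of_nonneg measureReal_nonneg]; exact measureReal_le_one)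
  refine integral_mul_integral_le_of_monovary (integrable_unitInterval (by fun_prop)) hgi
    ?_ fun x y => ?_
  · refine Integrable.of_bound (Measurable.aestronglyMeasurable
      (Measurable.mul (by fun_prop) hmono.measurable)) 1 (.of_forall fun x => ?_)
    rw [Real.norm_eq_abs, abs_of_nonneg (mul_nonneg x.2.1 measureReal_nonneg)]
    exact mul_le_one₀ x.2.2 measureReal_nonneg measureReal_le_one
  · rcases le_total x y with h | h
    · exact mul_nonneg_of_nonpos_of_nonpos (sub_nonpos.2 h) (sub_nonpos.2 (hmono h))
    · exact mul_nonneg (sub_nonneg.2 h) (sub_nonneg.2 (hmono h))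

/-! ### Tests based on empirical means -/

/-- The test that compares the empirical mean of arm `j` with a mixture of the others. -/
noncomputable def empTest (j : Fin K) (q : Fin K → ℝ) (e : Fin K → ℝ) : ℝ :=
  if ∑ i ∈ Finset.Iio j, q i * e i < e j then 1 else 0

lemma empTest_mem (j : Fin K) (q : Fin K → ℝ) (e : Fin K → ℝ) :
    0 ≤ empTest j q e ∧ empTest j q e ≤ 1 := by
  unfold empTest; split_ifs <;> simp

lemma empTest_congr {j : Fin K} {q e e' : Fin K → ℝ} (h : ∀ i ≤ j, e i = e' i) :
    empTest j q e = empTest j q e' := by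
  have : ∑ i ∈ Finset.Iio j, q i * e i = ∑ i ∈ Finset.Iio j, q i * e' i :=
    Finset.sum_congr rfl fun i hi => by rw [h i (Finset.mem_Iio.1 hi).le]
  exact if_congr (by rw [this, h j le_rfl]) rfl rfl

@[fun_prop]
lemma measurable_empTest (j : Fin K) (q : Fin K → ℝ) : Measurable (empTest j q) :=
  Measurable.ite (measurableSet_lt (by fun_prop) (by fun_prop)) measurable_const measurable_const

/-- The empirical means of all arms. -/
noncomputable def empMeans (n : ℕ) (w : World K) : Fin K → ℝ := fun i => empMean n (samples i n w)

@[fun_prop]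
lemma measurable_empMeans (n : ℕ) : Measurable (empMeans (K := K) n) := by
  unfold empMeans; fun_prop

lemma integrable_mul_empTest (j i : Fin K) (n : ℕ) (q : Fin K → ℝ) :
    Integrable (fun w : World K => (w.1 i : ℝ) * empTest j q (empMeans n w)) (worldLaw prior) :=
  Integrable.of_bound (Measurable.aestronglyMeasurable (by fun_prop)) 1 (.of_forall fun w => by
    have h1 := empTest_mem j q (empMeans n w)
    rw [Real.norm_eq_abs, abs_of_nonneg (mul_nonneg (w.1 i).2.1 h1.1)]
    exact mul_le_one₀ (w.1 i).2.2 h1.1 h1.2)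

/-- The test for `j` reads only arms up to `j`, and hence is independent of arm `k`. -/
lemma integral_mul_empTest_of_gt {j k : Fin K} (hk : j < k) (n : ℕ) (q : Fin K → ℝ) :
    ∫ w, (w.1 k : ℝ) * empTest j q (empMeans n w) ∂(worldLaw prior) =
      priorMean prior k * ∫ w, empTest j q (empMeans n w) ∂(worldLaw prior) := by
  have := integral_decouple prior (k := k) (S := Finset.Iic j) (by simpa using hk)
    (F := fun p => (p.1.1 : ℝ) * empTest j q fun i => if h : i ∈ Finset.Iic j then
      empMean n (armSamples n (p.2 ⟨i, h⟩)) else 0)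
    (by
      refine Measurable.mul (by fun_prop) ((measurable_empTest j q).comp ?_)
      refine measurable_pi_lambda _ fun i => ?_
      split_ifs <;> fun_prop) (c := 1) (fun p => by
      have h1 := empTest_mem j q fun i => if h : i ∈ Finset.Iic j then
        empMean n (armSamples n (p.2 ⟨i, h⟩)) else 0
      rw [abs_of_nonneg (mul_nonneg p.1.1.2.1 h1.1)]
      exact mul_le_one₀ p.1.1.2.2 h1.1 h1.2)
  have e : ∀ w : World K, (empTest j q fun i => if h : i ∈ Finset.Iic j then
      empMean n (armSamples n (arm i w)) else 0) = empTest j q (empMeans n w) := by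
    exact fun w => empTest_congr fun i hi => dif_pos (Finset.mem_Iic.2 hi)
  simp only [e] at this
  simp only [integral_mul_const, integral_const_mul] at this
  refine this.trans ?_
  rw [← integral_mean prior k]
  rfl

/-- With the other arms frozen, the test is a threshold on the empirical mean of arm `j`, so passing
it is good news about that arm (`mul_integral_le_of_empMean`). -/
lemma mul_integral_empTest_le (j : Fin K) (n : ℕ) (q : Fin K → ℝ) :
    priorMean prior j * ∫ w, empTest j q (empMeans n w) ∂(worldLaw prior) ≤
      ∫ w, (w.1 j : ℝ) * empTest j q (empMeans n w) ∂(worldLaw prior) := by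
  let T : (unitInterval × (ℕ → unitInterval)) ×
      (Finset.Iio j → unitInterval × (ℕ → unitInterval)) → ℝ := fun p =>
    if ∑ i : Finset.Iio j, q i * empMean n (armSamples n (p.2 i)) < empMean n (armSamples n p.1)
      then 1 else 0
  have hT : Measurable T := Measurable.ite (measurableSet_lt (by fun_prop) (by fun_prop))
    measurable_const measurable_const
  have hT1 : ∀ p, 0 ≤ T p ∧ T p ≤ 1 := fun p => by simp only [T]; split_ifs <;> simp
  have e : ∀ w : World K, T (arm j w, fun i => arm i w) = empTest j q (empMeans n w) := by
    intro w
    refine if_congr ?_ rfl rfl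
    rw [← Finset.sum_coe_sort (Finset.Iio j) fun i => q i * empMeans n w i]
    rfl
  have d1 := integral_decouple prior (k := j) (S := Finset.Iio j) (by simp) hT (c := 1)
    (fun p => by rw [abs_of_nonneg (hT1 p).1]; exact (hT1 p).2)
  have d2 := integral_decouple prior (k := j) (S := Finset.Iio j) (by simp)
    (F := fun p => (p.1.1 : ℝ) * T p) (by fun_prop) (c := 1)
    (fun p => by
      rw [abs_of_nonneg (mul_nonneg p.1.1.2.1 (hT1 p).1)]
      exact mul_le_one₀ p.1.1.2.2 (hT1 p).1 (hT1 p).2)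
  simp only [e] at d1 d2
  change ∫ w, (w.1 j : ℝ) * empTest j q (empMeans n w) ∂(worldLaw prior) = _ at d2
  rw [d1, d2, ← integral_const_mul]
  have hb : ∀ (F : (unitInterval × (ℕ → unitInterval)) ×
      (Finset.Iio j → unitInterval × (ℕ → unitInterval)) → ℝ), Measurable F →
      (∀ p, 0 ≤ F p ∧ F p ≤ 1) → Integrable (fun w' : World K =>
        ∫ w, F (arm j w, fun i : Finset.Iio j => arm (i : Fin K) w') ∂(worldLaw prior))
        (worldLaw prior) := by
    intro F hF hF1
    have hm : Measurable fun p : World K × World K =>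
        F (arm j p.2, fun i : Finset.Iio j => arm (i : Fin K) p.1) := by fun_prop
    refine Integrable.of_bound hm.stronglyMeasurable.integral_prod_right'.aestronglyMeasurable 1
      (.of_forall fun w' => ?_)
    rw [Real.norm_eq_abs, abs_of_nonneg (integral_nonneg fun w => (hF1 _).1)]
    refine (integral_mono (g := fun _ => 1) (Integrable.of_bound (Measurable.aestronglyMeasurable
      (by fun_prop)) 1 (.of_forall fun w => ?_)) (integrable_const _)
      fun w => (hF1 _).2).trans (by simp)
    rw [Real.norm_eq_abs, abs_of_nonneg (hF1 _).1]
    exact (hF1 _).2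
  refine integral_mono ((hb T hT hT1).const_mul _) (hb (fun p => (p.1.1 : ℝ) * T p) (by fun_prop)
    fun p => ⟨mul_nonneg p.1.1.2.1 (hT1 p).1, mul_le_one₀ p.1.1.2.2 (hT1 p).1 (hT1 p).2⟩)
    fun w' => ?_
  exact mul_integral_le_of_empMean prior j n
    (∑ i : Finset.Iio j, q i * empMean n (armSamples n (arm (i : Fin K) w')))

/-- A test that knew the true means would earn exactly the positive part of the gap. Using empirical
means loses pointwise at most the error of arm j plus the q-average of the other errors. Each error
has mean at most 1/(2√n), so the loss is uniform in q. -/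
lemma padGap_sub_le {j : Fin K} {n : ℕ} (hn : 0 < n) {q : Fin K → ℝ}
    (hq : q ∈ stdSimplex ℝ (Fin K)) (hj : ∀ i, j ≤ i → q i = 0) :
    padGap prior j q - 1 / √n ≤
      ∫ w, ((w.1 j : ℝ) - ∑ i, q i * (w.1 i : ℝ)) * empTest j q (empMeans n w)
        ∂(worldLaw prior) := by
  set D : World K → ℝ := fun w => |empMean n (samples j n w) - w.1 j| +
    ∑ i, q i * |empMean n (samples i n w) - w.1 i| with hD
  have hDi : Integrable D (worldLaw prior) :=
    (integrable_abs_empMean_sub prior j n).add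
      (integrable_finsetSum _ fun i _ => (integrable_abs_empMean_sub prior i n).const_mul _)
  have hDle : ∫ w, D w ∂(worldLaw prior) ≤ 1 / √n := by
    rw [hD, integral_add (integrable_abs_empMean_sub prior j n)
      (integrable_finsetSum _ fun i _ => (integrable_abs_empMean_sub prior i n).const_mul _),
      integral_finsetSum _ fun i _ => (integrable_abs_empMean_sub prior i n).const_mul _]
    simp only [integral_const_mul]
    have h1 : ∑ i, q i * ∫ w, |empMean n (samples i n w) - w.1 i| ∂(worldLaw prior) ≤
        ∑ i, q i * (1 / (2 * √n)) := Finset.sum_le_sum fun i _ =>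
      mul_le_mul_of_nonneg_left (integral_abs_empMean_sub_le prior i hn) (hq.1 i)
    rw [← Finset.sum_mul, hq.2, one_mul] at h1
    have h2 := integral_abs_empMean_sub_le prior j hn
    have h3 : 1 / (2 * √(n : ℝ)) + 1 / (2 * √(n : ℝ)) = 1 / √n := by
      have : 0 < √(n : ℝ) := Real.sqrt_pos.2 (by exact_mod_cast hn)
      field_simp
      norm_num
    linarith
  have hpt : ∀ w : World K, max ((w.1 j : ℝ) - ∑ i, q i * (w.1 i : ℝ)) 0 - D w ≤
      ((w.1 j : ℝ) - ∑ i, q i * (w.1 i : ℝ)) * empTest j q (empMeans n w) := by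
    intro w
    have hsum : ∑ i ∈ Finset.Iio j, q i * empMeans n w i = ∑ i, q i * empMeans n w i := by
      refine Finset.sum_subset (Finset.subset_univ _) fun i _ hi => ?_
      rw [hj i (by simpa using hi), zero_mul]
    have hdist : |((w.1 j : ℝ) - ∑ i, q i * (w.1 i : ℝ)) -
        (empMeans n w j - ∑ i, q i * empMeans n w i)| ≤ D w := by
      have e : ((w.1 j : ℝ) - ∑ i, q i * (w.1 i : ℝ)) -
          (empMeans n w j - ∑ i, q i * empMeans n w i) =
          -(empMean n (samples j n w) - w.1 j) +
            ∑ i, q i * (empMean n (samples i n w) - w.1 i) := by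
        simp only [empMeans, mul_sub, Finset.sum_sub_distrib]
        ring
      rw [e]
      refine (abs_add_le _ _).trans (add_le_add (abs_neg _).le ?_)
      refine (Finset.abs_sum_le_sum_abs _ _).trans (Finset.sum_le_sum fun i _ => ?_)
      rw [abs_mul, abs_of_nonneg (hq.1 i)]
    rw [abs_le] at hdist
    unfold empTest
    rw [hsum]
    split_ifs with h
    · rw [mul_one, sub_le_iff_le_add]
      exact max_le (by linarith) (by linarith)
    · rw [mul_zero, sub_le_iff_le_add]
      exact max_le (by linarith) (by linarith)
  have h1 := integral_mono ((integrable_posPart_gap hq j).sub hDi) ?_ hpt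
  · rw [integral_sub' (integrable_posPart_gap hq j) hDi] at h1
    refine le_trans ?_ h1
    unfold padGap
    linarith
  · refine Integrable.of_bound (Measurable.aestronglyMeasurable (by fun_prop)) 1
      (.of_forall fun w => ?_)
    have h1 := empTest_mem j q (empMeans n w)
    rw [Real.norm_eq_abs, abs_mul, abs_of_nonneg h1.1]
    refine mul_le_one₀ ?_ h1.1 h1.2
    have h2 := mix_mem hq w.1
    have h3 := (w.1 j).2
    rw [abs_le]
    constructor <;> linarith [h2.1, h2.2, h3.1, h3.2]

end

section

variable {K : ℕ}

/-! ### Randomized tests and the existence of suitable policies -/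

/-- Integrating out the randomness of an event. -/
lemma setIntegral_prod_fst {Ω Ω' : Type*} [MeasurableSpace Ω] [MeasurableSpace Ω']
    {P : Measure Ω} {Q : Measure Ω'} [IsFiniteMeasure P] [IsFiniteMeasure Q] {B : Set (Ω × Ω')}
    (hB : MeasurableSet B) {g : Ω → ℝ} (hg : Integrable g P) :
    ∫ p in B, g p.1 ∂(P.prod Q) = ∫ w, Q.real {o | (w, o) ∈ B} * g w ∂P := by
  rw [← integral_indicator hB, integral_prod _ ((hg.comp_fst Q).indicator hB)]
  congr 1
  ext w
  have hm : MeasurableSet {o | (w, o) ∈ B} := measurable_prodMk_left hB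
  have : ∀ o, B.indicator (fun p => g p.1) (w, o) = {o | (w, o) ∈ B}.indicator 1 o * g w := by
    intro o
    by_cases h : (w, o) ∈ B
    · rw [Set.indicator_of_mem h, Set.indicator_of_mem (by exact h)]; simp
    · rw [Set.indicator_of_notMem h, Set.indicator_of_notMem (by exact h)]; simp
  simp_rw [this]
  rw [integral_mul_const, integral_indicator_one hm]

@[fun_prop]
lemma measurable_reward (i : Fin K) (n : ℕ) : Measurable (reward i n) :=
  measurable_to_bool (by
    have : reward (K := K) i n ⁻¹' {true} = {w | w.2 (i, n) < w.1 i} := by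
      ext; simp [reward]
    rw [this]
    exact measurableSet_lt (by fun_prop) (by fun_prop))

@[fun_prop]
lemma measurable_profile (S : Set (Fin K)) (n : ℕ) : Measurable (profile S n) := by
  unfold profile
  refine measurable_pi_lambda _ fun i => measurable_pi_lambda _ fun m => ?_
  split_ifs <;> fun_prop

lemma samples_eq_ofFn (i : Fin K) (n : ℕ) (w : World K) :
    samples i n w = List.ofFn fun m : Fin n => reward i m w :=
  List.ext_getElem (by simp) fun m _ _ => by simp [samples]

lemma integral_profile (P : Measure (World K)) (S : Set (Fin K)) (n : ℕ) (φ : (Fin K → Fin n → Bool) → ℝ)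
    {g : World K → ℝ} (hg : Integrable g P) :
    ∫ w, φ (profile S n w) * g w ∂P =
      ∑ t, φ t * ∫ w in {w | profile S n w = t}, g w ∂P := by
  have hm : ∀ t, MeasurableSet {w : World K | profile S n w = t} := fun t =>
    measurable_profile S n (MeasurableSet.of_discrete (s := {t}))
  have hU : (⋃ t, {w : World K | profile S n w = t}) = Set.univ := by ext; simp
  rw [← setIntegral_univ, ← hU, integral_iUnion_fintype hm]
  · refine Finset.sum_congr rfl fun t _ => ?_
    rw [← integral_const_mul]
    exact setIntegral_congr_fun (hm t) fun w hw => by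
      have : profile S n w = t := hw
      simp only [this]
  · intro a b hab
    rw [Function.onFun, Set.disjoint_left]
    exact fun w h1 h2 => hab (h1.symm.trans h2)
  · intro t
    refine Integrable.integrableOn ?_
    obtain ⟨c, hc⟩ := (Set.finite_range fun t => |φ t|).bddAbove
    exact hg.bdd_mul (c := c) (Measurable.aestronglyMeasurable
      ((Measurable.of_discrete (f := φ)).comp (measurable_profile S n)))
      (.of_forall fun w => hc ⟨_, rfl⟩)

section

variable (prior : Fin K → Measure unitInterval) [∀ i, IsProbabilityMeasure (prior i)]

/-- A randomized test with all the gaps that a suitable policy needs. -/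
lemma exists_padded_test (hanti : Antitone (priorMean prior)) (j : Fin K) {N : ℕ} (hN : 0 < N)
    {lam : ℝ} (hlam : lam ≤ Gpad prior - 1 / √N) :
    ∃ φ : (Fin K → Fin N → Bool) → ℝ, (∀ t, φ t ∈ Set.Icc (0 : ℝ) 1) ∧
      ∀ i, (if i < j then lam else 0) ≤
        ∫ w, φ (profile (Set.Iic j) N w) * ((w.1 j : ℝ) - w.1 i) ∂(worldLaw prior) := by
  have hgap := fun i : Fin K => integrable_gap (P := worldLaw prior)
    (μ := fun w : World K => w.1) (by fun_prop) j i
  simp_rw [fun (φ : (Fin K → Fin N → Bool) → ℝ) i =>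
    integral_profile (worldLaw prior) (Set.Iic j) N φ (hgap i)]
  -- By minimax it suffices to answer each weight vector q with its own test. The weights also cover
  -- arms i ≥ j, with target 0, because incentive compatibility is required against all arms.
  refine exists_forall_le_sum (fun t i => ∫ w in {w | profile (Set.Iic j) N w = t},
    ((w.1 j : ℝ) - w.1 i) ∂(worldLaw prior)) _ fun q hq => ?_
  simp_rw [← fun (φ : (Fin K → Fin N → Bool) → ℝ) i =>
    integral_profile (worldLaw prior) (Set.Iic j) N φ (hgap i)]
  set s := ∑ i ∈ Finset.Iio j, q i with hs
  have hqb : ∑ i, q i * (if i < j then lam else 0) = s * lam := by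
    have : ∀ i, q i * (if i < j then lam else 0) = if i ∈ Finset.Iio j then q i * lam else 0 :=
      fun i => by simp
    simp_rw [this]
    rw [Finset.sum_ite_mem, Finset.univ_inter, ← Finset.sum_mul]
  rw [hqb]
  have hs0 : 0 ≤ s := Finset.sum_nonneg fun i _ => hq i
  rcases hs0.eq_or_lt with hs0 | hs0
  -- Without weight on earlier arms the target is 0, and the test that never recommends `j` reaches
  -- it.
  · refine ⟨fun _ => 0, fun _ => by simp, ?_⟩
    simp [← hs0]
  -- The part of the weights on earlier arms, normalized to a mixture as in the definition of G_pad.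
  let p : Fin K → ℝ := fun i => if i < j then q i / s else 0
  have hpj : ∀ i, j ≤ i → p i = 0 := fun i hi => if_neg (not_lt.2 hi)
  have hp : p ∈ stdSimplex ℝ (Fin K) := by
    refine ⟨fun i => ?_, ?_⟩
    · simp only [p]
      split_ifs
      · exact div_nonneg (hq i) hs0.le
      · exact le_rfl
    · have : ∀ i, p i = if i ∈ Finset.Iio j then q i / s else 0 := fun i => by simp [p]
      simp_rw [this]
      rw [Finset.sum_ite_mem, Finset.univ_inter, ← Finset.sum_div]
      exact div_self hs0.ne'
  refine ⟨fun t => empTest j p fun i => empMean N (List.ofFn (t i)), fun t => ?_, ?_⟩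
  · exact empTest_mem j p _
  have hφ : ∀ w : World K, (empTest j p fun i =>
      empMean N (List.ofFn (profile (Set.Iic j) N w i))) = empTest j p (empMeans N w) := by
    refine fun w => empTest_congr fun i hi => ?_
    have : profile (Set.Iic j) N w i = fun m : Fin N => reward i m w :=
      funext fun m => if_pos (Set.mem_Iic.2 hi)
    rw [this, ← samples_eq_ofFn]
    rfl
  simp_rw [hφ]
  set E : World K → ℝ := fun w => empTest j p (empMeans N w)
  have hint : ∀ i, Integrable (fun w => E w * ((w.1 j : ℝ) - w.1 i)) (worldLaw prior) := by
    intro i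
    have := (integrable_mul_empTest prior j j N p).sub (integrable_mul_empTest prior j i N p)
    refine this.congr (.of_forall fun w => ?_)
    simp only [Pi.sub_apply, E]
    ring
  -- A later arm is independent of the test and has the smaller prior mean, while passing the test
  -- speaks in favour of arm `j`.
  have hbig : ∀ i, j ≤ i → 0 ≤ q i * ∫ w, E w * ((w.1 j : ℝ) - w.1 i) ∂(worldLaw prior) := by
    intro i hi
    refine mul_nonneg (hq i) ?_
    rcases hi.eq_or_lt with rfl | hi
    · simp
    have e : ∫ w, E w * ((w.1 j : ℝ) - w.1 i) ∂(worldLaw prior) =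
        ∫ w, (w.1 j : ℝ) * E w ∂(worldLaw prior) -
          priorMean prior i * ∫ w, E w ∂(worldLaw prior) := by
      rw [← integral_mul_empTest_of_gt prior hi N p,
        ← integral_sub (integrable_mul_empTest prior j j N p)
          (integrable_mul_empTest prior j i N p)]
      congr 1
      ext w
      simp only [E]
      ring
    have h1 := mul_integral_empTest_le prior j N p
    have h2 : 0 ≤ ∫ w, E w ∂(worldLaw prior) := integral_nonneg fun w => (empTest_mem j p _).1
    have h3 := mul_le_mul_of_nonneg_right (hanti hi.le) h2
    rw [e]
    linarith
  have hsmall : s * lam ≤ ∑ i ∈ Finset.Iio j,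
      q i * ∫ w, E w * ((w.1 j : ℝ) - w.1 i) ∂(worldLaw prior) := by
    have h1 := (hlam.trans (sub_le_sub_right (Gpad_le hp hpj) _)).trans
      (padGap_sub_le prior hN hp hpj)
    refine (mul_le_mul_of_nonneg_left h1 hs0.le).trans (le_of_eq ?_)
    simp_rw [← integral_const_mul]
    rw [← integral_finsetSum _ fun i _ => (hint i).const_mul _]
    congr 1
    ext w
    have h2 : ∑ i, p i * (w.1 i : ℝ) = ∑ i ∈ Finset.Iio j, q i / s * (w.1 i : ℝ) := by
      rw [← Finset.sum_subset (Finset.subset_univ (Finset.Iio j))]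
      · exact Finset.sum_congr rfl fun i hi => by simp only [p, if_pos (Finset.mem_Iio.1 hi)]
      · intro i _ hi
        rw [hpj i (by simpa using hi), zero_mul]
    have h3 : s * ∑ i ∈ Finset.Iio j, q i / s * (w.1 i : ℝ) =
        ∑ i ∈ Finset.Iio j, q i * (w.1 i : ℝ) := by
      rw [Finset.mul_sum]
      exact Finset.sum_congr rfl fun i _ => by field_simp
    calc s * (((w.1 j : ℝ) - ∑ i, p i * (w.1 i : ℝ)) * E w)
        = E w * (s * (w.1 j : ℝ) - s * ∑ i ∈ Finset.Iio j, q i / s * (w.1 i : ℝ)) := by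
          rw [h2]; ring
      _ = E w * (∑ i ∈ Finset.Iio j, q i * ((w.1 j : ℝ) - w.1 i)) := by
          rw [h3]
          simp only [mul_sub, Finset.sum_sub_distrib, ← Finset.sum_mul, hs]
      _ = _ := by
          rw [Finset.mul_sum]
          exact Finset.sum_congr rfl fun i _ => by ring
  refine hsmall.trans ?_
  refine Finset.sum_le_sum_of_subset_of_nonneg (Finset.subset_univ _) fun i _ hi => ?_
  exact hbig i (by simpa using hi)

lemma measurableSet_policyArm {π : Policy K} (hπ : ∀ d, Measurable (π d)) (N : ℕ) (i : Fin K) :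
    MeasurableSet {p : World K × unitInterval | policyArm π N p = i} := by
  have h : Measurable fun p : Data K × unitInterval => π p.1 p.2 :=
    measurable_from_prod_countable_right hπ
  have h2 : Measurable fun p : World K × unitInterval =>
      ((fun i => samples i N p.1 : Data K), p.2) :=
    Measurable.prodMk (measurable_pi_lambda _ fun i =>
      (measurable_samples i N).comp measurable_fst) measurable_snd
  exact (h.comp h2) (MeasurableSet.of_discrete (s := {i}))

/-- Arm j is recommended when the test passes, and all available data are exploited otherwise.
Exploitation adds only nonnegative gaps, so the gaps of the test survive for arm j and the other
arms need nothing more. -/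
lemma exists_isSuitable [NeZero K] (hanti : Antitone (priorMean prior)) (j : Fin K) {N : ℕ}
    (hN : 0 < N) {lam : ℝ} (hlam0 : 0 ≤ lam) (hlam : lam ≤ Gpad prior - 1 / √N) :
    ∃ π, IsSuitable prior j lam N π := by
  classical
  obtain ⟨φ, hφ, hgap⟩ := exists_padded_test prior hanti j hN hlam
  let prof : Data K → Fin K → Fin N → Bool := fun d i m =>
    if i ≤ j then (d i).getD m false else false
  have hprof : ∀ w : World K, prof (fun i => samples i N w) = profile (Set.Iic j) N w := by
    intro w
    ext i m
    simp [prof, profile, samples]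
  let π : Policy K := fun d u => if (u : ℝ) < φ (prof d) then j else exploit prior (Set.Iic j) N d
  have hπm : ∀ d, Measurable (π d) := fun d =>
    Measurable.ite (measurableSet_lt (by fun_prop) (by fun_prop)) measurable_const measurable_const
  set U : Set (World K × unitInterval) := {p | (p.2 : ℝ) < φ (profile (Set.Iic j) N p.1)}
  have hU : MeasurableSet U := measurableSet_lt (by fun_prop)
    ((Measurable.of_discrete (f := φ)).comp ((measurable_profile _ N).comp measurable_fst))
  have hvol : ∀ x ∈ Set.Icc (0 : ℝ) 1,
      (volume : Measure unitInterval).real {u | (u : ℝ) < x} = x := by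
    intro x hx
    have : {u : unitInterval | (u : ℝ) < x} = Set.Iio ⟨x, hx⟩ := by ext; rfl
    rw [this, measureReal_def, unitInterval.volume_Iio, ENNReal.toReal_ofReal hx.1]
  have hUgap : ∀ i l : Fin K, ∫ p in U, ((p.1.1 i : ℝ) - p.1.1 l) ∂((worldLaw prior).prod volume) =
      ∫ w, φ (profile (Set.Iic j) N w) * ((w.1 i : ℝ) - w.1 l) ∂(worldLaw prior) := by
    intro i l
    rw [setIntegral_prod_fst hU (g := fun w : World K => (w.1 i : ℝ) - w.1 l)
      (integrable_gap (by fun_prop) i l)]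
    congr 1
    ext w
    congr 1
    exact hvol (φ (profile (Set.Iic j) N w)) (hφ _)
  have hA := fun i : Fin K => measurableSet_policyArm hπm N i
  have hexp : ∀ i l : Fin K, 0 ≤ ∫ p in {p : World K × unitInterval | policyArm π N p = i} \ U,
      ((p.1.1 i : ℝ) - p.1.1 l) ∂((worldLaw prior).prod volume) := by
    intro i l
    refine exploit_gap_nonneg prior (Set.Iic j) N ((hA i).diff hU) ?_ ?_ l
    · rintro w w' u h ⟨h1, h2⟩
      have hp : profile (Set.Iic j) N w = profile (Set.Iic j) N w' := profile_eq_iff.2 h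
      simp only [Set.mem_ofPred_eq, U, policyArm, π, Set.mem_sdiff, hprof] at h1 h2 ⊢
      rw [← hp, ← exploit_congr prior (d := fun i => samples i N w)
        (d' := fun i => samples i N w') fun i hi => by rw [h i hi]]
      exact ⟨h1, h2⟩
    · rintro w u ⟨h1, h2⟩
      simp only [Set.mem_ofPred_eq, U, policyArm, π, hprof] at h1 h2
      rwa [if_neg h2] at h1
  have hsplit : ∀ i l : Fin K, ∫ p in {p : World K × unitInterval | policyArm π N p = i} ∩ U,
      ((p.1.1 i : ℝ) - p.1.1 l) ∂((worldLaw prior).prod volume) ≤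
      ∫ p in {p : World K × unitInterval | policyArm π N p = i},
      ((p.1.1 i : ℝ) - p.1.1 l) ∂((worldLaw prior).prod volume) := by
    intro i l
    have := integral_inter_add_sdiff (s := {p | policyArm π N p = i}) hU
      (integrable_gap (P := (worldLaw prior).prod volume)
        (μ := fun p : World K × unitInterval => p.1.1) (by fun_prop) i l).integrableOn
    linarith [hexp i l]
  have hinter : ∀ p ∈ U, policyArm π N p = j := by
    intro p hp
    simp only [policyArm, π, hprof]
    exact if_pos hp
  have hjU : {p : World K × unitInterval | policyArm π N p = j} ∩ U = U :=
    Set.inter_eq_right.2 hinter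
  have hmain : ∀ l, (if l < j then lam else 0) ≤
      ∫ p in {p : World K × unitInterval | policyArm π N p = j},
      ((p.1.1 j : ℝ) - p.1.1 l) ∂((worldLaw prior).prod volume) := by
    intro l
    have := hsplit j l
    rw [hjU, hUgap] at this
    exact (hgap l).trans this
  refine ⟨π, hπm, ?_, isBIC_iff.2 fun i l => ?_, fun i hi => ?_⟩
  · intro d d' h
    have h1 : prof d = prof d' := by
      ext i m
      by_cases hi : i ≤ j
      · have e : ∀ l : List Bool, l.getD m false = (l.take N).getD m false := fun l => by
          simp [List.getD_eq_getElem?_getD]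
        simp only [prof, if_pos hi]
        rw [e, h i hi, ← e]
      · simp [prof, hi]
    ext u
    have h2 : exploit prior (Set.Iic j) N d = exploit prior (Set.Iic j) N d' :=
      exploit_congr prior h
    simp only [π]
    rw [h1, h2]
  · by_cases hij : i = j
    · subst hij
      rcases lt_or_ge l i with hl | hl
      · have := hmain l
        rw [if_pos hl] at this
        exact hlam0.trans this
      · have := hmain l
        rwa [if_neg (not_lt.2 hl)] at this
    · refine le_trans (le_of_eq ?_) (hsplit i l)
      have : {p : World K × unitInterval | policyArm π N p = i} ∩ U = ∅ := by
        ext p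
        simp only [Set.mem_inter_iff, Set.mem_ofPred_eq, Set.mem_empty_iff_false, iff_false]
        exact fun h => hij (h.1.symm.trans (hinter p h.2))
      simp [this]
  · have := hmain i
    rwa [if_pos hi] at this

end

end

section

variable {K : ℕ}

/-! ### Admissible parameters -/

/-- The assumptions on the parameters under which the algorithm is analyzed. -/
structure Params.Admissible (prior : Fin K → Measure unitInterval) (a : Params K)
    [NeZero K] : Prop where
  N_pos : 0 < a.N
  N₀_le : a.N₀ ≤ a.N
  lam_pos : 0 < a.lam
  zeros_pos : ∀ j, 0 < (worldLaw prior).real (zeros j a.N₀)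
  boot : a.N₀ ∈ bootSet prior
  antitone : Antitone (priorMean prior)
  suitable : ∀ j, j ≠ 0 → IsSuitable prior j a.lam a.N (a.π j)
  fake : ∀ j, ∀ i < j, IsFakeData prior a.N₀ a.N i (a.κ j i)

/-! ### Exploration probabilities -/

/-- The conditional probability of exploration in an iteration of the main loop. -/
noncomputable def coinProb (prior : Fin K → Measure unitInterval) (a : Params K) (j : Fin K)
    (n : ℕ) : ℝ :=
  min 1 (exploreProb prior a.N₀ a.lam j n / (1 - exploreProb prior a.N₀ a.lam j n) * a.lam)

section

variable [NeZero K] {prior : Fin K → Measure unitInterval} {a : Params K}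

lemma Params.Admissible.exploreProb_mem (h : a.Admissible prior) (j : Fin K) (n : ℕ) :
    0 < exploreProb prior a.N₀ a.lam j n ∧ exploreProb prior a.N₀ a.lam j n ≤ 1 := by
  have h0 := exploreProb_zero_mem (mul_pos h.lam_pos (h.zeros_pos j))
  induction n with
  | zero => exact ⟨h0.1, h0.2.le⟩
  | succ n ih =>
    rw [exploreProb]
    exact ⟨lt_min one_pos (mul_pos ih.1 (by linarith [h.lam_pos])), min_le_left _ _⟩

omit [NeZero K] in
lemma exploreProb_lt_one {j : Fin K} {n : ℕ} (hn : n < loopLength prior a.N₀ a.lam j) :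
    exploreProb prior a.N₀ a.lam j n < 1 :=
  not_le.1 (Nat.notMem_of_lt_sInf hn)

lemma Params.Admissible.coinProb_mem (h : a.Admissible prior) {j : Fin K} {n : ℕ}
    (hn : n < loopLength prior a.N₀ a.lam j) :
    coinProb prior a j n ∈ Set.Icc (0 : ℝ) 1 := by
  have h1 := h.exploreProb_mem j n
  have h2 := exploreProb_lt_one hn
  exact ⟨le_min zero_le_one (mul_nonneg (div_nonneg h1.1.le (by linarith)) h.lam_pos.le),
    min_le_left _ _⟩

omit [NeZero K] in
/-- The recursion for the probability that no exploration has happened. -/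
lemma one_sub_mul_one_sub_coinProb {j : Fin K} {n : ℕ}
    (hn : n < loopLength prior a.N₀ a.lam j) :
    (1 - exploreProb prior a.N₀ a.lam j n) * (1 - coinProb prior a j n) =
      1 - exploreProb prior a.N₀ a.lam j (n + 1) := by
  have h2 := exploreProb_lt_one hn
  rw [coinProb, exploreProb]
  set p := exploreProb prior a.N₀ a.lam j n
  have h3 : 0 < 1 - p := by linarith
  -- The caps at 1 in the coin and in the exploration probability are reached together: p λ ≥ 1 - p
  -- says the same as p (1 + λ) ≥ 1. In particular, p_n is the probability that exploration has
  -- happened before iteration n.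
  rcases le_total 1 (p / (1 - p) * a.lam) with h | h
  · rw [min_eq_left h, min_eq_left]
    · ring
    · rw [div_mul_eq_mul_div, le_div_iff₀ h3] at h
      linarith
  · rw [min_eq_right h, min_eq_right]
    · field_simp
      ring
    · rw [div_mul_eq_mul_div, div_le_iff₀ h3] at h
      linarith

lemma Params.Admissible.one_le_exploreProb_loopLength (h : a.Admissible prior) (j : Fin K) :
    1 ≤ exploreProb prior a.N₀ a.lam j (loopLength prior a.N₀ a.lam j) := by
  have hne : {n | 1 ≤ exploreProb prior a.N₀ a.lam j n}.Nonempty := by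
    have h0 := h.exploreProb_mem j 0
    obtain ⟨n, hn⟩ := pow_unbounded_of_one_lt (exploreProb prior a.N₀ a.lam j 0)⁻¹
      (show 1 < 1 + a.lam by linarith [h.lam_pos])
    refine ⟨n, le_trans (le_min le_rfl ?_) (le_exploreProb h.lam_pos.le j n)⟩
    rw [← div_le_iff₀' h0.1, one_div]
    exact hn.le
  exact Nat.sInf_mem hne

/-- In the last iteration p_{n+1} = 1 while p_n < 1, so the recursion for the probability of no
exploration leaves no chance for the coin to fail. The iteration exists because p_0 < 1. -/
lemma Params.Admissible.exists_coinProb_eq_one (h : a.Admissible prior) (j : Fin K) :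
    ∃ n < loopLength prior a.N₀ a.lam j, 1 ≤ coinProb prior a j n := by
  have h1 := h.one_le_exploreProb_loopLength j
  obtain ⟨n, hn⟩ : ∃ n, loopLength prior a.N₀ a.lam j = n + 1 := by
    refine Nat.exists_eq_succ_of_ne_zero fun h0 => ?_
    rw [h0] at h1
    linarith [(exploreProb_zero_mem (mul_pos h.lam_pos (h.zeros_pos j))).2]
  refine ⟨n, by omega, ?_⟩
  have hlt : n < loopLength prior a.N₀ a.lam j := by omega
  have h2 := one_sub_mul_one_sub_coinProb (prior := prior) hlt
  rw [← hn] at h2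
  have h3 := exploreProb_lt_one hlt
  by_contra! h4
  have : 0 < (1 - exploreProb prior a.N₀ a.lam j n) * (1 - coinProb prior a j n) :=
    mul_pos (by linarith) (by linarith)
  linarith

/-! ### The schedule -/

variable (prior a)

open Classical in
/-- The phases devoted to arm `j`. -/
noncomputable def block (j : Fin K) : List (Phase K) :=
  if j = 0 then [] else
    Phase.boot₁ j :: Phase.boot₂ j ::
      (List.range (loopLength prior a.N₀ a.lam j)).map fun n => Phase.main j n

/-- The number of phases before the first one that is devoted to arm number `k`. -/
noncomputable def blockStart (k : ℕ) : ℕ :=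
  1 + (((List.finRange K).take k).flatMap (block prior a)).length

/-- The phase with number `s`. -/
noncomputable def phaseAt (s : ℕ) : Phase K := (schedule prior a.N₀ a.lam).getD s Phase.init

lemma schedule_eq : schedule prior a.N₀ a.lam =
    Phase.init :: (List.finRange K).flatMap (block prior a) := rfl

lemma phaseAt_zero : phaseAt prior a 0 = Phase.init := rfl

lemma blockStart_zero : blockStart prior a 0 = 1 := by simp [blockStart]

lemma blockStart_last : blockStart prior a K = (schedule prior a.N₀ a.lam).length := by
  rw [schedule_eq, blockStart, List.take_of_length_le (by simp), List.length_cons, add_comm]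

omit [NeZero K] in
lemma take_finRange_succ (j : Fin K) :
    (List.finRange K).take (j + 1) = (List.finRange K).take j ++ [j] := by
  rw [List.take_succ_eq_append_getElem (by simp)]
  simp

lemma blockStart_succ (j : Fin K) :
    blockStart prior a (j + 1) = blockStart prior a j + (block prior a j).length := by
  simp only [blockStart]
  rw [take_finRange_succ, List.flatMap_append, List.length_append]
  simp
  omega

lemma phaseAt_block (j : Fin K) {m : ℕ} (hm : m < (block prior a j).length) :
    phaseAt prior a (blockStart prior a j + m) = (block prior a j)[m] := by
  have h : schedule prior a.N₀ a.lam = (Phase.init :: ((List.finRange K).take j).flatMap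
      (block prior a)) ++ (block prior a j ++
        ((List.finRange K).drop (j + 1)).flatMap (block prior a)) := by
    rw [schedule_eq, List.cons_append, ← List.append_assoc]
    congr 1
    conv_lhs => rw [← List.take_append_drop (j + 1) (List.finRange K), take_finRange_succ]
    simp
  have hlen : (Phase.init :: ((List.finRange K).take j).flatMap (block prior a)).length =
      blockStart prior a j := by
    rw [List.length_cons, blockStart, add_comm]
  rw [phaseAt, h, List.getD_append_right _ _ _ _ (by omega), hlen, Nat.add_sub_cancel_left,
    List.getD_append _ _ _ _ hm, List.getD_eq_getElem _ _ hm]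

variable {prior a}

lemma length_block {j : Fin K} (hj : j ≠ 0) :
    (block prior a j).length = loopLength prior a.N₀ a.lam j + 2 := by
  simp [block, hj]

lemma blockStart_succ_of_ne {j : Fin K} (hj : j ≠ 0) : blockStart prior a (j + 1) =
    blockStart prior a j + 2 + loopLength prior a.N₀ a.lam j := by
  rw [blockStart_succ, length_block hj]; ring

lemma phaseAt_boot₁ {j : Fin K} (hj : j ≠ 0) :
    phaseAt prior a (blockStart prior a j) = Phase.boot₁ j := by
  have := phaseAt_block prior a j (m := 0) (by rw [length_block hj]; omega)
  simpa [block, hj] using this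

lemma phaseAt_boot₂ {j : Fin K} (hj : j ≠ 0) :
    phaseAt prior a (blockStart prior a j + 1) = Phase.boot₂ j := by
  have := phaseAt_block prior a j (m := 1) (by rw [length_block hj]; omega)
  simpa [block, hj] using this

lemma phaseAt_main {j : Fin K} (hj : j ≠ 0) {n : ℕ} (hn : n < loopLength prior a.N₀ a.lam j) :
    phaseAt prior a (blockStart prior a j + 2 + n) = Phase.main j n := by
  have := phaseAt_block prior a j (m := n + 2) (by rw [length_block hj]; omega)
  rw [show blockStart prior a j + 2 + n = blockStart prior a j + (n + 2) by ring, this]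
  simp [block, hj]

lemma blockStart_mono : Monotone (blockStart prior a) := by
  refine monotone_nat_of_le_succ fun k => ?_
  by_cases hk : k < K
  · have := blockStart_succ prior a ⟨k, hk⟩
    simp only at this
    omega
  · simp only [blockStart]
    rw [List.take_of_length_le (by simpa using hk),
      List.take_of_length_le (by simp; omega)]

/-- Decoding a phase number reduces claims about all phases to the initial phase and the phases of a
single block; arm 0 has an empty block. -/
lemma exists_block {s : ℕ} (hs : s < (schedule prior a.N₀ a.lam).length) : s = 0 ∨
    ∃ j : Fin K, j ≠ 0 ∧ ∃ m < loopLength prior a.N₀ a.lam j + 2,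
      s = blockStart prior a j + m := by
  rw [← blockStart_last] at hs
  have key : ∀ k ≤ K, s < blockStart prior a k → s = 0 ∨
    ∃ j : Fin K, j ≠ 0 ∧ ∃ m < loopLength prior a.N₀ a.lam j + 2,
      s = blockStart prior a j + m := by
    intro k
    induction k with
    | zero =>
      intro _ h
      rw [blockStart_zero] at h
      exact .inl (by omega)
    | succ k ih =>
      intro hk h
      by_cases h1 : s < blockStart prior a k
      · exact ih (by omega) h1
      · have h2 := blockStart_succ prior a ⟨k, hk⟩
        simp only at h2
        by_cases hj : (⟨k, hk⟩ : Fin K) = 0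
        · have : (block prior a ⟨k, hk⟩).length = 0 := by simp [block, hj]
          omega
        · rw [length_block hj] at h2
          exact .inr ⟨⟨k, hk⟩, hj, s - blockStart prior a k, by omega, by simp only; omega⟩
  exact key K le_rfl hs

/-! ### The trajectory -/

variable (prior a)

/-- The arm played in phase `s`. -/
noncomputable def armAt (s : ℕ) (ω : World K × Seeds) : Fin K :=
  (decision prior a s (stateAt prior a ω s) ω.2).1

/-- At least `N` samples of arm `i` have been collected before phase `s`. -/
def Avail (s : ℕ) (i : Fin K) (ω : World K × Seeds) : Prop :=
  a.N ≤ ((stateAt prior a ω s).data i).length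

lemma armAt_eq (s : ℕ) (ω : World K × Seeds) : armAt prior a s ω =
    (choose prior a (phaseAt prior a s) (stateAt prior a ω s) fun m => ω.2 (s, m)).1 := rfl

lemma explored_succ (s : ℕ) (ω : World K × Seeds) : (stateAt prior a ω (s + 1)).explored =
    (choose prior a (phaseAt prior a s) (stateAt prior a ω s) fun m => ω.2 (s, m)).2 := rfl

lemma data_succ (s : ℕ) (ω : World K × Seeds) : (stateAt prior a ω (s + 1)).data =
    play a.N ω.1 (stateAt prior a ω s).data (armAt prior a s ω) := rfl

omit [NeZero K] in
lemma length_play (N : ℕ) (w : World K) (d : Data K) (k i : Fin K) :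
    (play N w d k i).length = (d i).length + if i = k then N else 0 := by
  unfold play
  split_ifs <;> simp

/-- The record of an arm is always an initial segment of its rewards. Its length is a multiple of N,
so an arm with fewer than N samples has none. -/
lemma data_eq_samples (s : ℕ) (i : Fin K) (ω : World K × Seeds) :
    (stateAt prior a ω s).data i = samples i ((stateAt prior a ω s).data i).length ω.1 ∧
      a.N ∣ ((stateAt prior a ω s).data i).length := by
  induction s with
  | zero => simp [stateAt, samples]
  | succ s ih =>
    rw [data_succ, length_play]
    by_cases h : i = armAt prior a s ω
    · rw [if_pos h]
      refine ⟨?_, ih.2.add dvd_rfl⟩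
      simp only [play, if_pos h]
      conv_lhs => rw [ih.1]
      simp only [samples, List.range_add, List.map_append, List.map_map,
        List.length_map, List.length_range]
      rfl
    · rw [if_neg h, add_zero]
      refine ⟨?_, ih.2⟩
      simp only [play, if_neg h]
      exact ih.1

variable {prior a}

lemma Avail.mono {s t : ℕ} (hst : s ≤ t) {i : Fin K} {ω : World K × Seeds}
    (h : Avail prior a s i ω) : Avail prior a t i ω := by
  induction t, hst using Nat.le_induction with
  | base => exact h
  | succ t _ ih =>
    unfold Avail at ih ⊢
    rw [data_succ, length_play]
    omega

lemma avail_succ_of_eq {s : ℕ} {i : Fin K} {ω : World K × Seeds} (h : armAt prior a s ω = i) :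
    Avail prior a (s + 1) i ω := by
  unfold Avail
  rw [data_succ, length_play, if_pos h.symm]
  omega

lemma Avail.take_eq {s : ℕ} {i : Fin K} {ω : World K × Seeds} (h : Avail prior a s i ω) {n : ℕ}
    (hn : n ≤ a.N) : ((stateAt prior a ω s).data i).take n = samples i n ω.1 := by
  rw [(data_eq_samples prior a s i ω).1]
  exact take_samples i (hn.trans h) ω.1

lemma data_eq_nil {s : ℕ} {i : Fin K} {ω : World K × Seeds} (h : ¬ Avail prior a s i ω) :
    (stateAt prior a ω s).data i = [] := by
  obtain ⟨c, hc⟩ := (data_eq_samples prior a s i ω).2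
  rw [← List.length_eq_zero_iff]
  by_contra h0
  refine h ?_
  unfold Avail
  rcases Nat.eq_zero_or_pos c with rfl | hc0
  · rw [mul_zero] at hc
    exact absurd hc h0
  · rw [hc]
    exact Nat.le_mul_of_pos_right _ hc0

lemma exists_armAt_of_avail (hN : 0 < a.N) {s : ℕ} {i : Fin K} {ω : World K × Seeds}
    (h : Avail prior a s i ω) : ∃ t < s, armAt prior a t ω = i := by
  induction s with
  | zero => simp [Avail, stateAt] at h; omega
  | succ s ih =>
    by_cases hi : armAt prior a s ω = i
    · exact ⟨s, by omega, hi⟩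
    · have : Avail prior a s i ω := by
        unfold Avail at h ⊢
        rwa [data_succ, length_play, if_neg (Ne.symm hi), add_zero] at h
      obtain ⟨t, ht, hti⟩ := ih this
      exact ⟨t, by omega, hti⟩

/-! ### Exploration phases -/

lemma explored_boot₂ {j : Fin K} (hj : j ≠ 0) (ω : World K × Seeds) :
    (stateAt prior a ω (blockStart prior a j + 2)).explored = true ↔
      (ω.2 (blockStart prior a j + 1, 0) : ℝ) ≤ exploreProb prior a.N₀ a.lam j 0 := by
  rw [explored_succ, phaseAt_boot₂ hj]
  simp only [choose]
  split_ifs <;> simp_all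

lemma explored_main {j : Fin K} (hj : j ≠ 0) {n : ℕ} (hn : n < loopLength prior a.N₀ a.lam j)
    (ω : World K × Seeds) :
    (stateAt prior a ω (blockStart prior a j + 2 + (n + 1))).explored = true ↔
      (stateAt prior a ω (blockStart prior a j + 2 + n)).explored = true ∨
      (ω.2 (blockStart prior a j + 2 + n, 0) : ℝ) ≤ coinProb prior a j n := by
  rw [← add_assoc, explored_succ, phaseAt_main hj hn]
  simp only [choose, coinProb]
  split_ifs <;> simp_all

/-- No exploration has happened if and only if all coins have failed. -/
lemma not_explored_iff {j : Fin K} (hj : j ≠ 0) {n : ℕ} (hn : n ≤ loopLength prior a.N₀ a.lam j)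
    (ω : World K × Seeds) :
    (stateAt prior a ω (blockStart prior a j + 2 + n)).explored = false ↔
      exploreProb prior a.N₀ a.lam j 0 < ω.2 (blockStart prior a j + 1, 0) ∧
      ∀ m < n, coinProb prior a j m < ω.2 (blockStart prior a j + 2 + m, 0) := by
  induction n with
  | zero =>
    have := explored_boot₂ (prior := prior) (a := a) hj ω
    rw [add_zero, ← Bool.not_eq_true, this, not_le]
    simp
  | succ n ih =>
    have h1 := explored_main (prior := prior) (a := a) hj (n := n) (by omega) ω
    have h2 := ih (by omega)
    rw [← Bool.not_eq_true, h1, not_or, Bool.not_eq_true, h2, not_le, and_assoc]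
    refine and_congr_right fun _ => ?_
    constructor
    · rintro ⟨h3, h4⟩ m hm
      rcases Nat.lt_succ_iff_lt_or_eq.1 hm with h | rfl
      · exact h3 m h
      · exact h4
    · exact fun h => ⟨fun m hm => h m (by omega), h n (by omega)⟩

lemma avail_of_explored {j : Fin K} (hj : j ≠ 0) {n : ℕ}
    (hn : n ≤ loopLength prior a.N₀ a.lam j) {ω : World K × Seeds}
    (h : (stateAt prior a ω (blockStart prior a j + 2 + n)).explored = true) :
    Avail prior a (blockStart prior a j + 2 + n) j ω := by
  induction n with
  | zero =>
    have h1 := (explored_boot₂ (prior := prior) (a := a) hj ω).1 h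
    refine avail_succ_of_eq ?_
    rw [armAt_eq, phaseAt_boot₂ hj]
    simp only [choose, if_pos h1]
  | succ n ih =>
    have h1 := (explored_main (prior := prior) (a := a) hj (n := n) (by omega) ω).1 h
    by_cases h2 : (stateAt prior a ω (blockStart prior a j + 2 + n)).explored = true
    · exact (ih (by omega) h2).mono (by omega)
    · have h3 := h1.resolve_left h2
      refine avail_succ_of_eq (s := blockStart prior a j + 2 + n) ?_
      rw [armAt_eq, phaseAt_main hj (by omega)]
      simp only [coinProb] at h3
      simp only [choose, if_neg h2, if_pos h3]

/-- Some coin has success probability 1, and no seed exceeds 1, so exploration happens for every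
outcome and not merely almost surely. -/
lemma Params.Admissible.explored_end (h : a.Admissible prior) {j : Fin K} (hj : j ≠ 0)
    (ω : World K × Seeds) : (stateAt prior a ω (blockStart prior a j + 2 +
      loopLength prior a.N₀ a.lam j)).explored = true := by
  by_contra hc
  rw [Bool.not_eq_true, not_explored_iff hj le_rfl] at hc
  obtain ⟨n, hn, h1⟩ := h.exists_coinProb_eq_one j
  linarith [hc.2 n hn, (ω.2 (blockStart prior a j + 2 + n, 0)).2.2]

/-- When the phases for arm `j` start, all previous arms have been explored. -/
lemma Params.Admissible.avail (h : a.Admissible prior) {k : ℕ} (hk : k ≤ K) {i : Fin K}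
    (hi : (i : ℕ) < k) (ω : World K × Seeds) : Avail prior a (blockStart prior a k) i ω := by
  induction k with
  | zero => omega
  | succ k ih =>
    by_cases hik : (i : ℕ) < k
    · exact (ih (by omega) hik).mono (blockStart_mono (by omega))
    · obtain rfl : (i : ℕ) = k := by omega
      -- Arm 0 has no block of its own and is sampled in the initial phase.
      by_cases hi0 : i = 0
      · subst hi0
        have h0 : Avail prior a (0 + 1) 0 ω := avail_succ_of_eq (by
          rw [armAt_eq, phaseAt_zero]; rfl)
        refine h0.mono ?_
        have := blockStart_mono (prior := prior) (a := a) (show 0 ≤ ((0 : Fin K) : ℕ) + 1 by omega)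
        rw [blockStart_zero] at this
        omega
      · rw [blockStart_succ_of_ne hi0]
        exact avail_of_explored hi0 le_rfl (h.explored_end hi0 ω)

/-- The number of rounds in which an arm is played. -/
lemma Params.Admissible.le_card_recommendation (h : a.Admissible prior) (i : Fin K)
    (ω : World K × Seeds) : a.N ≤ ((Finset.range (horizon prior a.N a.N₀ a.lam)).filter
      fun t => recommendation prior a t ω = i).card := by
  have h1 := h.avail le_rfl i.2 ω
  rw [blockStart_last] at h1
  obtain ⟨s, hs, hsi⟩ := exists_armAt_of_avail h.N_pos h1
  -- A single phase that plays the arm already accounts for `N` rounds.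
  have hsub : Finset.Ico (s * a.N) (s * a.N + a.N) ⊆
      (Finset.range (horizon prior a.N a.N₀ a.lam)).filter
        fun t => recommendation prior a t ω = i := by
    intro t ht
    rw [Finset.mem_Ico] at ht
    have hdiv : t / a.N = s := by
      rw [Nat.div_eq_iff h.N_pos]
      omega
    rw [Finset.mem_filter, Finset.mem_range, horizon]
    refine ⟨?_, ?_⟩
    · calc t < s * a.N + a.N := ht.2
        _ = (s + 1) * a.N := by ring
        _ ≤ _ := Nat.mul_le_mul_right _ hs
    · rw [recommendation, hdiv]
      exact hsi
  have := Finset.card_le_card hsub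
  rwa [Nat.card_Ico, Nat.add_sub_cancel_left] at this

end

end

section

variable {K : ℕ} [NeZero K] {prior : Fin K → Measure unitInterval} {a : Params K}

/-! ### Dependence of the trajectory on the data -/

lemma avail_succ_iff {s : ℕ} {i : Fin K} {ω : World K × Seeds} :
    Avail prior a (s + 1) i ω ↔ Avail prior a s i ω ∨ armAt prior a s ω = i := by
  constructor
  · intro h
    by_cases hi : armAt prior a s ω = i
    · exact .inr hi
    · unfold Avail at h ⊢
      rw [data_succ, length_play, if_neg (Ne.symm hi), add_zero] at h
      exact .inl h
  · rintro (h | h)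
    · exact h.mono (Nat.le_succ s)
    · exact avail_succ_of_eq h

/-- In a phase devoted to arm `j`, the algorithm depends only on the first `N` samples of the
arms up to `j`. -/
lemma Params.Admissible.choose_congr (h : a.Admissible prior) {j : Fin K} (hj : j ≠ 0) {m : ℕ}
    (hm : m < loopLength prior a.N₀ a.lam j + 2) {st st' : State K}
    (hd : ∀ i ≤ j, (st.data i).take a.N = (st'.data i).take a.N)
    (hl : a.N ≤ (st.data j).length ↔ a.N ≤ (st'.data j).length)
    (he : st.explored = st'.explored) (r : ℕ → unitInterval) :
    choose prior a (phaseAt prior a (blockStart prior a j + m)) st r =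
      choose prior a (phaseAt prior a (blockStart prior a j + m)) st' r := by
  have hd0 : ∀ i ≤ j, (st.data i).take a.N₀ = (st'.data i).take a.N₀ := fun i hi => by
    have := congrArg (List.take a.N₀) (hd i hi)
    rwa [List.take_take, List.take_take, min_eq_left h.N₀_le] at this
  have hE : exploitAvailable prior j a.N st.data = exploitAvailable prior j a.N st'.data := by
    unfold exploitAvailable
    rw [if_congr hl rfl rfl, exploit_congr prior (S := Set.Iic j) (fun i hi => hd i hi),
      exploit_congr prior (S := Set.Iio j) (fun i hi => hd i (le_of_lt hi))]
  obtain rfl | rfl | ⟨n, rfl⟩ : m = 0 ∨ m = 1 ∨ ∃ n, m = 2 + n := by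
    rcases m with _ | _ | n
    · exact .inl rfl
    · exact .inr (.inl rfl)
    · exact .inr (.inr ⟨n, by ring⟩)
  · rw [add_zero, phaseAt_boot₁ hj]
    simp only [choose]
    rw [exploit_congr prior (S := Set.Iio j) (fun i hi => hd0 i (le_of_lt hi))]
  · rw [phaseAt_boot₂ hj]
    have hT : transform prior a.N j (a.π j) (a.κ j) st.data r =
        transform prior a.N j (a.π j) (a.κ j) st'.data r := by
      unfold transform
      rw [exploit_congr prior (S := Set.Iic j) (fun i hi => hd i hi), (h.suitable j hj).informed _
        (fun i => if i < j then a.κ j i ((st'.data i).take a.N) (r (2 + i)) else st'.data i)]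
      intro i hi
      split_ifs
      · rw [hd i hi]
      · exact hd i hi
    have hz : (∀ i < j, ∀ x ∈ (st.data i).take a.N₀, x = false) ↔
        ∀ i < j, ∀ x ∈ (st'.data i).take a.N₀, x = false :=
      forall₂_congr fun i hi => by rw [hd0 i hi.le]
    simp only [choose]
    rw [hT, hE, if_congr hz rfl rfl]
  · rw [← add_assoc, phaseAt_main hj (by omega)]
    simp only [choose]
    rw [hE, he, (h.suitable j hj).informed _ _ hd]

/-- Two environments in which the same arms have been explored before phase `s`. -/
def SameStatus (prior : Fin K → Measure unitInterval) (a : Params K) (s : ℕ) (σ : Seeds)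
    (w w' : World K) : Prop :=
  (∀ i, Avail prior a s i (w, σ) ↔ Avail prior a s i (w', σ)) ∧
    (stateAt prior a (w, σ) s).explored = (stateAt prior a (w', σ) s).explored

/-- Arms that are available look the same in both environments, and arms that are not have empty
records. Hence both runs make the same decision. -/
lemma Params.Admissible.sameStatus_succ (h : a.Admissible prior) {j : Fin K} (hj : j ≠ 0) {m : ℕ}
    (hm : m < loopLength prior a.N₀ a.lam j + 2) {σ : Seeds} {w w' : World K}
    (hs : SameStatus prior a (blockStart prior a j + m) σ w w')
    (hd : ∀ i ≤ j, Avail prior a (blockStart prior a j + m) i (w, σ) →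
      samples i a.N w = samples i a.N w') :
    SameStatus prior a (blockStart prior a j + m + 1) σ w w' := by
  have hc := h.choose_congr hj hm (st := stateAt prior a (w, σ) (blockStart prior a j + m))
    (st' := stateAt prior a (w', σ) (blockStart prior a j + m)) (fun i hi => by
      by_cases hA : Avail prior a (blockStart prior a j + m) i (w, σ)
      · rw [hA.take_eq le_rfl, ((hs.1 i).1 hA).take_eq le_rfl]
        exact hd i hi hA
      · rw [data_eq_nil hA, data_eq_nil (fun h' => hA ((hs.1 i).2 h'))])
    (hs.1 j) hs.2 (fun m' => σ (blockStart prior a j + m, m'))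
  refine ⟨fun i => ?_, ?_⟩
  · rw [avail_succ_iff, avail_succ_iff, hs.1 i, armAt_eq, armAt_eq]
    simp only
    rw [hc]
  · rw [explored_succ, explored_succ]
    simp only
    rw [hc]

/-- What has been explored when the phases for arm `j` start depends only on the previous arms. -/
lemma Params.Admissible.sameStatus_blockStart (h : a.Admissible prior) (j : Fin K) {σ : Seeds}
    {w w' : World K} (hw : ∀ i < j, samples i a.N w = samples i a.N w') {s : ℕ}
    (hs : s ≤ blockStart prior a j) : SameStatus prior a s σ w w' := by
  induction s with
  | zero => exact ⟨fun i => Iff.rfl, rfl⟩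
  | succ s ih =>
    have h1 := ih (by omega)
    have h2 := blockStart_mono (prior := prior) (a := a) j.2.le
    rw [blockStart_last] at h2
    rcases exists_block (prior := prior) (a := a) (s := s) (by omega) with
      rfl | ⟨j', hj', m, hm, rfl⟩
    · refine ⟨fun i => ?_, ?_⟩
      · rw [avail_succ_iff, avail_succ_iff, h1.1 i, armAt_eq, armAt_eq, phaseAt_zero]
        rfl
      · rw [explored_succ, explored_succ, phaseAt_zero]
        rfl
    · refine h.sameStatus_succ hj' hm h1 fun i hi _ => hw i (hi.trans_lt ?_)
      by_contra! hle
      have := blockStart_mono (prior := prior) (a := a) (Fin.le_def.1 hle)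
      omega

/-- Whether arm `j` has been explored depends only on the previous arms and on the seeds. -/
lemma Params.Admissible.avail_congr (h : a.Admissible prior) {j : Fin K} (hj : j ≠ 0) {m : ℕ}
    (hm : m ≤ loopLength prior a.N₀ a.lam j + 2) {σ : Seeds} {w w' : World K}
    (hw : ∀ i < j, samples i a.N w = samples i a.N w') :
    Avail prior a (blockStart prior a j + m) j (w, σ) ↔
      Avail prior a (blockStart prior a j + m) j (w', σ) := by
  -- The two runs stay in lockstep until arm `j` is first played, because up to then only earlier
  -- arms have been consulted. Afterwards the runs may diverge, but arm `j` remains available in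
  -- both.
  have key : (Avail prior a (blockStart prior a j + m) j (w, σ) ∧
      Avail prior a (blockStart prior a j + m) j (w', σ)) ∨
      SameStatus prior a (blockStart prior a j + m) σ w w' := by
    induction m with
    | zero => exact .inr (h.sameStatus_blockStart j hw le_rfl)
    | succ m ih =>
      rcases ih (by omega) with ⟨h1, h2⟩ | h1
      · exact .inl ⟨h1.mono (by omega), h2.mono (by omega)⟩
      · by_cases hA : Avail prior a (blockStart prior a j + m) j (w, σ)
        · exact .inl ⟨hA.mono (by omega), ((h1.1 j).1 hA).mono (by omega)⟩
        · refine .inr (h.sameStatus_succ hj (by omega) h1 fun i hi hAi => hw i ?_)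
          exact lt_of_le_of_ne hi fun e => hA (e ▸ hAi)
  rcases key with h1 | h1
  · exact iff_of_true h1.1 h1.2
  · exact h1.1 j

/-! ### Measurability of the trajectory -/

/-- There are countably many states, so measurability of the trajectory can be checked with the
current state held fixed. -/
instance : MeasurableSpace (State K) := ⊤

instance : DiscreteMeasurableSpace (State K) := ⟨fun _ => trivial⟩

instance : Countable (State K) :=
  (show Function.Injective (fun st : State K => (st.data, st.explored)) from
    fun ⟨_, _⟩ ⟨_, _⟩ h => by simp_all).countable

omit [NeZero K] in
lemma IsSuitable.measurable_comp {j : Fin K} {lam : ℝ} {N : ℕ} {π : Policy K}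
    (hπ : IsSuitable prior j lam N π) {Ω : Type*} [MeasurableSpace Ω] {d : Ω → Data K}
    (hd : Measurable d) {u : Ω → unitInterval} (hu : Measurable u) :
    Measurable fun o => π (d o) (u o) := by
  have : Measurable fun p : Data K × unitInterval => π p.1 p.2 :=
    measurable_from_prod_countable_right hπ.measurable
  exact this.comp (hd.prodMk hu)

omit [NeZero K] in
lemma IsFakeData.measurable_apply {N₀ N : ℕ} {i : Fin K} {κ : List Bool → unitInterval → List Bool}
    (hκ : IsFakeData prior N₀ N i κ) (l : List Bool) : Measurable (κ l) :=
  measurable_to_countable' fun l' => hκ.measurable l l'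

lemma measurableSet_coin (c : ℝ) (m : ℕ) :
    MeasurableSet {r : ℕ → unitInterval | (r m : ℝ) ≤ c} :=
  measurableSet_le (by fun_prop) measurable_const

lemma Params.Admissible.measurable_choose (h : a.Admissible prior) (s : ℕ) (st : State K) :
    Measurable (choose prior a (phaseAt prior a s) st) := by
  by_cases hs : s < (schedule prior a.N₀ a.lam).length
  · rcases exists_block hs with rfl | ⟨j, hj, m, hm, rfl⟩
    · exact measurable_const
    · rcases m with _ | _ | n
      · rw [add_zero, phaseAt_boot₁ hj]
        exact measurable_const
      · rw [phaseAt_boot₂ hj]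
        change Measurable fun r => choose prior a (Phase.boot₂ j) st r
        simp only [choose]
        refine Measurable.ite (measurableSet_coin _ _) measurable_const ?_
        split_ifs
        · refine Measurable.prodMk ?_ measurable_const
          unfold transform
          refine Measurable.ite ?_ measurable_const measurable_const
          refine ((h.suitable j hj).measurable_comp (d := fun r : ℕ → unitInterval =>
            fun i : Fin K => if i < j then a.κ j i ((st.data i).take a.N) (r (2 + i)) else
              st.data i) ?_ (u := fun r => r 1) (by fun_prop)) (.of_discrete (s := {j}))
          refine measurable_pi_lambda _ fun i => ?_
          split_ifs with hi
          · exact ((h.fake j i hi).measurable_apply _).comp (measurable_pi_apply _)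
          · exact measurable_const
        · exact measurable_const
      · rw [show blockStart prior a j + (n + 1 + 1) = blockStart prior a j + 2 + n by ring,
          phaseAt_main hj (by omega)]
        change Measurable fun r => choose prior a (Phase.main j n) st r
        simp only [choose]
        split_ifs
        · exact (((h.suitable j hj).measurable _).comp (measurable_pi_apply 1)).prodMk
            measurable_const
        · exact Measurable.ite (measurableSet_coin _ _) measurable_const measurable_const
  · have : phaseAt prior a s = Phase.init := List.getD_eq_default _ _ (by omega)
    rw [this]
    exact measurable_const

omit [NeZero K] in
lemma measurable_play (N : ℕ) (d : Data K) (k : Fin K) :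
    Measurable fun w : World K => play N w d k := by
  refine measurable_pi_lambda _ fun i => ?_
  unfold play
  split_ifs
  · have : ∀ m n, Measurable fun w : World K =>
        (List.range n).map fun k => reward i (m + k) w := fun m n => by
      induction n with
      | zero => simp
      | succ n ih =>
        simp only [List.range_succ, List.map_append, List.map_cons, List.map_nil]
        have h2 : Measurable fun p : List Bool × Bool => p.1 ++ [p.2] := Measurable.of_discrete
        exact h2.comp (ih.prodMk (measurable_reward i (m + n)))
    have h2 : Measurable fun l : List Bool => d i ++ l := Measurable.of_discrete
    exact h2.comp (this _ N)
  · exact measurable_const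

lemma Params.Admissible.measurable_stateAt (h : a.Admissible prior) (s : ℕ) :
    Measurable fun ω => stateAt prior a ω s := by
  induction s with
  | zero => exact measurable_const
  | succ s ih =>
    have hF : Measurable fun p : State K × (World K × Seeds) =>
        (⟨play a.N p.2.1 p.1.data (choose prior a (phaseAt prior a s) p.1
          fun m => p.2.2 (s, m)).1, (choose prior a (phaseAt prior a s) p.1
          fun m => p.2.2 (s, m)).2⟩ : State K) := by
      refine measurable_from_prod_countable_right fun st => ?_
      have h1 : Measurable fun ω : World K × Seeds =>
          choose prior a (phaseAt prior a s) st fun m => ω.2 (s, m) :=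
        (h.measurable_choose s st).comp (by fun_prop)
      have h2 : Measurable fun p : (Fin K × Bool) × World K => play a.N p.2 st.data p.1.1 :=
        measurable_from_prod_countable_right fun c => measurable_play a.N st.data c.1
      have h3 : Measurable fun p : Data K × Bool => (⟨p.1, p.2⟩ : State K) := .of_discrete
      have h4 : Measurable fun ω : World K × Seeds => play a.N ω.1 st.data
          (choose prior a (phaseAt prior a s) st fun m => ω.2 (s, m)).1 :=
        h2.comp (h1.prodMk measurable_fst)
      have h5 : Measurable fun ω : World K × Seeds =>
          (choose prior a (phaseAt prior a s) st fun m => ω.2 (s, m)).2 :=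
        measurable_snd.comp h1
      exact h3.comp (h4.prodMk h5)
    have e : (fun ω => stateAt prior a ω (s + 1)) = fun ω =>
        (⟨play a.N ω.1 (stateAt prior a ω s).data (choose prior a (phaseAt prior a s)
          (stateAt prior a ω s) fun m => ω.2 (s, m)).1, (choose prior a (phaseAt prior a s)
          (stateAt prior a ω s) fun m => ω.2 (s, m)).2⟩ : State K) := rfl
    rw [e]
    have hc := hF.comp (ih.prodMk measurable_id)
    exact hc

lemma Params.Admissible.measurable_armAt (h : a.Admissible prior) (s : ℕ) :
    Measurable (armAt prior a s) := by
  have hF : Measurable fun p : State K × (World K × Seeds) =>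
      (choose prior a (phaseAt prior a s) p.1 fun m => p.2.2 (s, m)).1 :=
    measurable_from_prod_countable_right fun st => by
      have h1 : Measurable fun ω : World K × Seeds =>
          choose prior a (phaseAt prior a s) st fun m => ω.2 (s, m) :=
        (h.measurable_choose s st).comp (by fun_prop)
      exact measurable_fst.comp h1
  have e : armAt prior a s = fun ω => (choose prior a (phaseAt prior a s)
      (stateAt prior a ω s) fun m => ω.2 (s, m)).1 := rfl
  rw [e]
  have hc := hF.comp ((h.measurable_stateAt s).prodMk measurable_id)
  exact hc

lemma Params.Admissible.measurableSet_armAt (h : a.Admissible prior) (s : ℕ) (i : Fin K) :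
    MeasurableSet {ω | armAt prior a s ω = i} :=
  h.measurable_armAt s (.of_discrete (s := {i}))

lemma Params.Admissible.measurableSet_avail (h : a.Admissible prior) (s : ℕ) (i : Fin K) :
    MeasurableSet {ω | Avail prior a s i ω} :=
  h.measurable_stateAt s (.of_discrete (s := {st : State K | a.N ≤ (st.data i).length}))

end

section

variable {K : ℕ}

/-! ### Random data drawn arm by arm -/

/-- Writes a function of the data as a sum of products over the arms, to which independence applies.
-/
lemma sum_piFinset_lists {N : ℕ} {x : Fin K → List Bool} (hx : ∀ i, x i ∈ lists N)
    (v : (Fin K → List Bool) → ℝ) :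
    ∑ f ∈ Fintype.piFinset fun _ : Fin K => lists N,
      v f * ∏ i, (if x i = f i then (1 : ℝ) else 0) = v x := by
  rw [Finset.sum_eq_single x]
  · simp
  · intro f _ hf
    obtain ⟨i, hi⟩ := Function.ne_iff.1 hf
    rw [Finset.prod_eq_zero (Finset.mem_univ i) (if_neg (Ne.symm hi)), mul_zero]
  · exact fun h => absurd (Fintype.mem_piFinset.2 hx) h

section

variable (prior : Fin K → Measure unitInterval) [∀ i, IsProbabilityMeasure (prior i)]

/-- The mean of arm `k` joins the factor of that arm, and independence separates all factors. -/
lemma integral_mul_mean {h : Fin K → unitInterval × (ℕ → unitInterval) → ℝ}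
    (hm : ∀ i, Measurable (h i)) (k : Fin K) :
    ∫ w, (∏ i, h i (arm i w)) * (w.1 k : ℝ) ∂(worldLaw prior) =
      (∫ w, (w.1 k : ℝ) * h k (arm k w) ∂(worldLaw prior)) *
        ∏ i ∈ Finset.univ.erase k, ∫ w, h i (arm i w) ∂(worldLaw prior) := by
  have := integral_prod_arm prior
    (h := fun i x => if i = k then (x.1 : ℝ) * h i x else h i x)
    (fun i => by split_ifs <;> fun_prop)
  rw [← Finset.mul_prod_erase _ _ (Finset.mem_univ k)] at this
  simp only [↓reduceIte] at this
  have e : ∀ i ∈ Finset.univ.erase k, i ≠ k := fun i hi => Finset.ne_of_mem_erase hi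
  rw [show ∏ i ∈ Finset.univ.erase k, ∫ w, (if i = k then ((arm i w).1 : ℝ) * h i (arm i w)
      else h i (arm i w)) ∂(worldLaw prior) = ∏ i ∈ Finset.univ.erase k,
      ∫ w, h i (arm i w) ∂(worldLaw prior) from
    Finset.prod_congr rfl fun i hi => by simp only [if_neg (e i hi)]] at this
  refine Eq.trans (congrArg _ (funext fun w => ?_)) this
  rw [← Finset.mul_prod_erase _ _ (Finset.mem_univ k),
    ← Finset.mul_prod_erase (Finset.univ) (fun i => if i = k then ((arm i w).1 : ℝ) *
      h i (arm i w) else h i (arm i w)) (Finset.mem_univ k),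
    show ∏ i ∈ Finset.univ.erase k, (if i = k then ((arm i w).1 : ℝ) * h i (arm i w)
      else h i (arm i w)) = ∏ i ∈ Finset.univ.erase k, h i (arm i w) from
    Finset.prod_congr rfl fun i hi => by rw [if_neg (e i hi)]]
  simp only [↓reduceIte, arm]
  ring

/-- The probability that the first `n` samples of arm `i` are `l`. -/
noncomputable def samplesProb (n : ℕ) (i : Fin K) (l : List Bool) : ℝ :=
  (worldLaw prior).real {w | samples i n w = l}

/-- The integral of the mean reward of arm `i` over the event that its first `n` samples
are `l`. -/
noncomputable def samplesMean (n : ℕ) (i : Fin K) (l : List Bool) : ℝ :=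
  ∫ w in {w | samples i n w = l}, (w.1 i : ℝ) ∂(worldLaw prior)

lemma samplesMean_eq {n : ℕ} {l : List Bool} (hl : l.length = n) (i : Fin K) :
    samplesMean prior n i l =
      samplesProb prior n i l * posteriorMean prior {i} n (fun _ => l) i := by
  have h : {w : World K | samples i n w = l} = agrees {i} n fun _ => l := by
    ext w
    rw [agrees, Set.mem_ofPred_eq, Set.mem_ofPred_eq]
    simp [← hl]
  rw [samplesMean, samplesProb, h, setIntegral_agrees]

omit [∀ i, IsProbabilityMeasure (prior i)] in
lemma integral_mul_indicator_samples (n : ℕ) (i : Fin K) (l : List Bool) (g : World K → ℝ) :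
    ∫ w, g w * (if samples i n w = l then (1 : ℝ) else 0) ∂(worldLaw prior) =
      ∫ w in {w | samples i n w = l}, g w ∂(worldLaw prior) := by
  rw [← integral_indicator (show MeasurableSet {w : World K | samples i n w = l} from
    measurable_samples i n (.of_discrete (s := {l})))]
  congr 1
  ext w
  by_cases h : samples i n w = l <;> simp [h, Set.indicator, Set.mem_ofPred_eq]

omit [∀ i, IsProbabilityMeasure (prior i)] in
lemma integral_indicator_samples (n : ℕ) (i : Fin K) (l : List Bool) :
    ∫ w, (if samples i n w = l then (1 : ℝ) else 0) ∂(worldLaw prior) =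
      samplesProb prior n i l := by
  have := integral_mul_indicator_samples prior n i l (fun _ => 1)
  simpa [samplesProb] using this

/-- The gap between two arms on the event that a policy recommends a given arm. -/
lemma setIntegral_policyArm {π : Policy K} (hπ : ∀ d, Measurable (π d)) (N : ℕ) (i k l : Fin K) :
    ∫ p in {p : World K × unitInterval | policyArm π N p = i},
      ((p.1.1 k : ℝ) - (p.1.1 l : ℝ)) ∂((worldLaw prior).prod volume) =
    ∑ f ∈ Fintype.piFinset fun _ : Fin K => lists N,
      (volume : Measure unitInterval).real {u | π f u = i} *
        ∫ w, (∏ m, (if samples m N w = f m then (1 : ℝ) else 0)) * ((w.1 k : ℝ) - w.1 l)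
          ∂(worldLaw prior) := by
  rw [setIntegral_prod_fst (g := fun w : World K => (w.1 k : ℝ) - w.1 l)
    (measurableSet_policyArm hπ N i) (integrable_gap (by fun_prop) k l)]
  simp_rw [← integral_const_mul]
  rw [← integral_finsetSum]
  · refine integral_congr_ae (.of_forall fun w => ?_)
    simp only
    have := sum_piFinset_lists (x := fun m => samples m N w) (N := N)
      (fun m => mem_lists.2 (length_samples m N w))
      (fun f => (volume : Measure unitInterval).real {u | π f u = i})
    simp_rw [← mul_assoc]
    rw [← Finset.sum_mul, this]
    rfl
  · intro f _
    refine Integrable.const_mul (Integrable.bdd_mul (c := 1) (integrable_gap (by fun_prop) k l)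
      (Measurable.aestronglyMeasurable ?_) (.of_forall fun w => ?_)) _
    · refine Finset.measurable_prod _ fun m _ => Measurable.ite
        (measurable_samples m N (.of_discrete (s := {f m}))) measurable_const measurable_const
    · rw [Real.norm_eq_abs, Finset.abs_prod]
      exact Finset.prod_le_one (fun m _ => abs_nonneg _) fun m _ => by split_ifs <;> simp

end

/-! ### Fake data -/

/-- The data of arm `i` that are used by the transformed policy: fake data if `i < j`. -/
noncomputable def fakeArm (j : Fin K) (κ : Fin K → List Bool → unitInterval → List Bool)
    (i : Fin K) (l : List Bool) (u : unitInterval) : List Bool :=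
  if i < j then κ i l u else l

/-- The event that the first `N₀` samples of arm `i` are `0`, if `i < j`. -/
def zeroArm (j : Fin K) (N₀ : ℕ) (i : Fin K) : Set (unitInterval × (ℕ → unitInterval)) :=
  {x | i < j → armSamples N₀ x = List.replicate N₀ false}

open Classical in
/-- The conditional probability, given the environment, that the first `N₀` samples of arm `i` are
`0` and the data used by the transformed policy are `l`. -/
noncomputable def fakeWeight (j : Fin K) (N₀ N : ℕ)
    (κ : Fin K → List Bool → unitInterval → List Bool) (i : Fin K) (l : List Bool)
    (x : unitInterval × (ℕ → unitInterval)) : ℝ :=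
  if x ∈ zeroArm j N₀ i then
    (volume : Measure unitInterval).real {u | fakeArm j κ i (armSamples N x) u = l} else 0

lemma measurableSet_zeroArm (j : Fin K) (N₀ : ℕ) (i : Fin K) :
    MeasurableSet (zeroArm j N₀ i) := by
  by_cases h : i < j
  · have : zeroArm j N₀ i = {x | armSamples N₀ x = List.replicate N₀ false} := by
      ext x
      rw [zeroArm, Set.mem_ofPred_eq, Set.mem_ofPred_eq]
      simp [h]
    rw [this]
    exact measurableSet_armSamples_eq _ _
  · have : zeroArm j N₀ i = Set.univ := by
      ext x
      rw [zeroArm, Set.mem_ofPred_eq]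
      simp [h]
    rw [this]
    exact .univ

lemma mem_zeros_iff {j : Fin K} {N₀ : ℕ} {w : World K} :
    w ∈ zeros j N₀ ↔ ∀ i, arm i w ∈ zeroArm j N₀ i := by
  rw [zeros, Set.mem_ofPred_eq]
  refine forall_congr' fun i => forall_congr' fun _ => ?_
  rw [reward_zero_iff]
  rfl

@[fun_prop]
lemma measurable_fakeWeight (j : Fin K) (N₀ N : ℕ)
    (κ : Fin K → List Bool → unitInterval → List Bool) (i : Fin K) (l : List Bool) :
    Measurable (fakeWeight j N₀ N κ i l) := by
  classical
  refine Measurable.ite (measurableSet_zeroArm j N₀ i) ?_ measurable_const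
  have h : Measurable fun l' : List Bool =>
    (volume : Measure unitInterval).real {u | fakeArm j κ i l' u = l} := .of_discrete
  exact h.comp (measurable_armSamples N)

lemma fakeWeight_mem (j : Fin K) (N₀ N : ℕ)
    (κ : Fin K → List Bool → unitInterval → List Bool) (i : Fin K) (l : List Bool)
    (x : unitInterval × (ℕ → unitInterval)) : 0 ≤ fakeWeight j N₀ N κ i l x ∧
      fakeWeight j N₀ N κ i l x ≤ 1 := by
  unfold fakeWeight
  split_ifs
  · exact ⟨measureReal_nonneg, measureReal_le_one⟩
  · simp

lemma fakeWeight_of_le {j i : Fin K} (hi : ¬ i < j) (N₀ N : ℕ)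
    (κ : Fin K → List Bool → unitInterval → List Bool) (l : List Bool) (w : World K) :
    fakeWeight j N₀ N κ i l (arm i w) = if samples i N w = l then 1 else 0 := by
  have h : arm i w ∈ zeroArm j N₀ i := fun h => absurd h hi
  rw [fakeWeight, if_pos h]
  simp only [fakeArm, if_neg hi, ← samples_eq_armSamples]
  by_cases h : samples i N w = l <;> simp [h]

section

variable {prior : Fin K → Measure unitInterval} [∀ i, IsProbabilityMeasure (prior i)]
  {j : Fin K} {N₀ N : ℕ} {κ : Fin K → List Bool → unitInterval → List Bool}

lemma ae_cond_iff {Ω : Type*} [MeasurableSpace Ω] {P : Measure Ω} [IsFiniteMeasure P] {s : Set Ω}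
    (hs : MeasurableSet s) {p : Ω → Prop} :
    (∀ᵐ ω ∂(ProbabilityTheory.cond P s), p ω) ↔ ∀ᵐ ω ∂P, ω ∈ s → p ω := by
  rw [ProbabilityTheory.cond, Measure.ae_ennreal_smul_measure_iff
    (ENNReal.inv_ne_zero.2 (measure_ne_top _ _)), ae_restrict_iff' hs]

lemma setOf_reward_eq {i : Fin K} (hi : i < j) : {w : World K | ∀ n < N₀, reward i n w = false} =
    {w | arm i w ∈ zeroArm j N₀ i} := by
  ext w
  rw [Set.mem_ofPred_eq, Set.mem_ofPred_eq, reward_zero_iff, zeroArm, Set.mem_ofPred_eq,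
    samples_eq_armSamples]
  simp [hi]

/-- The probability that the first `N₀` samples of arm `i` are `0`, if `i < j`. -/
noncomputable def zeroProb (prior : Fin K → Measure unitInterval) (j : Fin K) (N₀ : ℕ)
    (i : Fin K) : ℝ :=
  (worldLaw prior).real {w | arm i w ∈ zeroArm j N₀ i}

lemma measurableSet_arm_zeroArm (i : Fin K) :
    MeasurableSet {w : World K | arm i w ∈ zeroArm j N₀ i} :=
  measurable_arm i (measurableSet_zeroArm j N₀ i)

lemma prod_zeroProb : ∏ i, zeroProb prior j N₀ i = (worldLaw prior).real (zeros j N₀) := by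
  have h := measureReal_arms prior (B := zeroArm j N₀) Finset.univ (measurableSet_zeroArm j N₀)
  unfold zeroProb
  rw [← h]
  congr 1
  ext w
  rw [mem_zeros_iff, Set.mem_ofPred_eq]
  simp

lemma zeroProb_pos (hz : 0 < (worldLaw prior).real (zeros j N₀)) (i : Fin K) :
    0 < zeroProb prior j N₀ i := by
  rw [← prod_zeroProb] at hz
  refine measureReal_nonneg.lt_of_ne' fun h => hz.ne' ?_
  exact Finset.prod_eq_zero (Finset.mem_univ i) h

lemma zeroProb_of_le {i : Fin K} (hi : ¬ i < j) : zeroProb prior j N₀ i = 1 := by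
  have : {w : World K | arm i w ∈ zeroArm j N₀ i} = Set.univ := by
    ext w
    rw [Set.mem_ofPred_eq]
    simp only [Set.mem_univ, iff_true]
    exact fun h => absurd h hi
  rw [zeroProb, this, probReal_univ]

omit [∀ i, IsProbabilityMeasure (prior i)] in
lemma IsFakeData.measurableSet_eq {i : Fin K} {κ : List Bool → unitInterval → List Bool}
    (hκ : IsFakeData prior N₀ N i κ) (l : List Bool) :
    MeasurableSet {p : World K × unitInterval | κ (samples i N p.1) p.2 = l} := by
  have h : Measurable fun p : List Bool × unitInterval => κ p.1 p.2 :=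
    measurable_from_prod_countable_right hκ.measurable_apply
  have h2 : Measurable fun p : World K × unitInterval => (samples i N p.1, p.2) :=
    ((measurable_samples i N).comp measurable_fst).prodMk measurable_snd
  exact (h.comp h2) (.of_discrete (s := {l}))

omit [∀ i, IsProbabilityMeasure (prior i)] in
lemma integral_fakeWeight_eq (i : Fin K) (l : List Bool) (g : World K → ℝ) :
    ∫ w, g w * fakeWeight j N₀ N κ i l (arm i w) ∂(worldLaw prior) =
      ∫ w in {w | arm i w ∈ zeroArm j N₀ i}, g w * (volume : Measure unitInterval).real
        {u | fakeArm j κ i (samples i N w) u = l} ∂(worldLaw prior) := by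
  classical
  rw [← integral_indicator (measurableSet_arm_zeroArm i)]
  refine congrArg _ (funext fun w => ?_)
  rw [Set.indicator_apply, fakeWeight]
  by_cases h : arm i w ∈ zeroArm j N₀ i
  · have h' : w ∈ {w | arm i w ∈ zeroArm j N₀ i} := h
    rw [if_pos h, if_pos h']
    rfl
  · have h' : w ∉ {w | arm i w ∈ zeroArm j N₀ i} := h
    rw [if_neg h, if_neg h', mul_zero]

/-- On the zeros, the fake data have the law of the true data. -/
lemma integral_fakeWeight (hz : 0 < (worldLaw prior).real (zeros j N₀))
    (hκ : ∀ i < j, IsFakeData prior N₀ N i (κ i)) (i : Fin K) (l : List Bool) :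
    ∫ w, fakeWeight j N₀ N κ i l (arm i w) ∂(worldLaw prior) =
      zeroProb prior j N₀ i * samplesProb prior N i l := by
  by_cases hi : i < j
  · have h1 := (hκ i hi).law l
    have h2 := congrArg ENNReal.toReal h1
    change Measure.real _ _ = samplesProb prior N i l at h2
    have h3 := setIntegral_prod_fst (P := ProbabilityTheory.cond (worldLaw prior)
      {w | ∀ n < N₀, reward i n w = false}) (Q := (volume : Measure unitInterval))
      ((hκ i hi).measurableSet_eq l) (g := fun _ => (1 : ℝ)) (integrable_const _)
    rw [setIntegral_const, smul_eq_mul, mul_one, h2, integral_cond_eq, setOf_reward_eq hi] at h3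
    have h4 := integral_fakeWeight_eq (prior := prior) (j := j) (N₀ := N₀) (N := N) (κ := κ) i l
      (fun _ => 1)
    simp only [one_mul] at h4
    have h5 : zeroProb prior j N₀ i *
        ((worldLaw prior).real {w | arm i w ∈ zeroArm j N₀ i})⁻¹ = 1 :=
      mul_inv_cancel₀ (zeroProb_pos hz i).ne'
    rw [h4, h3, ← mul_assoc, h5, one_mul]
    simp only [fakeArm, if_pos hi, mul_one]
    rfl
  · simp_rw [fakeWeight_of_le hi, zeroProb_of_le hi, one_mul]
    exact integral_indicator_samples prior N i l

/-- On the zeros, the fake data look better than the true data. -/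
lemma integral_mul_fakeWeight_le (hN : N₀ ≤ N) (hz : 0 < (worldLaw prior).real (zeros j N₀))
    (hκ : ∀ i < j, IsFakeData prior N₀ N i (κ i)) {i : Fin K} (hi : i < j) {l : List Bool}
    (hl : l.length = N) :
    ∫ w, (w.1 i : ℝ) * fakeWeight j N₀ N κ i l (arm i w) ∂(worldLaw prior) ≤
      zeroProb prior j N₀ i * samplesMean prior N i l := by
  classical
  -- Given the true samples, the weight is a function of them alone. Splitting over the true list l'
  -- leaves a comparison of the posterior means at l' and at the fake list l.
  set c : List Bool → ℝ := fun l' => if l'.take N₀ = List.replicate N₀ false then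
    (volume : Measure unitInterval).real {u | κ i l' u = l} else 0 with hc
  have hc0 : ∀ l', 0 ≤ c l' := fun l' => by
    simp only [hc]; split_ifs <;> simp
  have hW : ∀ w : World K, fakeWeight j N₀ N κ i l (arm i w) = c (samples i N w) := by
    intro w
    have : arm i w ∈ zeroArm j N₀ i ↔ (samples i N w).take N₀ = List.replicate N₀ false := by
      rw [take_samples i hN, zeroArm, Set.mem_ofPred_eq, samples_eq_armSamples]
      simp [hi]
    simp only [fakeWeight, hc, this, fakeArm, if_pos hi]
    rfl
  have hsum : ∀ (g : World K → ℝ), Integrable g (worldLaw prior) →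
      ∫ w, g w * fakeWeight j N₀ N κ i l (arm i w) ∂(worldLaw prior) =
      ∑ l' ∈ lists N, c l' * ∫ w in {w | samples i N w = l'}, g w ∂(worldLaw prior) := by
    intro g hg
    rw [integral_eq_sum_lists (measurable_samples i N) (length_samples i N)]
    · refine Finset.sum_congr rfl fun l' _ => ?_
      rw [← integral_const_mul]
      refine setIntegral_congr_fun (measurable_samples i N (.of_discrete (s := {l'})))
        fun w hw => ?_
      have hw' : samples i N w = l' := hw
      simp only [hW, hw']
      ring
    · refine Integrable.mul_bdd (c := 1) hg (Measurable.aestronglyMeasurable (by fun_prop))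
        (.of_forall fun w => ?_)
      have := fakeWeight_mem j N₀ N κ i l (arm i w)
      rw [Real.norm_eq_abs, abs_of_nonneg this.1]
      exact this.2
  have h1 := integral_fakeWeight hz hκ i l
  have h2 := hsum (fun _ => 1) (integrable_const _)
  simp only [one_mul, setIntegral_const, smul_eq_mul, mul_one] at h2
  rw [hsum _ (integrable_mean (by fun_prop) i), samplesMean_eq prior hl, ← mul_assoc, ← h1, h2,
    Finset.sum_mul]
  refine Finset.sum_le_sum fun l' hl' => ?_
  have h3 := samplesMean_eq prior (mem_lists.1 hl') i
  rw [samplesMean, samplesProb] at h3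
  rw [h3, ← mul_assoc]
  -- If the term vanishes there is nothing to compare. Otherwise the pair of a true list l' and a
  -- fake list l has positive probability, so the almost sure domination holds at some such point.
  by_cases h0 : c l' * (worldLaw prior).real {w | samples i N w = l'} = 0
  · rw [h0, zero_mul, zero_mul]
  refine mul_le_mul_of_nonneg_left ?_ (mul_nonneg (hc0 _) measureReal_nonneg)
  obtain ⟨hcl, hpl⟩ := mul_ne_zero_iff.1 h0
  have hz' : l'.take N₀ = List.replicate N₀ false := by
    by_contra h
    exact hcl (if_neg h)
  have hcl' : (volume : Measure unitInterval).real {u | κ i l' u = l} ≠ 0 := by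
    simpa only [hc, if_pos hz'] using hcl
  have hd := (hκ i hi).dominates
  rw [setOf_reward_eq hi] at hd
  have hpos : ((ProbabilityTheory.cond (worldLaw prior)
      {w | arm i w ∈ zeroArm j N₀ i}).prod (volume : Measure unitInterval))
      ({w | samples i N w = l'} ×ˢ {u | κ i l' u = l}) ≠ 0 := by
    rw [Measure.prod_prod]
    refine mul_ne_zero ?_ ?_
    · rw [← measureReal_ne_zero_iff, measureReal_cond (measurableSet_arm_zeroArm i)]
      refine mul_ne_zero (inv_ne_zero (zeroProb_pos hz i).ne') ?_
      rwa [Set.inter_eq_right.2]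
      intro w hw
      have hw' : samples i N w = l' := hw
      have : armSamples N₀ (arm i w) = List.replicate N₀ false := by
        rw [← samples_eq_armSamples, ← take_samples i hN, hw', hz']
      exact fun _ => this
    · rwa [← measureReal_ne_zero_iff]
  obtain ⟨p, ⟨hp1, hp2⟩, hp⟩ := Measure.exists_mem_of_measure_ne_zero_of_ae hpos
    (ae_restrict_of_ae hd)
  have hp1' : samples i N p.1 = l' := hp1
  have hp2' : κ i l' p.2 = l := hp2
  rwa [hp1', hp2'] at hp

/-- The transformed policy inherits the padding of the original one. -/
lemma sum_fakeWeight_ge (hN : N₀ ≤ N) (hz : 0 < (worldLaw prior).real (zeros j N₀))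
    (hκ : ∀ i < j, IsFakeData prior N₀ N i (κ i)) {π : Policy K} (hπ : ∀ d, Measurable (π d))
    (l : Fin K) :
    (worldLaw prior).real (zeros j N₀) * ∫ p in {p : World K × unitInterval | policyArm π N p = j},
      ((p.1.1 j : ℝ) - (p.1.1 l : ℝ)) ∂((worldLaw prior).prod volume) ≤
    ∑ f ∈ Fintype.piFinset fun _ : Fin K => lists N,
      (volume : Measure unitInterval).real {u | π f u = j} *
        ∫ w, (∏ m, fakeWeight j N₀ N κ m (f m) (arm m w)) * ((w.1 j : ℝ) - w.1 l)
          ∂(worldLaw prior) := by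
  rcases eq_or_ne j l with rfl | hjl
  · simp
  rw [setIntegral_policyArm prior hπ, Finset.mul_sum]
  -- The comparison is made separately for every possible data set f. Both sides factorize over the
  -- arms and differ only in the factor of the subtracted mean of arm `l`, which on the fake side is
  -- no larger than on the true side.
  refine Finset.sum_le_sum fun f hf => ?_
  rw [mul_left_comm]
  refine mul_le_mul_of_nonneg_left ?_ measureReal_nonneg
  have hf' : ∀ i, (f i).length = N := fun i => mem_lists.1 (Fintype.mem_piFinset.1 hf i)
  have expand : ∀ h : Fin K → unitInterval × (ℕ → unitInterval) → ℝ, (∀ i, Measurable (h i)) →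
      (∀ i x, 0 ≤ h i x ∧ h i x ≤ 1) →
      ∫ w, (∏ m, h m (arm m w)) * ((w.1 j : ℝ) - w.1 l) ∂(worldLaw prior) =
        (∫ w, (w.1 j : ℝ) * h j (arm j w) ∂(worldLaw prior)) *
        ∏ i ∈ Finset.univ.erase j, ∫ w, h i (arm i w) ∂(worldLaw prior) -
        (∫ w, (w.1 l : ℝ) * h l (arm l w) ∂(worldLaw prior)) *
        ∏ i ∈ Finset.univ.erase l, ∫ w, h i (arm i w) ∂(worldLaw prior) := by
    intro h hm hb
    have hint : ∀ k, Integrable (fun w : World K => (∏ m, h m (arm m w)) * (w.1 k : ℝ))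
        (worldLaw prior) := fun k => by
      refine Integrable.bdd_mul (c := 1) (integrable_mean (by fun_prop) k)
        (Measurable.aestronglyMeasurable (by fun_prop)) (.of_forall fun w => ?_)
      rw [Real.norm_eq_abs, Finset.abs_prod]
      exact Finset.prod_le_one (fun m _ => abs_nonneg _) fun m _ => by
        rw [abs_of_nonneg (hb _ _).1]; exact (hb _ _).2
    simp_rw [mul_sub]
    rw [integral_sub (hint j) (hint l), integral_mul_mean prior hm, integral_mul_mean prior hm]
  have hmi : ∀ i, Measurable fun x : unitInterval × (ℕ → unitInterval) =>
      if armSamples N x = f i then (1 : ℝ) else 0 := fun i =>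
    Measurable.ite (measurableSet_armSamples_eq N (f i)) measurable_const measurable_const
  have e1 : ∫ w, (∏ m, (if samples m N w = f m then (1 : ℝ) else 0)) * ((w.1 j : ℝ) - w.1 l)
        ∂(worldLaw prior) =
      (∫ w, (w.1 j : ℝ) * (if samples j N w = f j then (1 : ℝ) else 0) ∂(worldLaw prior)) *
        ∏ i ∈ Finset.univ.erase j,
          ∫ w, (if samples i N w = f i then (1 : ℝ) else 0) ∂(worldLaw prior) -
      (∫ w, (w.1 l : ℝ) * (if samples l N w = f l then (1 : ℝ) else 0) ∂(worldLaw prior)) *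
        ∏ i ∈ Finset.univ.erase l,
          ∫ w, (if samples i N w = f i then (1 : ℝ) else 0) ∂(worldLaw prior) :=
    expand (fun i x => if armSamples N x = f i then 1 else 0) hmi
    (fun i x => by split_ifs <;> simp)
  have e2 := expand (fun i => fakeWeight j N₀ N κ i (f i)) (fun i => by fun_prop)
    (fun i x => fakeWeight_mem _ _ _ _ _ _ _)
  simp_rw [integral_mul_indicator_samples, integral_indicator_samples] at e1
  simp_rw [integral_fakeWeight hz hκ] at e2
  have hj : ∫ w, (w.1 j : ℝ) * fakeWeight j N₀ N κ j (f j) (arm j w) ∂(worldLaw prior) =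
      zeroProb prior j N₀ j * samplesMean prior N j (f j) := by
    simp_rw [fakeWeight_of_le (lt_irrefl j), zeroProb_of_le (lt_irrefl j), one_mul]
    exact integral_mul_indicator_samples prior N j (f j) _
  have hl : ∫ w, (w.1 l : ℝ) * fakeWeight j N₀ N κ l (f l) (arm l w) ∂(worldLaw prior) ≤
      zeroProb prior j N₀ l * samplesMean prior N l (f l) := by
    by_cases hlj : l < j
    · exact integral_mul_fakeWeight_le hN hz hκ hlj (hf' l)
    · simp_rw [fakeWeight_of_le hlj, zeroProb_of_le hlj, one_mul]
      exact (integral_mul_indicator_samples prior N l (f l) _).le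
  have hprod : ∀ k, (zeroProb prior j N₀ k * samplesMean prior N k (f k)) *
      ∏ i ∈ Finset.univ.erase k, zeroProb prior j N₀ i * samplesProb prior N i (f i) =
      (worldLaw prior).real (zeros j N₀) * (samplesMean prior N k (f k) *
        ∏ i ∈ Finset.univ.erase k, samplesProb prior N i (f i)) := by
    intro k
    rw [← prod_zeroProb, ← Finset.mul_prod_erase _ _ (Finset.mem_univ k),
      Finset.prod_mul_distrib]
    ring
  rw [e1, e2, hj, hprod, mul_sub]
  refine sub_le_sub_left (le_trans (mul_le_mul_of_nonneg_right hl ?_) (hprod l).le) _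
  exact Finset.prod_nonneg fun i _ => mul_nonneg (zeroProb_pos hz i).le measureReal_nonneg

/-- On the zeros, the fake data almost surely consist of `N` samples. -/
lemma ae_length_fakeArm (hκ : ∀ i < j, IsFakeData prior N₀ N i (κ i)) :
    ∀ᵐ w ∂(worldLaw prior), w ∈ zeros j N₀ → ∀ i, ∀ᵐ u ∂(volume : Measure unitInterval),
      fakeArm j κ i (samples i N w) u ∈ lists N := by
  have key : ∀ i, ∀ᵐ w ∂(worldLaw prior), arm i w ∈ zeroArm j N₀ i →
      ∀ᵐ u ∂(volume : Measure unitInterval), fakeArm j κ i (samples i N w) u ∈ lists N := by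
    intro i
    by_cases hi : i < j
    · refine (ae_cond_iff (measurableSet_arm_zeroArm i)).1 (Measure.ae_ae_of_ae_prod
        (p := fun p : World K × unitInterval => fakeArm j κ i (samples i N p.1) p.2 ∈ lists N) ?_)
      simp only [fakeArm, if_pos hi]
      rw [ae_iff]
      -- There are countably many lists of a wrong length, and each has probability zero as a fake
      -- list because it has probability zero as a true one.
      refine measure_mono_null (t := ⋃ l : {l : List Bool // l ∉ lists N},
        {p : World K × unitInterval | κ i (samples i N p.1) p.2 = l}) ?_ ?_
      · intro p hp
        exact Set.mem_iUnion.2 ⟨⟨_, hp⟩, rfl⟩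
      · refine measure_iUnion_null fun l => ?_
        rw [← setOf_reward_eq hi, (hκ i hi).law]
        have : {w : World K | samples i N w = l} = ∅ := by
          ext w
          rw [Set.mem_ofPred_eq]
          simp only [Set.mem_empty_iff_false, iff_false]
          intro h
          exact l.2 (h ▸ mem_lists.2 (length_samples i N w))
        rw [this, measure_empty]
    · refine .of_forall fun w _ => .of_forall fun u => ?_
      rw [fakeArm, if_neg hi]
      exact mem_lists.2 (length_samples i N w)
  filter_upwards [ae_all_iff.2 key] with w hw hz i
  exact hw i (mem_zeros_iff.1 hz i)

end

end

section

variable {K : ℕ}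

/-! ### Finitely many seeds -/

/-- Injectivity of `g` means that distinct, hence independent, coordinates are constrained; its left
inverse reindexes the box. -/
lemma seedLaw_real_box (n : ℕ) {g : ℕ → ℕ × ℕ} (hg : Function.Injective g)
    {t : ℕ → Set unitInterval} (ht : ∀ m, MeasurableSet (t m)) :
    seedLaw.real {σ | ∀ m < n, σ (g m) ∈ t m} =
      ∏ m ∈ Finset.range n, (volume : Measure unitInterval).real (t m) := by
  have h := Measure.infinitePi_pi (fun _ : ℕ × ℕ => (volume : Measure unitInterval))
    (s := (Finset.range n).map ⟨g, hg⟩) (t := fun e => t (Function.invFun g e))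
    (fun e _ => ht _)
  have hset : {σ : Seeds | ∀ m < n, σ (g m) ∈ t m} =
      ((((Finset.range n).map ⟨g, hg⟩ : Finset (ℕ × ℕ)) : Set (ℕ × ℕ)).pi
        fun e => t (Function.invFun g e)) := by
    ext σ
    rw [Set.mem_pi, Set.mem_ofPred_eq]
    simp [Function.leftInverse_invFun hg _]
  rw [Measure.real, seedLaw, hset, h, Finset.prod_map, ENNReal.toReal_prod]
  simp only [Function.Embedding.coeFn_mk, Function.leftInverse_invFun hg _]
  rfl

lemma measurableSet_lt_unitInterval (c : ℝ) : MeasurableSet {u : unitInterval | c < u} :=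
  measurableSet_lt measurable_const (by fun_prop)

lemma volume_real_lt {c : ℝ} (hc : c ∈ Set.Icc (0 : ℝ) 1) :
    (volume : Measure unitInterval).real {u : unitInterval | c < u} = 1 - c := by
  have : {u : unitInterval | c < u} = Set.Ioi ⟨c, hc⟩ := by
    ext u
    rw [Set.mem_ofPred_eq, Set.mem_Ioi, ← Subtype.coe_lt_coe]
  rw [this, Measure.real, unitInterval.volume_Ioi, ENNReal.toReal_ofReal]
  linarith [hc.2]

lemma volume_real_le {c : ℝ} (hc : c ∈ Set.Icc (0 : ℝ) 1) :
    (volume : Measure unitInterval).real {u : unitInterval | (u : ℝ) ≤ c} = c := by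
  have : {u : unitInterval | (u : ℝ) ≤ c} = {u : unitInterval | c < u}ᶜ := by
    ext u
    rw [Set.mem_compl_iff, Set.mem_ofPred_eq, Set.mem_ofPred_eq, not_lt]
  rw [this, probReal_compl_eq_one_sub (measurableSet_lt_unitInterval c), volume_real_lt hc]
  ring

lemma seedLaw_real_eval (e : ℕ × ℕ) {B : Set unitInterval} (hB : MeasurableSet B) :
    seedLaw.real {σ | σ e ∈ B} = (volume : Measure unitInterval).real B := by
  have h := (measurePreserving_eval_infinitePi
    (fun _ : ℕ × ℕ => (volume : Measure unitInterval)) e).measureReal_preimage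
    hB.nullMeasurableSet
  exact h

/-- Within one phase the coin, the policy and the fake samples of each arm use different seeds, so
they are independent. -/
lemma seedLaw_real_row (s : ℕ) {A B : Set unitInterval} (hA : MeasurableSet A)
    (hB : MeasurableSet B) {t : Fin K → Set unitInterval} (ht : ∀ i, MeasurableSet (t i)) :
    seedLaw.real {σ | σ (s, 0) ∈ A ∧ σ (s, 1) ∈ B ∧ ∀ i : Fin K, σ (s, 2 + i) ∈ t i} =
      (volume : Measure unitInterval).real A * ((volume : Measure unitInterval).real B *
        ∏ i, (volume : Measure unitInterval).real (t i)) := by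
  set T : ℕ → Set unitInterval := fun m => if m = 0 then A else if m = 1 then B else
    if h : m - 2 < K then t ⟨m - 2, h⟩ else Set.univ with hT
  have h0 : T 0 = A := by simp [hT]
  have h1 : T 1 = B := by simp [hT]
  have h2 : ∀ i : Fin K, T (i + 1 + 1) = t i := fun i => by simp [hT]
  have h := seedLaw_real_box (K + 2) (g := fun m => (s, m)) (fun m m' h => by simpa using h)
    (t := T) (fun m => by
      simp only [hT]
      split_ifs
      · exact hA
      · exact hB
      · exact ht _
      · exact .univ)
  rw [Finset.prod_range_succ', Finset.prod_range_succ', Finset.prod_range] at h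
  simp only [h2, zero_add, h0, h1] at h
  rw [mul_comm, mul_comm (∏ _, _)] at h
  rw [← h]
  congr 1
  ext σ
  rw [Set.mem_ofPred_eq, Set.mem_ofPred_eq]
  constructor
  · rintro ⟨ha, hb, hc⟩ m hm
    rcases m with _ | _ | m
    · rwa [h0]
    · rwa [h1]
    · have := hc ⟨m, by omega⟩
      have h2' := h2 ⟨m, by omega⟩
      simp only at this h2'
      rw [h2']
      convert this using 3
      ring
  · intro hσ
    refine ⟨h0 ▸ hσ 0 (by omega), h1 ▸ hσ 1 (by omega), fun i => ?_⟩
    have := hσ (i + 1 + 1) (by omega)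
    rw [h2] at this
    convert this using 3
    ring

section

variable [NeZero K] {prior : Fin K → Measure unitInterval} {a : Params K}

/-- All coins for the exploration of arm `j` before iteration `n` of its main loop have failed. -/
def coinsFailed (prior : Fin K → Measure unitInterval) (a : Params K) (j : Fin K) (n : ℕ) :
    Set Seeds :=
  {σ | exploreProb prior a.N₀ a.lam j 0 < σ (blockStart prior a j + 1, 0) ∧
    ∀ m < n, coinProb prior a j m < σ (blockStart prior a j + 2 + m, 0)}

lemma measurableSet_coinsFailed (j : Fin K) (n : ℕ) :
    MeasurableSet (coinsFailed prior a j n) := by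
  have : coinsFailed prior a j n =
      (fun σ : Seeds => σ (blockStart prior a j + 1, 0)) ⁻¹'
        {u : unitInterval | exploreProb prior a.N₀ a.lam j 0 < u} ∩
      ⋂ m, ⋂ (_ : m < n), (fun σ : Seeds => σ (blockStart prior a j + 2 + m, 0)) ⁻¹'
        {u : unitInterval | coinProb prior a j m < u} := by
    ext σ
    rw [coinsFailed, Set.mem_ofPred_eq]
    simp only [Set.mem_inter_iff, Set.mem_preimage, Set.mem_iInter]
    rfl
  rw [this]
  have hev : ∀ e : ℕ × ℕ, Measurable fun σ : Seeds => σ e := fun e => measurable_pi_apply e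
  exact (hev _ (measurableSet_lt_unitInterval _)).inter
    (.iInter fun m => .iInter fun _ => hev _ (measurableSet_lt_unitInterval _))

lemma explored_eq_false_iff {j : Fin K} (hj : j ≠ 0) {n : ℕ}
    (hn : n ≤ loopLength prior a.N₀ a.lam j) (ω : World K × Seeds) :
    (stateAt prior a ω (blockStart prior a j + 2 + n)).explored = false ↔
      ω.2 ∈ coinsFailed prior a j n :=
  not_explored_iff hj hn ω

/-- The coins sit in different rows and are independent, and their failure probabilities telescope
by `one_sub_mul_one_sub_coinProb`. The additional seed lies in the row of iteration n, beyond all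
these coins. -/
lemma Params.Admissible.seedLaw_real_coinsFailed (h : a.Admissible prior) {j : Fin K} {n : ℕ}
    (hn : n ≤ loopLength prior a.N₀ a.lam j) (c : ℕ) {B : Set unitInterval}
    (hB : MeasurableSet B) :
    seedLaw.real {σ | σ ∈ coinsFailed prior a j n ∧ σ (blockStart prior a j + 2 + n, c) ∈ B} =
      (1 - exploreProb prior a.N₀ a.lam j n) * (volume : Measure unitInterval).real B := by
  -- Threshold 0 belongs to the second bootstrapping phase, and threshold m + 1 to iteration m of
  -- the loop.
  set q : ℕ → ℝ := fun m => if m = 0 then exploreProb prior a.N₀ a.lam j 0 else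
    coinProb prior a j (m - 1) with hq
  set T : ℕ → Set unitInterval := fun m => if m = n + 1 then B else {u : unitInterval | q m < u}
    with hT
  have hbox := seedLaw_real_box (n + 1 + 1)
    (g := fun m => (blockStart prior a j + 1 + m, if m = n + 1 then c else 0))
    (fun m m' hm => by have := congrArg Prod.fst hm; simpa using this) (t := T) (fun m => by
      simp only [hT]
      split_ifs
      · exact hB
      · exact measurableSet_lt_unitInterval _)
  have hset : {σ : Seeds | σ ∈ coinsFailed prior a j n ∧
      σ (blockStart prior a j + 2 + n, c) ∈ B} = {σ | ∀ m < n + 1 + 1,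
        σ (blockStart prior a j + 1 + m, if m = n + 1 then c else 0) ∈ T m} := by
    ext σ
    rw [Set.mem_ofPred_eq, Set.mem_ofPred_eq, coinsFailed, Set.mem_ofPred_eq]
    constructor
    · rintro ⟨⟨h1, h2⟩, h3⟩ m hm
      by_cases hmn : m = n + 1
      · subst hmn
        simp only [hT, ↓reduceIte]
        convert h3 using 3
        ring
      · rcases m with _ | m
        · simp only [hT, hq, if_neg hmn, ↓reduceIte]
          exact h1
        · simp only [hT, hq, if_neg hmn, if_neg (Nat.succ_ne_zero m), Nat.add_sub_cancel]
          have := h2 m (by omega)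
          rw [show blockStart prior a j + 2 + m = blockStart prior a j + 1 + (m + 1) by ring]
            at this
          exact this
    · intro h1
      refine ⟨⟨?_, fun m hm => ?_⟩, ?_⟩
      · have := h1 0 (by omega)
        simp only [hT, hq, if_neg (Nat.succ_ne_zero n).symm, ↓reduceIte] at this
        exact this
      · have := h1 (m + 1) (by omega)
        have hne : m + 1 ≠ n + 1 := by omega
        simp only [hT, hq, if_neg hne, if_neg (Nat.succ_ne_zero m), Nat.add_sub_cancel] at this
        rw [show blockStart prior a j + 2 + m = blockStart prior a j + 1 + (m + 1) by ring]
        exact this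
      · have := h1 (n + 1) (by omega)
        simp only [hT, ↓reduceIte] at this
        rw [show blockStart prior a j + 2 + n = blockStart prior a j + 1 + (n + 1) by ring]
        exact this
  rw [hset, hbox, Finset.prod_range_succ]
  have hlast : T (n + 1) = B := by simp [hT]
  rw [hlast]
  congr 1
  have key : ∀ k ≤ n, ∏ m ∈ Finset.range (k + 1), (volume : Measure unitInterval).real (T m) =
      1 - exploreProb prior a.N₀ a.lam j k := by
    intro k
    induction k with
    | zero =>
      intro _
      have h0 := h.exploreProb_mem j 0
      have hT0 : T 0 = {u : unitInterval | exploreProb prior a.N₀ a.lam j 0 < u} := by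
        simp [hT, hq]
      rw [Finset.prod_range_one, hT0, volume_real_lt ⟨h0.1.le, h0.2⟩]
    | succ k ih =>
      intro hk
      have hT1 : T (k + 1) = {u : unitInterval | coinProb prior a j k < u} := by
        have : k ≠ n := by omega
        simp [hT, hq, this]
      rw [Finset.prod_range_succ, ih (by omega), hT1, volume_real_lt (h.coinProb_mem (by omega)),
        one_sub_mul_one_sub_coinProb (by omega)]
  exact key n le_rfl

lemma Params.Admissible.seedLaw_real_not_coinsFailed (h : a.Admissible prior) {j : Fin K} {n : ℕ}
    (hn : n ≤ loopLength prior a.N₀ a.lam j) (c : ℕ) {B : Set unitInterval}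
    (hB : MeasurableSet B) :
    seedLaw.real {σ | σ ∉ coinsFailed prior a j n ∧ σ (blockStart prior a j + 2 + n, c) ∈ B} =
      exploreProb prior a.N₀ a.lam j n * (volume : Measure unitInterval).real B := by
  have h1 := h.seedLaw_real_coinsFailed hn c hB
  have h2 := seedLaw_real_eval (blockStart prior a j + 2 + n, c) hB
  have h3 := measureReal_inter_add_sdiff (μ := seedLaw)
    (s := {σ : Seeds | σ (blockStart prior a j + 2 + n, c) ∈ B})
    (measurableSet_coinsFailed (prior := prior) (a := a) j n)
  have e1 : {σ : Seeds | σ (blockStart prior a j + 2 + n, c) ∈ B} ∩ coinsFailed prior a j n =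
      {σ | σ ∈ coinsFailed prior a j n ∧ σ (blockStart prior a j + 2 + n, c) ∈ B} := by
    ext σ; exact and_comm
  have e2 : {σ : Seeds | σ (blockStart prior a j + 2 + n, c) ∈ B} \ coinsFailed prior a j n =
      {σ | σ ∉ coinsFailed prior a j n ∧ σ (blockStart prior a j + 2 + n, c) ∈ B} := by
    ext σ; exact and_comm
  rw [e1, e2, h1, h2] at h3
  linarith

/-! ### Exploitation phases -/

variable [∀ i, IsProbabilityMeasure (prior i)]

omit [NeZero K] in
lemma integral_gap_split {S T : Set (World K × Seeds)} (hT : MeasurableSet T) (i l : Fin K) :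
    ∫ ω in S, ((ω.1.1 i : ℝ) - (ω.1.1 l : ℝ)) ∂((worldLaw prior).prod seedLaw) =
      ∫ ω in S ∩ T, ((ω.1.1 i : ℝ) - (ω.1.1 l : ℝ)) ∂((worldLaw prior).prod seedLaw) +
      ∫ ω in S ∩ Tᶜ, ((ω.1.1 i : ℝ) - (ω.1.1 l : ℝ)) ∂((worldLaw prior).prod seedLaw) := by
  rw [← integral_inter_add_sdiff hT (integrable_gap (μ := fun ω : World K × Seeds => ω.1.1)
    (by fun_prop) i l).integrableOn, Set.sdiff_eq]

omit [NeZero K] in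
lemma integral_gap (i l : Fin K) : ∫ w : World K, ((w.1 i : ℝ) - (w.1 l : ℝ)) ∂(worldLaw prior) =
    priorMean prior i - priorMean prior l := by
  rw [integral_sub (integrable_mean (by fun_prop) i) (integrable_mean (by fun_prop) l),
    integral_mean, integral_mean]

omit [NeZero K] in
/-- The gap on an event that depends on the seeds only. -/
lemma integral_gap_seeds {E : Set Seeds} (hE : MeasurableSet E) (i l : Fin K) :
    ∫ ω in {ω : World K × Seeds | ω.2 ∈ E}, ((ω.1.1 i : ℝ) - (ω.1.1 l : ℝ))
      ∂((worldLaw prior).prod seedLaw) =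
      seedLaw.real E * (priorMean prior i - priorMean prior l) := by
  have hE' : MeasurableSet {ω : World K × Seeds | ω.2 ∈ E} := measurable_snd hE
  rw [setIntegral_prod_fst (g := fun w : World K => (w.1 i : ℝ) - w.1 l) hE'
    (integrable_gap (by fun_prop) i l), ← integral_gap, ← integral_const_mul]
  rfl

omit [∀ i, IsProbabilityMeasure (prior i)] in
/-- The data of the explored arms are their samples. -/
lemma Params.Admissible.take_eq_samples (h : a.Admissible prior) {j : Fin K} {m : ℕ}
    {ω : World K × Seeds} {i : Fin K} (hi : i < j) {n : ℕ} (hn : n ≤ a.N) :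
    ((stateAt prior a ω (blockStart prior a j + m)).data i).take n =
      (samples i a.N ω.1).take n := by
  rw [((h.avail j.2.le (Fin.lt_def.1 hi) ω).mono (Nat.le_add_right _ m)).take_eq hn,
    take_samples i hn]

omit [∀ i, IsProbabilityMeasure (prior i)] in
lemma Params.Admissible.take_eq_samples_of_avail (h : a.Admissible prior) {j : Fin K} {m : ℕ}
    {ω : World K × Seeds} (hA : Avail prior a (blockStart prior a j + m) j ω) {i : Fin K}
    (hi : i ≤ j) {n : ℕ} (hn : n ≤ a.N) :
    ((stateAt prior a ω (blockStart prior a j + m)).data i).take n =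
      (samples i a.N ω.1).take n := by
  rcases hi.lt_or_eq with hi | rfl
  · exact h.take_eq_samples hi hn
  · rw [hA.take_eq hn, take_samples i hn]

/-- Which data are exploited depends on whether arm j has been sampled. This is determined by the
seeds and the samples of earlier arms, so each of the two cases is a legitimate exploitation event.
-/
lemma Params.Admissible.exploitAvailable_gap_nonneg (h : a.Admissible prior) {j : Fin K}
    (hj : j ≠ 0) {m : ℕ} (hm : m ≤ loopLength prior a.N₀ a.lam j + 2)
    {E : Set (World K × Seeds)} (hE : MeasurableSet E)
    (hinv : ∀ w w' σ, (∀ i < j, samples i a.N w = samples i a.N w') → (w, σ) ∈ E → (w', σ) ∈ E)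
    (i l : Fin K) :
    0 ≤ ∫ ω in E ∩ {ω | exploitAvailable prior j a.N
        (stateAt prior a ω (blockStart prior a j + m)).data = i},
      ((ω.1.1 i : ℝ) - (ω.1.1 l : ℝ)) ∂((worldLaw prior).prod seedLaw) := by
  set s := blockStart prior a j + m with hs
  have hX : MeasurableSet {ω | exploitAvailable prior j a.N (stateAt prior a ω s).data = i} :=
    h.measurable_stateAt s
      (.of_discrete (s := {st : State K | exploitAvailable prior j a.N st.data = i}))
  have hA := h.measurableSet_avail s j
  rw [integral_gap_split hA]
  have hiff : ∀ ω : World K × Seeds, (Avail prior a s j ω ∧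
      exploitAvailable prior j a.N (stateAt prior a ω s).data = i ↔ Avail prior a s j ω ∧
      exploit prior (Set.Iic j) a.N (fun k => samples k a.N ω.1) = i) := fun ω => by
    refine and_congr_right fun h1 => ?_
    have h1' : a.N ≤ ((stateAt prior a ω s).data j).length := h1
    rw [exploitAvailable, if_pos h1', exploit_congr prior (S := Set.Iic j) fun k hk =>
      h.take_eq_samples_of_avail h1 hk le_rfl]
  have hiff' : ∀ ω : World K × Seeds, (¬ Avail prior a s j ω ∧
      exploitAvailable prior j a.N (stateAt prior a ω s).data = i ↔ ¬ Avail prior a s j ω ∧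
      exploit prior (Set.Iio j) a.N (fun k => samples k a.N ω.1) = i) := fun ω => by
    refine and_congr_right fun h1 => ?_
    have h1' : ¬ a.N ≤ ((stateAt prior a ω s).data j).length := h1
    rw [exploitAvailable, if_neg h1', exploit_congr prior (S := Set.Iio j) fun k hk =>
      h.take_eq_samples hk le_rfl]
  refine add_nonneg ?_ ?_
  · refine exploit_gap_nonneg prior (Set.Iic j) a.N ((hE.inter hX).inter hA) ?_ ?_ l
    · rintro w w' σ hw ⟨⟨h1, h2⟩, h3⟩
      obtain ⟨-, h4⟩ := (hiff (w, σ)).1 ⟨h3, h2⟩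
      have h5 : Avail prior a s j (w', σ) :=
        (h.avail_congr hj hm fun k hk => hw k (le_of_lt hk)).1 h3
      refine ⟨⟨hinv w w' σ (fun k hk => hw k (le_of_lt hk)) h1,
        ((hiff (w', σ)).2 ⟨h5, ?_⟩).2⟩, h5⟩
      rw [← h4]
      exact exploit_congr prior fun k hk => by simp only [hw k hk]
    · rintro w σ ⟨⟨-, h2⟩, h3⟩
      exact ((hiff (w, σ)).1 ⟨h3, h2⟩).2
  · refine exploit_gap_nonneg prior (Set.Iio j) a.N ((hE.inter hX).inter hA.compl) ?_ ?_ l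
    · rintro w w' σ hw ⟨⟨h1, h2⟩, h3⟩
      obtain ⟨-, h4⟩ := (hiff' (w, σ)).1 ⟨h3, h2⟩
      have h5 : ¬ Avail prior a s j (w', σ) :=
        fun h6 => h3 ((h.avail_congr hj hm fun k hk => hw k hk).2 h6)
      refine ⟨⟨hinv w w' σ (fun k hk => hw k hk) h1, ((hiff' (w', σ)).2 ⟨h5, ?_⟩).2⟩, h5⟩
      rw [← h4]
      exact exploit_congr prior fun k hk => by simp only [hw k hk]
    · rintro w σ ⟨⟨-, h2⟩, h3⟩
      exact ((hiff' (w, σ)).1 ⟨h3, h2⟩).2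

/-- The initial phase is incentive-compatible. -/
lemma Params.Admissible.isBIC_init (h : a.Admissible prior) :
    IsBIC ((worldLaw prior).prod seedLaw) (fun ω => ω.1.1) (armAt prior a 0) := by
  rw [isBIC_iff]
  intro i l
  by_cases hi : i = 0
  · have : {ω | armAt prior a 0 ω = i} = {ω : World K × Seeds | ω.2 ∈ Set.univ} := by
      ext ω
      rw [Set.mem_ofPred_eq, Set.mem_ofPred_eq, armAt_eq, phaseAt_zero, hi]
      simp [choose]
    rw [this, integral_gap_seeds .univ, probReal_univ, one_mul, sub_nonneg, hi]
    exact h.antitone (Fin.zero_le l)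
  · have : {ω | armAt prior a 0 ω = i} = ∅ := by
      ext ω
      rw [Set.mem_ofPred_eq, armAt_eq, phaseAt_zero]
      simp [choose, Ne.symm hi]
    rw [this]
    simp

/-- The first bootstrapping phase is incentive-compatible. -/
lemma Params.Admissible.isBIC_boot₁ (h : a.Admissible prior) {j : Fin K} (hj : j ≠ 0) :
    IsBIC ((worldLaw prior).prod seedLaw) (fun ω => ω.1.1)
      (armAt prior a (blockStart prior a j)) := by
  rw [isBIC_iff]
  intro i l
  have hiff : ∀ ω : World K × Seeds, armAt prior a (blockStart prior a j) ω =
      exploit prior (Set.Iio j) a.N₀ (fun k => samples k a.N₀ ω.1) := fun ω => by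
    rw [armAt_eq, phaseAt_boot₁ hj]
    simp only [choose]
    refine exploit_congr prior fun k hk => ?_
    have := h.take_eq_samples (m := 0) (ω := ω) hk h.N₀_le
    rw [add_zero, take_samples k h.N₀_le] at this
    rw [this, take_samples k le_rfl]
  refine exploit_gap_nonneg prior (Set.Iio j) a.N₀ (h.measurableSet_armAt _ i) ?_ ?_ l
  · intro w w' σ hw h1
    have h1' : armAt prior a (blockStart prior a j) (w, σ) = i := h1
    have : armAt prior a (blockStart prior a j) (w', σ) = i := by
      rw [← h1', hiff, hiff]
      exact exploit_congr prior fun k hk => by simp only [hw k hk]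
    exact this
  · intro w σ h1
    have h1' : armAt prior a (blockStart prior a j) (w, σ) = i := h1
    rw [← h1', hiff]

end

end

section

variable {K : ℕ} [NeZero K] {prior : Fin K → Measure unitInterval} {a : Params K}
  [∀ i, IsProbabilityMeasure (prior i)]

/-! ### The main loop -/

omit [NeZero K] in
lemma IsSuitable.gap_nonneg {j : Fin K} {lam : ℝ} {N : ℕ} {π : Policy K}
    (hπ : IsSuitable prior j lam N π) (i l : Fin K) :
    0 ≤ ∫ p in {p : World K × unitInterval | policyArm π N p = i},
      ((p.1.1 i : ℝ) - (p.1.1 l : ℝ)) ∂((worldLaw prior).prod volume) :=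
  isBIC_iff.1 hπ.bic i l

-- After exploration all arms up to `j` have their first `N` samples recorded, and the policy reads
-- nothing else.
omit [∀ i, IsProbabilityMeasure (prior i)] in
lemma Params.Admissible.armAt_main_of_explored (h : a.Admissible prior) {j : Fin K} (hj : j ≠ 0)
    {n : ℕ} (hn : n < loopLength prior a.N₀ a.lam j) {ω : World K × Seeds}
    (hω : ω.2 ∉ coinsFailed prior a j n) :
    armAt prior a (blockStart prior a j + 2 + n) ω =
      policyArm (a.π j) a.N (ω.1, ω.2 (blockStart prior a j + 2 + n, 1)) := by
  rw [← explored_eq_false_iff hj hn.le, Bool.not_eq_false] at hω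
  have hA := avail_of_explored hj hn.le hω
  rw [armAt_eq, phaseAt_main hj hn]
  simp only [choose, if_pos hω]
  rw [policyArm, (h.suitable j hj).informed _ (fun i => samples i a.N ω.1)]
  intro i hi
  rw [add_assoc] at hA ⊢
  exact h.take_eq_samples_of_avail hA hi le_rfl

omit [∀ i, IsProbabilityMeasure (prior i)] in
lemma armAt_main {j : Fin K} (hj : j ≠ 0) {n : ℕ} (hn : n < loopLength prior a.N₀ a.lam j)
    {ω : World K × Seeds} (hω : ω.2 ∈ coinsFailed prior a j n) :
    armAt prior a (blockStart prior a j + 2 + n) ω =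
      if (ω.2 (blockStart prior a j + 2 + n, 0) : ℝ) ≤ coinProb prior a j n then j else
        exploitAvailable prior j a.N
          (stateAt prior a ω (blockStart prior a j + 2 + n)).data := by
  rw [← explored_eq_false_iff hj hn.le] at hω
  have hω' : ¬ (stateAt prior a ω (blockStart prior a j + 2 + n)).explored = true := by
    rw [hω]; exact Bool.false_ne_true
  rw [armAt_eq, phaseAt_main hj hn]
  by_cases hc : (ω.2 (blockStart prior a j + 2 + n, 0) : ℝ) ≤ coinProb prior a j n
  · have hc' := hc
    rw [coinProb] at hc'
    simp only [choose, if_neg hω', if_pos hc, if_pos hc']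
  · have hc' := hc
    rw [coinProb] at hc'
    simp only [choose, if_neg hω', if_neg hc, if_neg hc']

/-- The gap on the event that the policy for arm `j` is used. -/
lemma Params.Admissible.integral_gap_policy (h : a.Admissible prior) {j : Fin K} (hj : j ≠ 0)
    {n : ℕ} (hn : n < loopLength prior a.N₀ a.lam j) (i l : Fin K) :
    ∫ ω in {ω | armAt prior a (blockStart prior a j + 2 + n) ω = i} ∩
        {ω | ω.2 ∈ coinsFailed prior a j n}ᶜ, ((ω.1.1 i : ℝ) - (ω.1.1 l : ℝ))
      ∂((worldLaw prior).prod seedLaw) = exploreProb prior a.N₀ a.lam j n *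
    ∫ p in {p : World K × unitInterval | policyArm (a.π j) a.N p = i},
      ((p.1.1 i : ℝ) - (p.1.1 l : ℝ)) ∂((worldLaw prior).prod volume) := by
  have hC : MeasurableSet {ω : World K × Seeds | ω.2 ∈ coinsFailed prior a j n} :=
    measurable_snd (measurableSet_coinsFailed j n)
  rw [setIntegral_prod_fst (g := fun w : World K => (w.1 i : ℝ) - w.1 l)
    ((h.measurableSet_armAt _ i).inter hC.compl) (integrable_gap (by fun_prop) i l),
    setIntegral_prod_fst (g := fun w : World K => (w.1 i : ℝ) - w.1 l)
    (measurableSet_policyArm (h.suitable j hj).measurable a.N i)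
    (integrable_gap (by fun_prop) i l), ← integral_const_mul]
  -- For a fixed environment, the seed of the policy is independent of the earlier coins. These
  -- contribute exactly the probability that exploration has happened.
  refine congrArg _ (funext fun w => ?_)
  have hm : MeasurableSet {u : unitInterval | policyArm (a.π j) a.N (w, u) = i} :=
    (h.suitable j hj).measurable (fun k => samples k a.N w) (.of_discrete (s := {i}))
  have := h.seedLaw_real_not_coinsFailed hn.le 1 hm
  rw [← mul_assoc]
  congr 1
  refine Eq.trans (congrArg _ ?_) this
  ext σ
  constructor
  · rintro ⟨h1, h2⟩
    have h1' : armAt prior a (blockStart prior a j + 2 + n) (w, σ) = i := h1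
    rw [h.armAt_main_of_explored hj hn h2] at h1'
    exact ⟨h2, h1'⟩
  · rintro ⟨h1, h2⟩
    exact ⟨(h.armAt_main_of_explored hj hn (ω := (w, σ)) h1).trans h2, h1⟩

omit [NeZero K] [∀ i, IsProbabilityMeasure (prior i)] in
/-- In the main loop, the padding outweighs the exploration. -/
lemma explore_le {j : Fin K} {n : ℕ}
    (hn : n < loopLength prior a.N₀ a.lam j) :
    (1 - exploreProb prior a.N₀ a.lam j n) * coinProb prior a j n ≤
      exploreProb prior a.N₀ a.lam j n * a.lam := by
  have h1 := exploreProb_lt_one hn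
  have h2 : coinProb prior a j n ≤ exploreProb prior a.N₀ a.lam j n /
    (1 - exploreProb prior a.N₀ a.lam j n) * a.lam := min_le_right _ _
  have h3 : 0 < 1 - exploreProb prior a.N₀ a.lam j n := by linarith
  calc _ ≤ (1 - exploreProb prior a.N₀ a.lam j n) * (exploreProb prior a.N₀ a.lam j n /
        (1 - exploreProb prior a.N₀ a.lam j n) * a.lam) :=
      mul_le_mul_of_nonneg_left h2 h3.le
    _ = _ := by field_simp

omit [NeZero K] in
lemma priorMean_sub_ge (i l : Fin K) : -1 ≤ priorMean prior i - priorMean prior l := by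
  have h1 := priorMean_mem prior i
  have h2 := priorMean_mem prior l
  linarith [h1.1, h2.2]

/-- The phases of the main loop are incentive-compatible. -/
lemma Params.Admissible.isBIC_main (h : a.Admissible prior) {j : Fin K} (hj : j ≠ 0) {n : ℕ}
    (hn : n < loopLength prior a.N₀ a.lam j) :
    IsBIC ((worldLaw prior).prod seedLaw) (fun ω => ω.1.1)
      (armAt prior a (blockStart prior a j + 2 + n)) := by
  rw [isBIC_iff]
  intro i l
  set s := blockStart prior a j + 2 + n with hs
  have hC : MeasurableSet {ω : World K × Seeds | ω.2 ∈ coinsFailed prior a j n} :=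
    measurable_snd (measurableSet_coinsFailed j n)
  have hT : MeasurableSet {ω : World K × Seeds | (ω.2 (s, 0) : ℝ) ≤ coinProb prior a j n} :=
    measurableSet_le (by fun_prop) measurable_const
  -- Three pieces: arm `j` is explored now, data are exploited, or exploration has already happened
  -- and the policy is used.
  rw [integral_gap_split hC, integral_gap_split hT, h.integral_gap_policy hj hn]
  have hexploit : 0 ≤ ∫ ω in {ω | armAt prior a s ω = i} ∩
      {ω : World K × Seeds | ω.2 ∈ coinsFailed prior a j n} ∩
      {ω | (ω.2 (s, 0) : ℝ) ≤ coinProb prior a j n}ᶜ, ((ω.1.1 i : ℝ) - (ω.1.1 l : ℝ))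
      ∂((worldLaw prior).prod seedLaw) := by
    have := h.exploitAvailable_gap_nonneg hj (m := 2 + n) (by omega) (hC.inter hT.compl)
      (fun w w' σ _ h => h) i l
    rw [← add_assoc] at this
    convert this using 2
    congr 1
    ext ω
    constructor
    · rintro ⟨⟨h1, h2⟩, h3⟩
      have h1' : armAt prior a s ω = i := h1
      have h3' : ¬ (ω.2 (s, 0) : ℝ) ≤ coinProb prior a j n := h3
      rw [armAt_main hj hn h2, if_neg h3'] at h1'
      exact ⟨⟨h2, h3⟩, h1'⟩
    · rintro ⟨⟨h2, h3⟩, h1⟩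
      have h1' : armAt prior a s ω = i := by
        have h3' : ¬ (ω.2 (s, 0) : ℝ) ≤ coinProb prior a j n := h3
        rw [armAt_main hj hn h2, if_neg h3']
        exact h1
      exact ⟨⟨h1', h2⟩, h3⟩
  have hp := h.exploreProb_mem j n
  have hπ := h.suitable j hj
  by_cases hi : i = j
  · subst hi
    have hset : {ω | armAt prior a s ω = i} ∩
        {ω : World K × Seeds | ω.2 ∈ coinsFailed prior a i n} ∩
        {ω | (ω.2 (s, 0) : ℝ) ≤ coinProb prior a i n} = {ω : World K × Seeds | ω.2 ∈
          {σ | σ ∈ coinsFailed prior a i n ∧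
            σ (s, 0) ∈ {u : unitInterval | (u : ℝ) ≤ coinProb prior a i n}}} := by
      ext ω
      constructor
      · rintro ⟨⟨-, h2⟩, h3⟩
        exact ⟨h2, h3⟩
      · rintro ⟨h2, h3⟩
        have h1' : armAt prior a s ω = i := by
          rw [armAt_main hj hn h2]
          exact if_pos h3
        exact ⟨⟨h1', h2⟩, h3⟩
    have hB : MeasurableSet {u : unitInterval | (u : ℝ) ≤ coinProb prior a i n} :=
      measurableSet_le (by fun_prop) measurable_const
    have hev : Measurable fun σ : Seeds => σ (s, 0) := measurable_pi_apply _
    have hcoin := integral_gap_seeds (prior := prior)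
      ((measurableSet_coinsFailed (prior := prior) (a := a) i n).inter (hev hB)) i l
    have hq := h.seedLaw_real_coinsFailed hn.le 0 hB
    rw [volume_real_le (h.coinProb_mem hn)] at hq
    have hcoin' : ∫ ω in {ω | armAt prior a s ω = i} ∩
        {ω : World K × Seeds | ω.2 ∈ coinsFailed prior a i n} ∩
        {ω | (ω.2 (s, 0) : ℝ) ≤ coinProb prior a i n}, ((ω.1.1 i : ℝ) - (ω.1.1 l : ℝ))
        ∂((worldLaw prior).prod seedLaw) = (1 - exploreProb prior a.N₀ a.lam i n) *
          coinProb prior a i n * (priorMean prior i - priorMean prior l) := by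
      rw [hset, ← hq]
      exact hcoin
    rw [hcoin']
    have h0 : 0 ≤ (1 - exploreProb prior a.N₀ a.lam i n) * coinProb prior a i n :=
      mul_nonneg (by linarith) (h.coinProb_mem hn).1
    -- Against an earlier arm the coin loses at most its probability, and the padding pays for it.
    -- Against a later arm the coin has a nonnegative gap by the order of the prior means.
    by_cases hl : l < i
    · have h1 := mul_le_mul_of_nonneg_left (hπ.padded l hl) hp.1.le
      have h2 := explore_le (prior := prior) hn
      have h3 := mul_le_mul_of_nonneg_left (priorMean_sub_ge (prior := prior) i l) h0
      linarith
    · have h1 := mul_nonneg hp.1.le (hπ.gap_nonneg i l)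
      have h2 := mul_nonneg h0 (sub_nonneg.2 (h.antitone (not_lt.1 hl)))
      linarith
  · have hset : {ω | armAt prior a s ω = i} ∩
        {ω : World K × Seeds | ω.2 ∈ coinsFailed prior a j n} ∩
        {ω | (ω.2 (s, 0) : ℝ) ≤ coinProb prior a j n} = ∅ := by
      rw [Set.eq_empty_iff_forall_notMem]
      rintro ω ⟨⟨h1, h2⟩, h3⟩
      have h1' : armAt prior a s ω = i := h1
      have h3' : (ω.2 (s, 0) : ℝ) ≤ coinProb prior a j n := h3
      rw [armAt_main hj hn h2, if_pos h3'] at h1'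
      exact hi h1'.symm
    rw [hset, Measure.restrict_empty, integral_zero_measure]
    have h1 := mul_nonneg hp.1.le (hπ.gap_nonneg i l)
    linarith

/-! ### The second bootstrapping phase -/

/-- If all samples are `0`, then exploitation means to play the new arm. -/
lemma Params.Admissible.exploit_zeros (h : a.Admissible prior) {j : Fin K} {w : World K}
    (hw : w ∈ zeros j a.N₀) :
    exploit prior (Set.Iio j) a.N₀ (fun k => samples k a.N₀ w) = j := by
  have hag : agrees (Set.Iio j) a.N₀ (fun k => samples k a.N₀ w) = zeros j a.N₀ := by
    ext w'
    refine forall₂_congr fun i hi => ?_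
    have h1 := (reward_zero_iff i a.N₀ w).1 (hw i hi)
    rw [reward_zero_iff, take_samples i le_rfl, h1]
  have hint : ∀ k, Integrable (fun w : World K => (w.1 k : ℝ))
      (ProbabilityTheory.cond (worldLaw prior) (zeros j a.N₀)) := fun k =>
    integrable_mean (by fun_prop) k
  have hge : ∀ k, j ≤ k → posteriorMean prior (Set.Iio j) a.N₀ (fun k => samples k a.N₀ w) k =
      priorMean prior k := fun k hk => by
    rw [posteriorMean, hag, integral_cond_eq, setIntegral_zeros_of_le prior hk, mul_comm,
      mul_assoc, mul_inv_cancel₀ (h.zeros_pos j).ne', mul_one]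
  have hlt : ∀ i < j, posteriorMean prior (Set.Iio j) a.N₀ (fun k => samples k a.N₀ w) i <
      posteriorMean prior (Set.Iio j) a.N₀ (fun k => samples k a.N₀ w) j := fun i hi => by
    have h1 := h.boot j i hi
    rw [integral_sub (hint j) (hint i), sub_pos] at h1
    rwa [posteriorMean, posteriorMean, hag]
  -- Earlier arms are strictly worse by the choice of `N₀`. Later arms keep their prior means and
  -- can at best tie, and a tie goes to the smaller index.
  refine argmaxArm_eq hlt fun l => ?_
  by_cases hl : l < j
  · exact (hlt l hl).le
  · rw [hge l (not_lt.1 hl), hge j le_rfl]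
    exact h.antitone (not_lt.1 hl)

/-- After zeros the first bootstrapping phase plays arm j. This supplies the true samples of arm j
that the transformed policy needs. -/
lemma Params.Admissible.avail_of_zeros (h : a.Admissible prior) {j : Fin K} (hj : j ≠ 0)
    {ω : World K × Seeds} (hω : ω.1 ∈ zeros j a.N₀) :
    Avail prior a (blockStart prior a j + 1) j ω := by
  refine avail_succ_of_eq ?_
  rw [armAt_eq, phaseAt_boot₁ hj]
  simp only [choose]
  refine Eq.trans (exploit_congr prior (d' := fun k => samples k a.N₀ ω.1) fun k hk => ?_)
    (h.exploit_zeros hω)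
  have := h.take_eq_samples (m := 0) (ω := ω) hk h.N₀_le
  rw [add_zero, take_samples k h.N₀_le] at this
  rw [this, take_samples k le_rfl]

/-! ### The recommendation based on fake data -/

/-- The recommendation of the policy for arm `j`, applied to fake data. -/
noncomputable def fakePolicyArm (a : Params K) (j : Fin K) (s : ℕ) (ω : World K × Seeds) : Fin K :=
  a.π j (fun i => fakeArm j (a.κ j) i (samples i a.N ω.1) (ω.2 (s, 2 + i))) (ω.2 (s, 1))

omit [∀ i, IsProbabilityMeasure (prior i)] in
lemma Params.Admissible.measurable_fakeArm (h : a.Admissible prior) (j i : Fin K)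
    (l : List Bool) : Measurable (fakeArm j (a.κ j) i l) := by
  unfold fakeArm
  split_ifs with hi
  · exact (h.fake j i hi).measurable_apply l
  · exact measurable_const

omit [∀ i, IsProbabilityMeasure (prior i)] in
lemma Params.Admissible.measurable_fakePolicyArm (h : a.Admissible prior) {j : Fin K}
    (hj : j ≠ 0) (s : ℕ) : Measurable (fakePolicyArm a j s) := by
  have hd : ∀ i : Fin K, Measurable fun ω : World K × Seeds =>
      fakeArm j (a.κ j) i (samples i a.N ω.1) (ω.2 (s, 2 + (i : ℕ))) := fun i => by
    have h1 : Measurable fun p : List Bool × unitInterval => fakeArm j (a.κ j) i p.1 p.2 :=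
      measurable_from_prod_countable_right fun l => h.measurable_fakeArm j i l
    have h2 : Measurable fun ω : World K × Seeds => (samples i a.N ω.1, ω.2 (s, 2 + (i : ℕ))) :=
      ((measurable_samples i a.N).comp measurable_fst).prodMk (by fun_prop)
    have hc := h1.comp h2
    exact hc
  have hu : Measurable fun ω : World K × Seeds => ω.2 (s, 1) := by fun_prop
  have hc := (h.suitable j hj).measurable_comp (measurable_pi_lambda _ hd) hu
  exact hc

/-- The four cases of the partition used for the second bootstrapping phase. After zeros the
recorded data can be replaced by true samples, because arm j is already available. -/
lemma Params.Admissible.armAt_boot₂ (h : a.Admissible prior) {j : Fin K} (hj : j ≠ 0)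
    (ω : World K × Seeds) :
    (ω.2 (blockStart prior a j + 1, 0) ≤ exploreProb prior a.N₀ a.lam j 0 →
      armAt prior a (blockStart prior a j + 1) ω = j) ∧
    (¬ ω.2 (blockStart prior a j + 1, 0) ≤ exploreProb prior a.N₀ a.lam j 0 →
      ω.1 ∉ zeros j a.N₀ → armAt prior a (blockStart prior a j + 1) ω =
        exploitAvailable prior j a.N (stateAt prior a ω (blockStart prior a j + 1)).data) ∧
    (¬ ω.2 (blockStart prior a j + 1, 0) ≤ exploreProb prior a.N₀ a.lam j 0 →
      ω.1 ∈ zeros j a.N₀ → fakePolicyArm a j (blockStart prior a j + 1) ω = j →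
      armAt prior a (blockStart prior a j + 1) ω = j) ∧
    (¬ ω.2 (blockStart prior a j + 1, 0) ≤ exploreProb prior a.N₀ a.lam j 0 →
      ω.1 ∈ zeros j a.N₀ → fakePolicyArm a j (blockStart prior a j + 1) ω ≠ j →
      armAt prior a (blockStart prior a j + 1) ω =
        exploit prior (Set.Iic j) a.N fun k => samples k a.N ω.1) := by
  have hz : (∀ i < j, ∀ x ∈ ((stateAt prior a ω (blockStart prior a j + 1)).data i).take a.N₀,
      x = false) ↔ ω.1 ∈ zeros j a.N₀ := by
    refine forall₂_congr fun i hi => ?_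
    rw [h.take_eq_samples hi h.N₀_le, take_samples i h.N₀_le]
    simp [samples]
  have hF : ω.1 ∈ zeros j a.N₀ → a.π j (fun i => if i < j then a.κ j i
      (((stateAt prior a ω (blockStart prior a j + 1)).data i).take a.N)
        (ω.2 (blockStart prior a j + 1, 2 + i))
      else (stateAt prior a ω (blockStart prior a j + 1)).data i)
      (ω.2 (blockStart prior a j + 1, 1)) =
      fakePolicyArm a j (blockStart prior a j + 1) ω := by
    intro hω
    rw [fakePolicyArm, (h.suitable j hj).informed]
    intro i hi
    have hd := h.take_eq_samples_of_avail (h.avail_of_zeros hj hω) hi le_rfl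
    simp only [fakeArm]
    split_ifs
    · rw [hd, take_samples i le_rfl]
    · exact hd
  rw [armAt_eq, phaseAt_boot₂ hj]
  simp only [choose]
  refine ⟨fun h1 => by rw [if_pos h1], fun h1 h2 => by rw [if_neg h1, if_neg (mt hz.1 h2)],
    fun h1 h2 h3 => ?_, fun h1 h2 h3 => ?_⟩
  · rw [if_neg h1, if_pos (hz.2 h2), transform, hF h2, if_pos h3]
  · rw [if_neg h1, if_pos (hz.2 h2), transform, hF h2, if_neg h3]
    exact exploit_congr prior fun i hi =>
      h.take_eq_samples_of_avail (h.avail_of_zeros hj h2) hi le_rfl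

lemma measureReal_eq_sum_of_ae_mem {Ω ι : Type*} [MeasurableSpace Ω] {P : Measure Ω}
    [IsFiniteMeasure P] {D : Ω → ι} {F : Finset ι} (hD : ∀ᵐ ω ∂P, D ω ∈ F) {S : Set Ω}
    (hS : ∀ f ∈ F, MeasurableSet {ω | ω ∈ S ∧ D ω = f}) :
    P.real S = ∑ f ∈ F, P.real {ω | ω ∈ S ∧ D ω = f} := by
  rw [← measureReal_biUnion_finset _ hS]
  · refine measureReal_congr ?_
    filter_upwards [hD] with ω hω
    refine propext ⟨fun h1 => ?_, fun h1 => ?_⟩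
    · exact Set.mem_biUnion hω ⟨h1, rfl⟩
    · obtain ⟨f, _, h2⟩ := Set.mem_iUnion₂.1 h1
      exact h2.1
  · intro f _ f' _ hff
    rw [Function.onFun, Set.disjoint_left]
    exact fun ω h1 h2 => hff (h1.2.symm.trans h2.2)

/-- The event that arm `j` is recommended by the transformed policy because of the fake data. -/
def fakeEvent (prior : Fin K → Measure unitInterval) (a : Params K) (j : Fin K) (s : ℕ) :
    Set (World K × Seeds) :=
  {ω | ¬ (ω.2 (s, 0) : ℝ) ≤ exploreProb prior a.N₀ a.lam j 0 ∧ ω.1 ∈ zeros j a.N₀ ∧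
    fakePolicyArm a j s ω = j}

omit [∀ i, IsProbabilityMeasure (prior i)] in
lemma Params.Admissible.measurableSet_fakeEvent (h : a.Admissible prior) {j : Fin K}
    (hj : j ≠ 0) (s : ℕ) : MeasurableSet (fakeEvent prior a j s) := by
  have h1 : MeasurableSet {ω : World K × Seeds |
      (ω.2 (s, 0) : ℝ) ≤ exploreProb prior a.N₀ a.lam j 0} :=
    measurableSet_le (by fun_prop) measurable_const
  have h2 : MeasurableSet {ω : World K × Seeds | ω.1 ∈ zeros j a.N₀} :=
    measurable_fst (measurableSet_zeros j a.N₀)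
  have h3 : MeasurableSet {ω : World K × Seeds | fakePolicyArm a j s ω = j} :=
    h.measurable_fakePolicyArm hj s (.of_discrete (s := {j}))
  exact h1.compl.inter (h2.inter h3)

/-- For a fixed environment the fake lists of different arms use different seeds, so the probability
factorizes once their values are fixed. The exceptional null set comes from fake lists of a wrong
length. -/
lemma Params.Admissible.seedLaw_real_fakeEvent (h : a.Admissible prior) {j : Fin K} (hj : j ≠ 0)
    (s : ℕ) : ∀ᵐ w ∂(worldLaw prior), seedLaw.real {σ | (w, σ) ∈ fakeEvent prior a j s} =
      (1 - exploreProb prior a.N₀ a.lam j 0) *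
        ∑ f ∈ Fintype.piFinset fun _ : Fin K => lists a.N,
          (volume : Measure unitInterval).real {u | a.π j f u = j} *
            ∏ m, fakeWeight j a.N₀ a.N (a.κ j) m (f m) (arm m w) := by
  filter_upwards [ae_length_fakeArm (N := a.N) (h.fake j)] with w hw
  by_cases hz : w ∈ zeros j a.N₀
  · have hae : ∀ᵐ σ ∂seedLaw, (fun i : Fin K => fakeArm j (a.κ j) i (samples i a.N w)
        (σ (s, 2 + i))) ∈ Fintype.piFinset fun _ : Fin K => lists a.N := by
      have : ∀ i : Fin K, ∀ᵐ σ ∂seedLaw,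
          fakeArm j (a.κ j) i (samples i a.N w) (σ (s, 2 + i)) ∈ lists a.N := fun i =>
        (measurePreserving_eval_infinitePi (fun _ : ℕ × ℕ => (volume : Measure unitInterval))
          (s, 2 + (i : ℕ))).quasiMeasurePreserving.ae (hw hz i)
      filter_upwards [ae_all_iff.2 this] with σ hσ
      exact Fintype.mem_piFinset.2 hσ
    have hset : ∀ f : Fin K → List Bool, {σ | σ ∈ {σ | (w, σ) ∈ fakeEvent prior a j s} ∧
        (fun i : Fin K => fakeArm j (a.κ j) i (samples i a.N w) (σ (s, 2 + i))) = f} =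
        {σ : Seeds | σ (s, 0) ∈ {u : unitInterval | exploreProb prior a.N₀ a.lam j 0 < u} ∧
          σ (s, 1) ∈ {u | a.π j f u = j} ∧ ∀ i : Fin K, σ (s, 2 + i) ∈
            {u | fakeArm j (a.κ j) i (samples i a.N w) u = f i}} := by
      intro f
      ext σ
      constructor
      · rintro ⟨⟨h1, _, h3⟩, h4⟩
        refine ⟨not_le.1 h1, ?_, fun i => congrFun h4 i⟩
        rw [← h4]
        exact h3
      · rintro ⟨h1, h2, h3⟩
        have h4 : (fun i : Fin K => fakeArm j (a.κ j) i (samples i a.N w) (σ (s, 2 + i))) = f :=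
          funext h3
        have h5 : fakePolicyArm a j s (w, σ) = j := by
          simp only [fakePolicyArm, h4]
          exact h2
        exact ⟨⟨not_le.2 h1, hz, h5⟩, h4⟩
    have hm1 : ∀ f, MeasurableSet {u | a.π j f u = j} := fun f =>
      (h.suitable j hj).measurable f (.of_discrete (s := {j}))
    have hm2 : ∀ (f : Fin K → List Bool) i,
        MeasurableSet {u | fakeArm j (a.κ j) i (samples i a.N w) u = f i} := fun f i =>
      h.measurable_fakeArm j i _ (.of_discrete (s := {f i}))
    have hmE : MeasurableSet {σ | (w, σ) ∈ fakeEvent prior a j s} :=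
      measurable_prodMk_left (h.measurableSet_fakeEvent hj s)
    have hmD : Measurable fun (σ : Seeds) (i : Fin K) =>
        fakeArm j (a.κ j) i (samples i a.N w) (σ (s, 2 + i)) :=
      measurable_pi_lambda _ fun i => (h.measurable_fakeArm j i _).comp (measurable_pi_apply _)
    rw [measureReal_eq_sum_of_ae_mem hae fun f _ => hmE.inter (hmD (.of_discrete (s := {f}))),
      Finset.mul_sum]
    refine Finset.sum_congr rfl fun f _ => ?_
    have h0 := h.exploreProb_mem j 0
    rw [hset, seedLaw_real_row s (measurableSet_lt_unitInterval _) (hm1 f) (hm2 f),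
      volume_real_lt ⟨h0.1.le, h0.2⟩]
    congr 2
    refine Finset.prod_congr rfl fun i _ => ?_
    rw [fakeWeight, if_pos (mem_zeros_iff.1 hz i)]
    rfl
  · have hemp : {σ | (w, σ) ∈ fakeEvent prior a j s} = ∅ := by
      rw [Set.eq_empty_iff_forall_notMem]
      exact fun σ h1 => hz h1.2.1
    rw [hemp, measureReal_empty, Finset.sum_eq_zero, mul_zero]
    intro f _
    rw [mem_zeros_iff, not_forall] at hz
    obtain ⟨i, hi⟩ := hz
    rw [Finset.prod_eq_zero (Finset.mem_univ i), mul_zero]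
    rw [fakeWeight, if_neg hi]

lemma Params.Admissible.integral_fakeEvent_ge (h : a.Admissible prior) {j : Fin K} (hj : j ≠ 0)
    (s : ℕ) (l : Fin K) :
    (1 - exploreProb prior a.N₀ a.lam j 0) * ((worldLaw prior).real (zeros j a.N₀) *
      ∫ p in {p : World K × unitInterval | policyArm (a.π j) a.N p = j},
        ((p.1.1 j : ℝ) - (p.1.1 l : ℝ)) ∂((worldLaw prior).prod volume)) ≤
    ∫ ω in fakeEvent prior a j s, ((ω.1.1 j : ℝ) - (ω.1.1 l : ℝ))
      ∂((worldLaw prior).prod seedLaw) := by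
  have h0 := h.exploreProb_mem j 0
  rw [setIntegral_prod_fst (g := fun w : World K => (w.1 j : ℝ) - w.1 l)
    (h.measurableSet_fakeEvent hj s) (integrable_gap (by fun_prop) j l)]
  have hint : ∀ f : Fin K → List Bool, Integrable (fun w : World K =>
      (∏ m, fakeWeight j a.N₀ a.N (a.κ j) m (f m) (arm m w)) * ((w.1 j : ℝ) - w.1 l))
      (worldLaw prior) := fun f => by
    refine Integrable.bdd_mul (c := 1) (integrable_gap (by fun_prop) j l)
      (Measurable.aestronglyMeasurable (by fun_prop)) (.of_forall fun w => ?_)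
    rw [Real.norm_eq_abs, Finset.abs_prod]
    refine Finset.prod_le_one (fun m _ => abs_nonneg _) fun m _ => ?_
    have := fakeWeight_mem j a.N₀ a.N (a.κ j) m (f m) (arm m w)
    rw [abs_of_nonneg this.1]
    exact this.2
  have e : ∫ w, seedLaw.real {o | (w, o) ∈ fakeEvent prior a j s} * ((w.1 j : ℝ) - w.1 l)
      ∂(worldLaw prior) = (1 - exploreProb prior a.N₀ a.lam j 0) *
      ∑ f ∈ Fintype.piFinset fun _ : Fin K => lists a.N,
        (volume : Measure unitInterval).real {u | a.π j f u = j} *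
        ∫ w, (∏ m, fakeWeight j a.N₀ a.N (a.κ j) m (f m) (arm m w)) * ((w.1 j : ℝ) - w.1 l)
          ∂(worldLaw prior) := by
    simp_rw [← integral_const_mul]
    rw [← integral_finsetSum _ fun f _ => (hint f).const_mul _, ← integral_const_mul]
    refine integral_congr_ae ?_
    filter_upwards [h.seedLaw_real_fakeEvent hj s] with w hw
    rw [hw, mul_assoc, Finset.sum_mul]
    simp_rw [mul_assoc]
  rw [e]
  refine mul_le_mul_of_nonneg_left ?_ (by linarith [h0.2])
  exact sum_fakeWeight_ge h.N₀_le (h.zeros_pos j) (h.fake j) (h.suitable j hj).measurable l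

/-- The second bootstrapping phase is incentive-compatible. -/
lemma Params.Admissible.isBIC_boot₂ (h : a.Admissible prior) {j : Fin K} (hj : j ≠ 0) :
    IsBIC ((worldLaw prior).prod seedLaw) (fun ω => ω.1.1)
      (armAt prior a (blockStart prior a j + 1)) := by
  rw [isBIC_iff]
  intro i l
  set s := blockStart prior a j + 1 with hs
  have hT : MeasurableSet {ω : World K × Seeds |
      (ω.2 (s, 0) : ℝ) ≤ exploreProb prior a.N₀ a.lam j 0} :=
    measurableSet_le (by fun_prop) measurable_const
  have hZ : MeasurableSet {ω : World K × Seeds | ω.1 ∈ zeros j a.N₀} :=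
    measurable_fst (measurableSet_zeros j a.N₀)
  have hP : MeasurableSet {ω : World K × Seeds | fakePolicyArm a j s ω = j} :=
    h.measurable_fakePolicyArm hj s (.of_discrete (s := {j}))
  have hzinv : ∀ {w w' : World K}, (∀ i < j, samples i a.N w = samples i a.N w') →
      (w ∈ zeros j a.N₀ ↔ w' ∈ zeros j a.N₀) := fun hw =>
    forall₂_congr fun i hi => by
      rw [reward_zero_iff, reward_zero_iff, samples_congr h.N₀_le (hw i hi)]
  -- Four pieces: the coin explores, no zeros were observed, the fake data point to arm `j`, or they
  -- do not.
  rw [integral_gap_split hT, integral_gap_split (S := _ ∩ _ᶜ) hZ,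
    integral_gap_split (S := _ ∩ _ᶜ ∩ {ω | ω.1 ∈ zeros j a.N₀}) hP]
  have hexploit : 0 ≤ ∫ ω in {ω | armAt prior a s ω = i} ∩
      {ω : World K × Seeds | (ω.2 (s, 0) : ℝ) ≤ exploreProb prior a.N₀ a.lam j 0}ᶜ ∩
      {ω | ω.1 ∈ zeros j a.N₀}ᶜ, ((ω.1.1 i : ℝ) - (ω.1.1 l : ℝ))
      ∂((worldLaw prior).prod seedLaw) := by
    have := h.exploitAvailable_gap_nonneg hj (m := 1) (by omega) (hT.compl.inter hZ.compl)
      (fun w w' σ hw h1 => ⟨h1.1, fun h2 => h1.2 ((hzinv hw).2 h2)⟩) i l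
    convert this using 2
    congr 1
    ext ω
    constructor
    · rintro ⟨⟨h1, h2⟩, h3⟩
      exact ⟨⟨h2, h3⟩, ((h.armAt_boot₂ hj ω).2.1 h2 h3).symm.trans h1⟩
    · rintro ⟨⟨h2, h3⟩, h1⟩
      exact ⟨⟨((h.armAt_boot₂ hj ω).2.1 h2 h3).trans h1, h2⟩, h3⟩
  -- When the fake data reject arm `j`, this is decided by the true samples of the arms up to `j`
  -- and by seeds, so the exploitation that follows is harmless.
  have htransform : 0 ≤ ∫ ω in {ω | armAt prior a s ω = i} ∩
      {ω : World K × Seeds | (ω.2 (s, 0) : ℝ) ≤ exploreProb prior a.N₀ a.lam j 0}ᶜ ∩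
      {ω | ω.1 ∈ zeros j a.N₀} ∩ {ω | fakePolicyArm a j s ω = j}ᶜ,
      ((ω.1.1 i : ℝ) - (ω.1.1 l : ℝ)) ∂((worldLaw prior).prod seedLaw) := by
    refine exploit_gap_nonneg prior (Set.Iic j) a.N
      ((((h.measurableSet_armAt s i).inter hT.compl).inter hZ).inter hP.compl) ?_ ?_ l
    · rintro w w' σ hw ⟨⟨⟨h1, h2⟩, h3⟩, h4⟩
      have h3' : w' ∈ zeros j a.N₀ := (hzinv fun k hk => hw k (le_of_lt hk)).1 h3
      have h4' : fakePolicyArm a j s (w', σ) ≠ j := by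
        have : fakePolicyArm a j s (w', σ) = fakePolicyArm a j s (w, σ) := by
          rw [fakePolicyArm, fakePolicyArm, (h.suitable j hj).informed]
          intro k hk
          simp only [hw k hk]
        rw [this]
        exact h4
      refine ⟨⟨⟨?_, h2⟩, h3'⟩, h4'⟩
      refine ((h.armAt_boot₂ hj (w', σ)).2.2.2 h2 h3' h4').trans ?_
      refine Eq.trans ?_ (((h.armAt_boot₂ hj (w, σ)).2.2.2 h2 h3 h4).symm.trans h1)
      exact exploit_congr prior fun k hk => by simp only [hw k hk]
    · rintro w σ ⟨⟨⟨h1, h2⟩, h3⟩, h4⟩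
      exact ((h.armAt_boot₂ hj (w, σ)).2.2.2 h2 h3 h4).symm.trans h1
  have h0 := h.exploreProb_mem j 0
  have hπ := h.suitable j hj
  by_cases hi : i = j
  · subst hi
    have hset1 : {ω | armAt prior a s ω = i} ∩
        {ω : World K × Seeds | (ω.2 (s, 0) : ℝ) ≤ exploreProb prior a.N₀ a.lam i 0} =
        {ω : World K × Seeds | ω.2 ∈ {σ : Seeds | σ (s, 0) ∈
          {u : unitInterval | (u : ℝ) ≤ exploreProb prior a.N₀ a.lam i 0}}} := by
      ext ω
      constructor
      · exact fun h1 => h1.2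
      · exact fun h1 => ⟨(h.armAt_boot₂ hj ω).1 h1, h1⟩
    have hset2 : {ω | armAt prior a s ω = i} ∩
        {ω : World K × Seeds | (ω.2 (s, 0) : ℝ) ≤ exploreProb prior a.N₀ a.lam i 0}ᶜ ∩
        {ω | ω.1 ∈ zeros i a.N₀} ∩ {ω | fakePolicyArm a i s ω = i} =
        fakeEvent prior a i s := by
      ext ω
      constructor
      · rintro ⟨⟨⟨-, h2⟩, h3⟩, h4⟩
        exact ⟨h2, h3, h4⟩
      · rintro ⟨h2, h3, h4⟩
        exact ⟨⟨⟨(h.armAt_boot₂ hj ω).2.2.1 h2 h3 h4, h2⟩, h3⟩, h4⟩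
    have hB : MeasurableSet {u : unitInterval | (u : ℝ) ≤ exploreProb prior a.N₀ a.lam i 0} :=
      measurableSet_le (by fun_prop) measurable_const
    have hev : Measurable fun σ : Seeds => σ (s, 0) := measurable_pi_apply _
    have hE : MeasurableSet {σ : Seeds | σ (s, 0) ∈
        {u : unitInterval | (u : ℝ) ≤ exploreProb prior a.N₀ a.lam i 0}} := hev hB
    rw [hset1, hset2, integral_gap_seeds hE, seedLaw_real_eval _ hB,
      volume_real_le ⟨h0.1.le, h0.2⟩]
    have hfake := h.integral_fakeEvent_ge hj s l
    have hz := h.zeros_pos i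
    by_cases hl : l < i
    · have h1 := mul_le_mul_of_nonneg_left (mul_le_mul_of_nonneg_left (hπ.padded l hl) hz.le)
        (show 0 ≤ 1 - exploreProb prior a.N₀ a.lam i 0 by linarith [h0.2])
      -- The choice p_0 = q/(1 + q) solves (1 - p_0) q = p_0: the guaranteed gain from the fake data
      -- equals the largest possible loss from the coin.
      have h2 : (1 - exploreProb prior a.N₀ a.lam i 0) *
          ((worldLaw prior).real (zeros i a.N₀) * a.lam) =
          exploreProb prior a.N₀ a.lam i 0 := by
        have hq := mul_pos h.lam_pos hz
        rw [exploreProb]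
        field_simp
        ring
      have h3 := mul_le_mul_of_nonneg_left (priorMean_sub_ge (prior := prior) i l) h0.1.le
      linarith
    · have h1 := mul_nonneg (show 0 ≤ 1 - exploreProb prior a.N₀ a.lam i 0 by linarith [h0.2])
        (mul_nonneg hz.le (hπ.gap_nonneg i l))
      have h2 := mul_nonneg h0.1.le (sub_nonneg.2 (h.antitone (not_lt.1 hl)))
      linarith
  · have hset1 : {ω | armAt prior a s ω = i} ∩
        {ω : World K × Seeds | (ω.2 (s, 0) : ℝ) ≤ exploreProb prior a.N₀ a.lam j 0} = ∅ := by
      rw [Set.eq_empty_iff_forall_notMem]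
      rintro ω ⟨h1, h2⟩
      exact hi (Eq.trans (Eq.symm h1) ((h.armAt_boot₂ hj ω).1 h2))
    have hset2 : {ω | armAt prior a s ω = i} ∩
        {ω : World K × Seeds | (ω.2 (s, 0) : ℝ) ≤ exploreProb prior a.N₀ a.lam j 0}ᶜ ∩
        {ω | ω.1 ∈ zeros j a.N₀} ∩ {ω | fakePolicyArm a j s ω = j} = ∅ := by
      rw [Set.eq_empty_iff_forall_notMem]
      rintro ω ⟨⟨⟨h1, h2⟩, h3⟩, h4⟩
      exact hi (Eq.trans (Eq.symm h1) ((h.armAt_boot₂ hj ω).2.2.1 h2 h3 h4))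
    rw [hset1, hset2, Measure.restrict_empty, integral_zero_measure]
    linarith

/-- Every round of the algorithm is incentive-compatible. -/
lemma Params.Admissible.isBIC (h : a.Admissible prior) {t : ℕ}
    (ht : t < horizon prior a.N a.N₀ a.lam) :
    IsBIC ((worldLaw prior).prod seedLaw) (fun ω => ω.1.1) (recommendation prior a t) := by
  have hs : t / a.N < (schedule prior a.N₀ a.lam).length :=
    Nat.div_lt_of_lt_mul (by rwa [mul_comm])
  change IsBIC _ _ (armAt prior a (t / a.N))
  rcases exists_block hs with h0 | ⟨j, hj, m, hm, h1⟩
  · rw [h0]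
    exact h.isBIC_init
  · rw [h1]
    rcases m with _ | _ | n
    · exact h.isBIC_boot₁ hj
    · exact h.isBIC_boot₂ hj
    · rw [show blockStart prior a j + (n + 1 + 1) = blockStart prior a j + 2 + n by ring]
      exact h.isBIC_main hj (by omega)

end

/-! ### The choice of the constants -/

/-- Since log G⁻¹ ≥ 1, the hypothesis with C ≥ 4 gives N ≥ (2/G)². Half of the padding gap therefore
survives the estimation error. -/
lemma one_div_sqrt_le {G C N : ℝ} (hG : 0 < G) (hG4 : G ≤ 1 / 4) (hC : 4 ≤ C)
    (hN : C * G⁻¹ ^ 2 * Real.log G⁻¹ ≤ N) : 0 < N ∧ 1 / √N ≤ G / 2 := by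
  have h4 : (4 : ℝ) ≤ G⁻¹ := by
    rw [le_inv_comm₀ (by norm_num) hG]
    linarith
  have hlog : 1 ≤ Real.log G⁻¹ := by
    have h1 := Real.log_le_log (by norm_num) h4
    have h2 : Real.log 4 = 2 * Real.log 2 := by
      rw [show (4 : ℝ) = 2 ^ 2 by norm_num, Real.log_pow]
      norm_num
    linarith [Real.log_two_gt_d9]
  have hsq : (2 * G⁻¹) ^ 2 ≤ N := by
    have h1 : 4 * G⁻¹ ^ 2 ≤ C * G⁻¹ ^ 2 := by gcongr
    have h2 : C * G⁻¹ ^ 2 * 1 ≤ C * G⁻¹ ^ 2 * Real.log G⁻¹ := by gcongr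
    linarith
  have hpos : 0 < 2 * G⁻¹ := by positivity
  refine ⟨(pow_pos hpos 2).trans_le hsq, ?_⟩
  have h1 : 2 * G⁻¹ ≤ √N := Real.le_sqrt_of_sq_le hsq
  calc 1 / √N ≤ 1 / (2 * G⁻¹) := one_div_le_one_div_of_le hpos h1
    _ = G / 2 := by field_simp

end IncentivizedExploration


/-! ### The theorem -/

theorem theorem4p4 :
    ∃ C₀ > (0 : ℝ), ∃ C > (0 : ℝ), ∀ Cpad ≥ C₀,
      ∀ (K : ℕ) [NeZero K] (prior : Fin K → MeasureTheory.Measure unitInterval)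
        [∀ i, MeasureTheory.IsProbabilityMeasure (prior i)] (N : ℕ),
        2 ≤ K →
        Antitone (IncentivizedExploration.priorMean prior) →
        IncentivizedExploration.PairwiseNonDominance prior →
        IncentivizedExploration.Nboot prior ≤ N →
        IncentivizedExploration.Npad Cpad prior ≤ (N : ℝ) →
        -- the parameters are well-defined
        (0 < IncentivizedExploration.Gpad prior ∧
          (IncentivizedExploration.bootSet prior).Nonempty ∧
          0 < IncentivizedExploration.pboot prior) ∧
        -- suitable policies, and the couplings that define their transforms, exist
        (∃ π : Fin K → IncentivizedExploration.Policy K, ∀ j, j ≠ 0 →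
          IncentivizedExploration.IsSuitable prior j
            (IncentivizedExploration.Gpad prior / 10) N (π j)) ∧
        (∃ κ : Fin K → Fin K → List Bool → unitInterval → List Bool, ∀ j, ∀ i < j,
          IncentivizedExploration.IsFakeData prior
            (IncentivizedExploration.Nboot prior) N i (κ j i)) ∧
        -- the number of rounds
        (IncentivizedExploration.horizon prior N (IncentivizedExploration.Nboot prior)
            (IncentivizedExploration.Gpad prior / 10) : ℝ) ≤
          C * K * N * (IncentivizedExploration.Gpad prior)⁻¹ *
            Real.log ((IncentivizedExploration.Gpad prior)⁻¹ *
              (IncentivizedExploration.pboot prior)⁻¹) ∧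
        -- the guarantees, for any suitable policies and any such couplings
        ∀ a : IncentivizedExploration.Params K,
          a.N = N →
          a.N₀ = IncentivizedExploration.Nboot prior →
          a.lam = IncentivizedExploration.Gpad prior / 10 →
          (∀ j, j ≠ 0 → IncentivizedExploration.IsSuitable prior j a.lam a.N (a.π j)) →
          (∀ j, ∀ i < j, IncentivizedExploration.IsFakeData prior a.N₀ a.N i (a.κ j i)) →
          (∀ t < IncentivizedExploration.horizon prior a.N a.N₀ a.lam,
            IncentivizedExploration.IsBIC
              ((IncentivizedExploration.worldLaw prior).prod IncentivizedExploration.seedLaw)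
              (fun ω => ω.1.1) (IncentivizedExploration.recommendation prior a t)) ∧
          (∀ᵐ ω ∂((IncentivizedExploration.worldLaw prior).prod IncentivizedExploration.seedLaw),
            ∀ i : Fin K, N ≤
              ((Finset.range (IncentivizedExploration.horizon prior a.N a.N₀ a.lam)).filter
                fun t => IncentivizedExploration.recommendation prior a t ω = i).card) := by
  -- The value 4 makes 1/√N at most G/2, and 84 is the constant from the count of phases.
  refine ⟨4, by norm_num, 84, by norm_num, ?_⟩
  intro Cpad hC K _ prior _ N hK hanti hdom hboot hpad
  have hG := hdom.Gpad_pos hK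
  obtain ⟨hN, hsqrt⟩ := IncentivizedExploration.one_div_sqrt_le hG
    (IncentivizedExploration.Gpad_le_quarter hK hanti) hC hpad
  have hN' : 0 < N := by exact_mod_cast hN
  have hne := hdom.bootSet_nonempty hK
  have hz := fun j => hdom.zeros_pos hK j (IncentivizedExploration.Nboot prior)
  refine ⟨⟨hG, hne, hdom.pboot_pos hK⟩, ?_, ?_,
    IncentivizedExploration.horizon_le hdom hK hanti N, ?_⟩
  -- The padding G/10 is below G - 1/√N, which is at least G/2.
  · choose π hπ using fun j => IncentivizedExploration.exists_isSuitable prior hanti j hN'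
      (lam := IncentivizedExploration.Gpad prior / 10) (by linarith) (by linarith)
    exact ⟨π, fun j _ => hπ j⟩
  · have hκ : ∀ j i : Fin K, ∃ κ, i < j → IncentivizedExploration.IsFakeData prior
        (IncentivizedExploration.Nboot prior) N i κ := by
      intro j i
      by_cases hij : i < j
      · obtain ⟨κ, hκ⟩ := IncentivizedExploration.exists_isFakeData prior (i := i) hboot (by
          have h0 : IncentivizedExploration.worldLaw prior
              (IncentivizedExploration.zeros j (IncentivizedExploration.Nboot prior)) ≠ 0 :=
            (measureReal_ne_zero_iff).1 (hz j).ne'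
          -- Zeros of all arms before `j` include zeros of arm `i`, so the event to be conditioned
          -- on is not null.
          exact fun h => h0 (measure_mono_null (fun w hw => hw i hij) h))
        exact ⟨κ, fun _ => hκ⟩
      · exact ⟨fun l _ => l, fun h => absurd h hij⟩
    choose κ hκ using hκ
    exact ⟨κ, fun j i hij => hκ j i hij⟩
  · intro a haN haN₀ halam hsuit hfake
    have hA : a.Admissible prior :=
      { N_pos := haN ▸ hN'
        N₀_le := by rw [haN, haN₀]; exact hboot
        lam_pos := by rw [halam]; positivity
        zeros_pos := fun j => by rw [haN₀]; exact hz j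
        boot := by rw [haN₀]; exact Nat.sInf_mem hne
        antitone := hanti
        suitable := hsuit
        fake := hfake }
    refine ⟨fun t ht => hA.isBIC ht, .of_forall fun ω i => ?_⟩
    rw [← haN]
    exact hA.le_card_recommendation i ω
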